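/- Let $p$ be a prime, $r\ge 0$, and let $G$ be a cyclic group of order $p^r$ with subgroups $e=H_0<H_1<\dots<H_r=G$, $|H_k|=p^k$. For a finite $G$-set $X$ let $\Omega_G(X)$ be the Grothendieck ring of finite $G$-sets over $X$. These rings form the Burnside Tambara functor $\Omega_G$: for a $G$-map $f:X\to Y$, the restriction $f^*$ is given by fibre products, the additive transfer $f_+$ by composition with $f$, and the multiplicative transfer $f_\bullet$ is the (polynomial) extension to $\Omega_G(X)$ of $(A\xrightarrow{\pi}X)\mapsto(\Pi_f(A)\to Y)$, where $\Pi_f(A)=\{(y,\sigma)\mid y\in Y,\ \sigma:f^{-1}(y)\to A,\ \pi\circ\sigma=\mathrm{id}\}$. An ideal $\mathscr I$ of $\Omega_G$ is a family of ideals $\mathscr I(X)\subseteq\Omega_G(X)$, one for each finite $G$-set $X$, such that for all $f:X\to Y$ one has $f^*(\mathscr I(Y))\subseteq\mathscr I(X)$, $f_+(\mathscr I(X))\subseteq\mathscr I(Y)$ and $f_\bullet(\mathscr I(X))\subseteq f_\bullet(0)+\mathscr I(Y)$; ideals are ordered by inclusion for every $X$. A proper ideal $\mathscr I$ is prime if,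 for all transitive $X,Y$ and all $a\in\Omega_G(X)$, $b\in\Omega_G(Y)$, one has $a\in\mathscr I(X)$ or $b\in\mathscr I(Y)$ if and only if $$(v_\bullet w^*(a)-v_\bullet(0))\cdot(v'_\bullet w'^*(b)-v'_\bullet(0))\in\mathscr I(C)$$ for all finite $G$-sets $C$ and all pairs of diagrams $C\xleftarrow{v}D\xrightarrow{w}X$, $C\xleftarrow{v'}D'\xrightarrow{w'}Y$ of finite $G$-sets. $\mathrm{Spec}\,\Omega_G$ is the set of prime ideals. Put $R_k=\Omega_G(G/H_k)$, and let $\mathrm{res},\mathrm{ind},\mathrm{jnd}$ be the restriction, additive transfer and multiplicative transfer along $G/H_k\to G/H_{k+1}$. For an ideal $I\subseteq R_k$ let $L(I)=\mathrm{res}^{-1}(I)\subseteq R_{k+1}$, and let $S(I)\subseteq R_{k+1}$ be the ideal generated by $\mathrm{ind}(I)\cup\mathrm{jnd}(I)$. For a sequence $[I_0,\dots,I_m]$ of ideals $I_k\subseteq R_k$ put $\mathcal L[I_0,\dots,I_m]=[I_0,\dots,I_m,L(I_m)]$ and $\mathcal S[I_0,\dots,I_m]=[I_0,\dots,I_m,S(I_m)]$;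 powers denote iterates, $(n)$ denotes the ideal of $R_0$ generated by the integer $n$ (seen as a sequence of length one), and $\mathcal L^i(0)$ is obtained by applying $\mathcal L^i$ to the sequence $[0,\dots,0]$ with $r-i+1$ terms. A sequence $[I_0,\dots,I_r]$ is identified with the family $\mathscr I$ in which $\mathscr I(X)$ consists of the elements of $\Omega_G(X)$ whose restriction along every $G$-map $G/H_k\to X$, $0\le k\le r$, lies in $I_k$. We say that a prime ideal $\mathscr I$ lies over the ideal $\mathscr I(G/H_0)$ of $R_0$. Theorem. $R_0\cong\mathbb Z$ as rings. Each family named in (i), (ii), (iii) below has value at $G/H_k$ equal to the $k$-th term of its sequence, for every $0\le k\le r$, and: (i) For every prime $q\ne p$, there are exactly $r+1$ prime ideals of $\Omega_G$ over $(q)$, and they form the chain $$\mathcal S^r(q)\subsetneq\mathcal L\mathcal S^{r-1}(q)\subsetneq\dots\subsetneq\mathcal L^r(q).$$ (ii) There is exactly one prime ideal of $\Omega_G$ over $(p)$, namely $\mathcal L^r(p)$. (iii) There are exactly $r+1$ prime ideals of $\Omega_G$ over $0\subseteq R_0$, and they form the chain $$0\subsetneq\mathcal L(0)\subsetneq\dots\subsetneq\mathcal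 L^r(0),$$ whose first term $\mathcal L^0(0)$ is the zero ideal of $\Omega_G$. Consequently $$\mathrm{Spec}\,\Omega_G=\{\mathcal L^r(p)\}\cup\{\mathcal L^i(0)\mid 0\le i\le r\}\cup\{\mathcal L^i\mathcal S^{r-i}(q)\mid 0\le i\le r,\ q\ne p\text{ prime}\}.$$ -/

import Mathlib

universe u

/-! ## The Grothendieck ring of a commutative semiring -/

/-- The Grothendieck ring of a commutative semiring: the formal differences of its elements. -/
def GrothendieckRing (S : Type*) [CommSemiring S] : Type _ := Algebra.GrothendieckAddGroup S

namespace GrothendieckRing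

variable {S T : Type*} [CommSemiring S] [CommSemiring T]

noncomputable instance instAddCommGroup : AddCommGroup (GrothendieckRing S) :=
  inferInstanceAs (AddCommGroup (Algebra.GrothendieckAddGroup S))

/-- The class of an element of the semiring, as an additive map. -/
noncomputable def ofAdd : S →+ GrothendieckRing S :=
  Algebra.GrothendieckAddGroup.of (M := S)

/-- Additive maps into a group extend to the Grothendieck ring. -/
noncomputable def liftAdd {A : Type*} [AddCommGroup A] (f : S →+ A) : GrothendieckRing S →+ A :=
  Algebra.GrothendieckAddGroup.lift f

theorem mk_eq (a : S) (b : (⊤ : AddSubmonoid S)) :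
    (AddLocalization.mk a b : Algebra.GrothendieckAddGroup S) =
      Algebra.GrothendieckAddGroup.of a - Algebra.GrothendieckAddGroup.of (b : S) := by
  have h (c : S) : Algebra.GrothendieckAddGroup.of c =
      (AddLocalization.mk c 0 : Algebra.GrothendieckAddGroup S) :=
    (AddLocalization.mk_zero_eq_addMonoidOf_mk (S := (⊤ : AddSubmonoid S)) c).symm
  rw [h, h, Algebra.GrothendieckAddGroup.mk_sub_mk]
  simp

theorem exists_eq_sub (x : GrothendieckRing S) : ∃ a b : S, x = ofAdd a - ofAdd b := by
  induction x using AddLocalization.ind with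
  | H y => exact ⟨y.1, y.2, mk_eq y.1 y.2⟩

theorem liftAdd_ofAdd {A : Type*} [AddCommGroup A] (f : S →+ A) (a : S) :
    liftAdd f (ofAdd a) = f a :=
  DFunLike.congr_fun (Algebra.GrothendieckAddGroup.lift.symm_apply_apply f) a

/-- The product `(a - b) * (c - d) = (a * c + b * d) - (a * d + b * c)`, as a biadditive map. -/
noncomputable def mulHom : GrothendieckRing S →+ GrothendieckRing S →+ GrothendieckRing S :=
  liftAdd
    { toFun := fun a => liftAdd ((ofAdd (S := S)).comp (AddMonoidHom.mulLeft a))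
      map_zero' := by
        ext x
        obtain ⟨a, b, rfl⟩ := exists_eq_sub x
        simp [liftAdd_ofAdd]
      map_add' := fun c d => by
        ext x
        obtain ⟨a, b, rfl⟩ := exists_eq_sub x
        simp only [map_sub, liftAdd_ofAdd, AddMonoidHom.add_apply, AddMonoidHom.comp_apply,
          AddMonoidHom.coe_mulLeft, add_mul, map_add] }

theorem mulHom_ofAdd (a b : S) : mulHom (ofAdd a) (ofAdd b) = ofAdd (a * b) := by
  simp [mulHom, liftAdd_ofAdd]

noncomputable instance instCommRing : CommRing (GrothendieckRing S) where
  __ := instAddCommGroup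
  mul x y := mulHom x y
  one := ofAdd 1
  left_distrib x y z := map_add (mulHom x) y z
  right_distrib x y z := by
    change mulHom (x + y) z = mulHom x z + mulHom y z
    rw [map_add, AddMonoidHom.add_apply]
  zero_mul x := by
    change mulHom 0 x = 0
    rw [map_zero, AddMonoidHom.zero_apply]
  mul_zero x := map_zero (mulHom x)
  mul_assoc x y z := by
    change mulHom (mulHom x y) z = mulHom x (mulHom y z)
    obtain ⟨a, b, rfl⟩ := exists_eq_sub x
    obtain ⟨c, d, rfl⟩ := exists_eq_sub y
    obtain ⟨e, f, rfl⟩ := exists_eq_sub z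
    simp only [map_sub, AddMonoidHom.sub_apply, mulHom_ofAdd, mul_assoc]
  one_mul x := by
    change mulHom (ofAdd 1) x = x
    obtain ⟨a, b, rfl⟩ := exists_eq_sub x
    simp only [map_sub, mulHom_ofAdd, one_mul]
  mul_one x := by
    change mulHom x (ofAdd 1) = x
    obtain ⟨a, b, rfl⟩ := exists_eq_sub x
    simp only [map_sub, AddMonoidHom.sub_apply, mulHom_ofAdd, mul_one]
  mul_comm x y := by
    change mulHom x y = mulHom y x
    obtain ⟨a, b, rfl⟩ := exists_eq_sub x
    obtain ⟨c, d, rfl⟩ := exists_eq_sub y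
    simp only [map_sub, AddMonoidHom.sub_apply, mulHom_ofAdd, mul_comm]
    abel
  zsmul := instAddCommGroup.zsmul
  zsmul_zero' := instAddCommGroup.zsmul_zero'
  zsmul_succ' := instAddCommGroup.zsmul_succ'
  zsmul_neg' := instAddCommGroup.zsmul_neg'

/-- The class of an element of the semiring. -/
noncomputable def of : S →+* GrothendieckRing S where
  __ := ofAdd
  map_one' := rfl
  map_mul' a b := (mulHom_ofAdd a b).symm

/-- The additive map of Grothendieck rings induced by an additive map of semirings. -/
noncomputable def mapAdd (f : S →+ T) : GrothendieckRing S →+ GrothendieckRing T :=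
  liftAdd ((of (S := T)).toAddMonoidHom.comp f)

/-- The ring homomorphism of Grothendieck rings induced by a homomorphism of semirings. -/
noncomputable def map (f : S →+* T) : GrothendieckRing S →+* GrothendieckRing T where
  __ := mapAdd f.toAddMonoidHom
  map_one' := by
    change liftAdd _ (ofAdd 1) = ofAdd 1
    rw [liftAdd_ofAdd]
    change ofAdd (f 1) = _
    rw [map_one]
  map_mul' x y := by
    change mapAdd _ (mulHom x y) = mulHom (mapAdd _ x) (mapAdd _ y)
    have h (a : S) : mapAdd f.toAddMonoidHom (ofAdd a) = ofAdd (f a) := liftAdd_ofAdd _ a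
    obtain ⟨a, b, rfl⟩ := exists_eq_sub x
    obtain ⟨c, d, rfl⟩ := exists_eq_sub y
    simp only [map_sub, AddMonoidHom.sub_apply, mulHom_ofAdd, h, map_mul]

/-- A function `φ a b` of pairs with `φ (a + c) (b + c) = φ a b`, seen as a function of the formal
difference `a - b`. -/
noncomputable def liftSub {A : Sort*} (φ : S → S → A)
    (hφ : ∀ a b c, φ (a + c) (b + c) = φ a b) (x : GrothendieckRing S) : A :=
  AddLocalization.liftOn (S := (⊤ : AddSubmonoid S)) x (fun a b => φ a b) (by
    intro a c b d h
    obtain ⟨e, he⟩ := AddLocalization.r_iff_exists.mp h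
    change (e : S) + ((d : S) + a) = e + (b + c) at he
    rw [← hφ a b (d + e), ← hφ c d (b + e)]
    congr 1
    · calc a + ((d : S) + e) = e + (d + a) := by ring
        _ = c + (b + e) := by rw [he]; ring
    · ring)

theorem liftSub_of_sub {A : Sort*} (φ : S → S → A)
    (hφ : ∀ a b c, φ (a + c) (b + c) = φ a b) (a b : S) :
    liftSub φ hφ (of a - of b) = φ a b := by
  have h : of a - of b = (AddLocalization.mk a ⟨b, trivial⟩ : Algebra.GrothendieckAddGroup S) :=
    (mk_eq a ⟨b, trivial⟩).symm
  rw [h]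
  rfl

end GrothendieckRing

/-! ## Finite `G`-sets over `X` -/

namespace Burnside

/-- A finite `G`-set `A` together with a `G`-map `A → X`. -/
structure GSetOver (G : Type u) [Group G] (X : Type u) [MulAction G X] where
  carrier : Type u
  [action : MulAction G carrier]
  [finite : Finite carrier]
  proj : carrier →[G] X

namespace GSetOver

variable {G : Type u} [Group G] {X : Type u} [MulAction G X] {Y : Type u} [MulAction G Y]

instance : CoeSort (GSetOver G X) (Type u) := ⟨GSetOver.carrier⟩

instance (A : GSetOver G X) : MulAction G A := A.action

instance (A : GSetOver G X) : Finite A := A.finite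

/-- An isomorphism of `G`-sets over `X`. -/
def Iso (A B : GSetOver G X) : Prop :=
  ∃ e : A ≃ B, (∀ (g : G) (a : A), e (g • a) = g • e a) ∧ ∀ a : A, B.proj (e a) = A.proj a

variable (G X) in
/-- Isomorphism of finite `G`-sets over `X`. -/
instance isoSetoid : Setoid (GSetOver G X) where
  r := Iso
  iseqv :=
    { refl := fun _ => ⟨Equiv.refl _, fun _ _ => rfl, fun _ => rfl⟩
      symm := by
        rintro A B ⟨e, he, hp⟩
        refine ⟨e.symm, fun g b => ?_, fun b => ?_⟩
        · rw [Equiv.symm_apply_eq, he, Equiv.apply_symm_apply]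
        · rw [← hp, Equiv.apply_symm_apply]
      trans := by
        rintro A B C ⟨e, he, hp⟩ ⟨e', he', hp'⟩
        exact ⟨e.trans e', fun g a => by simp [he, he'], fun a => by simp [hp, hp']⟩ }

theorem iso_of_bijective {A B : GSetOver G X} (φ : A → B) (hφ : Function.Bijective φ)
    (hg : ∀ (g : G) (a : A), φ (g • a) = g • φ a) (hp : ∀ a : A, B.proj (φ a) = A.proj a) :
    A ≈ B :=
  ⟨Equiv.ofBijective φ hφ, hg, hp⟩

theorem proj_smul (A : GSetOver G X) (g : G) (a : A) : A.proj (g • a) = g • A.proj a :=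
  map_smul A.proj g a

instance emptyAction : MulAction G PEmpty.{u + 1} where
  smul _ a := a
  one_smul a := a.elim
  mul_smul _ _ a := a.elim

/-- The empty `G`-set over `X`. -/
def empty : GSetOver G X where
  carrier := PEmpty
  proj := { toFun := fun a => a.elim, map_smul' := fun _ a => a.elim }

/-- The identity `X → X`. -/
def self [Finite X] : GSetOver G X where
  carrier := X
  proj := MulActionHom.id G

/-- The disjoint union. -/
def sum (A B : GSetOver G X) : GSetOver G X where
  carrier := A ⊕ B
  proj :=
    { toFun := Sum.elim A.proj B.proj
      map_smul' := by
        rintro g (a | a)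
        · exact A.proj_smul g a
        · exact B.proj_smul g a }

/-- A point of the fibre product `A ×_Y X`. -/
@[ext]
structure FibrePt (f : X →[G] Y) (A : GSetOver G Y) where
  fst : A
  snd : X
  eq : A.proj fst = f snd

namespace FibrePt

variable {f : X →[G] Y} {A : GSetOver G Y}

instance : MulAction G (FibrePt f A) where
  smul g z := ⟨g • z.fst, g • z.snd, by rw [A.proj_smul, map_smul, z.eq]⟩
  one_smul z := FibrePt.ext (one_smul G z.fst) (one_smul G z.snd)
  mul_smul g h z := FibrePt.ext (mul_smul g h z.fst) (mul_smul g h z.snd)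

instance [Finite X] : Finite (FibrePt f A) :=
  Finite.of_injective (β := A × X) (fun z => (z.fst, z.snd)) fun _ _ h =>
    FibrePt.ext (congrArg Prod.fst h) (congrArg Prod.snd h)

theorem sumElim_injective {B : GSetOver G Y} : Function.Injective
    (Sum.elim (fun z => ⟨Sum.inl z.fst, z.snd, z.eq⟩) (fun z => ⟨Sum.inr z.fst, z.snd, z.eq⟩) :
      FibrePt f A ⊕ FibrePt f B → FibrePt f (sum A B)) := by
  rintro (z | z) (w | w) h
  · have h₁ := congrArg FibrePt.fst h
    have h₂ := congrArg FibrePt.snd h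
    exact congrArg Sum.inl (FibrePt.ext (Sum.inl.inj h₁) h₂)
  · exact absurd (congrArg FibrePt.fst h) Sum.inl_ne_inr
  · exact absurd (congrArg FibrePt.fst h) Sum.inr_ne_inl
  · have h₁ := congrArg FibrePt.fst h
    have h₂ := congrArg FibrePt.snd h
    exact congrArg Sum.inr (FibrePt.ext (Sum.inr.inj h₁) h₂)

end FibrePt

/-- The fibre product `A ×_Y X` of a `G`-set `A` over `Y` and a `G`-map `f : X → Y`, as a `G`-set
over `X`. -/
def pullback [Finite X] (f : X →[G] Y) (A : GSetOver G Y) : GSetOver G X where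
  carrier := FibrePt f A
  proj := { toFun := fun z => z.snd, map_smul' := fun _ _ => rfl }

/-- The composite `A → X → Y`. -/
def push (f : X →[G] Y) (A : GSetOver G X) : GSetOver G Y where
  carrier := A
  proj := f.comp A.proj

/-- The fibre product `A ×_X B`, as a `G`-set over `X`. -/
def prod (A B : GSetOver G X) : GSetOver G X :=
  push B.proj (pullback B.proj A)

/-- An element `(y, σ)` of `Π_f(A)`: a point `y` of `Y` and a map of sets `σ : f⁻¹(y) → A` with
`p ∘ σ = id`, where `p : A → X` is the structure map. -/
@[ext]
structure Sec (f : X →[G] Y) (A : GSetOver G X) where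
  base : Y
  sec : ∀ x : X, f x = base → A
  proj_sec : ∀ (x : X) (h : f x = base), A.proj (sec x h) = x

namespace Sec

variable {f : X →[G] Y} {A : GSetOver G X}

theorem ext_sec {s t : Sec f A} (hb : s.base = t.base)
    (h : ∀ x hs ht, s.sec x hs = t.sec x ht) : s = t := by
  obtain ⟨b, σ, hσ⟩ := s
  obtain ⟨c, τ, hτ⟩ := t
  obtain rfl : b = c := hb
  obtain rfl : σ = τ := by
    funext x hx
    exact h x hx hx
  rfl

theorem sec_congr (s : Sec f A) {x y : X} (h : x = y) (hx : f x = s.base) (hy : f y = s.base) :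
    s.sec x hx = s.sec y hy := by
  subst h
  rfl

/-- The action `g • (y, σ) = (g • y, x ↦ g • σ (g⁻¹ • x))`. -/
instance : MulAction G (Sec f A) where
  smul g s :=
    { base := g • s.base
      sec := fun x h => g • s.sec (g⁻¹ • x) (by rw [map_smul, h, inv_smul_smul])
      proj_sec := fun x h => by rw [A.proj_smul, s.proj_sec, smul_inv_smul] }
  one_smul s := by
    refine ext_sec (one_smul G s.base) fun x hs ht => ?_
    change (1 : G) • s.sec ((1 : G)⁻¹ • x) _ = s.sec x ht
    rw [one_smul]
    exact s.sec_congr (by simp) _ _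
  mul_smul g h s := by
    refine ext_sec (mul_smul g h s.base) fun x hs ht => ?_
    change (g * h) • s.sec ((g * h)⁻¹ • x) _ = g • h • s.sec (h⁻¹ • g⁻¹ • x) _
    rw [mul_smul]
    congr 2
    exact s.sec_congr (by rw [mul_inv_rev, mul_smul]) _ _

theorem smul_base (g : G) (s : Sec f A) : (g • s).base = g • s.base := rfl

theorem smul_sec (g : G) (s : Sec f A) (x : X) (h : f x = (g • s).base) :
    (g • s).sec x h = g • s.sec (g⁻¹ • x) (by rw [map_smul, h, smul_base, inv_smul_smul]) := rfl

theorem smul_sec_smul (g : G) (s : Sec f A) (x : X) (h : f x = s.base)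
    (h' : f (g • x) = (g • s).base) : (g • s).sec (g • x) h' = g • s.sec x h := by
  rw [smul_sec]
  congr 1
  exact s.sec_congr (inv_smul_smul g x) _ _

/-- The map `Π_f(A) → Π_f(B)` induced by a map `A → B` over `X`. -/
def map {B : GSetOver G X} (φ : A → B) (hφ : ∀ a, B.proj (φ a) = A.proj a) (s : Sec f A) :
    Sec f B :=
  ⟨s.base, fun x h => φ (s.sec x h), fun x h => by rw [hφ, s.proj_sec]⟩

theorem sec_eq_of_eq {s t : Sec f A} (h : s = t) (x : X) (hs : f x = s.base)
    (ht : f x = t.base) : s.sec x hs = t.sec x ht := by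
  subst h
  rfl

theorem map_injective {B : GSetOver G X} (φ : A → B) (hφ : ∀ a, B.proj (φ a) = A.proj a)
    (hi : Function.Injective φ) : Function.Injective (map (f := f) φ hφ) := fun _ _ h =>
  ext_sec (congrArg (fun u : Sec f B => u.base) h) fun x hs ht =>
    hi (sec_eq_of_eq h x hs ht)

instance [Finite X] [Finite Y] : Finite (Sec f A) := by
  classical
  refine Finite.of_injective (β := Y × (X → Option A))
    (fun s => (s.base, fun x => if h : f x = s.base then some (s.sec x h) else none)) ?_
  intro s t h
  simp only [Prod.mk.injEq] at h
  refine ext_sec h.1 fun x hs ht => ?_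
  have := congrFun h.2 x
  rw [dif_pos hs, dif_pos ht] at this
  exact Option.some.inj this

end Sec

/-- The `G`-set `Π_f(A)` over `Y`. -/
def dprod [Finite X] [Finite Y] (f : X →[G] Y) (A : GSetOver G X) : GSetOver G Y where
  carrier := Sec f A
  proj := { toFun := fun s => s.base, map_smul' := fun _ _ => rfl }

end GSetOver

/-! ## The Burnside semiring -/

/-- The semiring of isomorphism classes of finite `G`-sets over `X`. -/
def Semi (G : Type u) [Group G] (X : Type u) [MulAction G X] : Type (u + 1) :=
  Quotient (GSetOver.isoSetoid G X)

namespace Semi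

open GSetOver

variable {G : Type u} [Group G] {X : Type u} [MulAction G X] {Y : Type u} [MulAction G Y]

/-- The isomorphism class. -/
def mk (A : GSetOver G X) : Semi G X := Quotient.mk _ A

theorem mk_eq_of_bijective {A B : GSetOver G X} (φ : A → B) (hφ : Function.Bijective φ)
    (hg : ∀ (g : G) (a : A), φ (g • a) = g • φ a) (hp : ∀ a : A, B.proj (φ a) = A.proj a) :
    mk A = mk B :=
  Quotient.sound (iso_of_bijective φ hφ hg hp)

theorem mk_eq_of_equiv {A B : GSetOver G X} (e : A ≃ B)
    (hg : ∀ (g : G) (a : A), e (g • a) = g • e a) (hp : ∀ a : A, B.proj (e a) = A.proj a) :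
    mk A = mk B :=
  Quotient.sound ⟨e, hg, hp⟩

theorem ind {P : Semi G X → Prop} (h : ∀ A, P (mk A)) (a : Semi G X) : P a :=
  Quotient.ind h a

instance : Zero (Semi G X) := ⟨mk empty⟩

instance [Finite X] : One (Semi G X) := ⟨mk self⟩

instance : Add (Semi G X) :=
  ⟨Quotient.map₂ sum (by
    rintro A A' ⟨e, he, hp⟩ B B' ⟨e', he', hp'⟩
    refine ⟨Equiv.sumCongr e e', ?_, ?_⟩
    · rintro g (a | a)
      · exact congrArg Sum.inl (he g a)
      · exact congrArg Sum.inr (he' g a)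
    · rintro (a | a)
      · exact hp a
      · exact hp' a)⟩

/-- The pullback of isomorphism classes. -/
def pull [Finite X] (f : X →[G] Y) : Semi G Y → Semi G X :=
  Quotient.map (pullback f) (by
    rintro A B ⟨e, he, hp⟩
    refine iso_of_bijective (A := pullback f A) (B := pullback f B)
      (fun z => ⟨e z.fst, z.snd, by rw [hp, z.eq]⟩) ⟨?_, ?_⟩ ?_ ?_
    · intro z w h
      have h₁ := congrArg FibrePt.fst h
      have h₂ := congrArg FibrePt.snd h
      exact FibrePt.ext (e.injective h₁) h₂
    · intro z
      refine ⟨⟨e.symm z.fst, z.snd, ?_⟩, ?_⟩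
      · rw [← hp, Equiv.apply_symm_apply]
        exact z.eq
      · exact FibrePt.ext (e.apply_symm_apply _) rfl
    · intro g z
      exact FibrePt.ext (he g z.fst) rfl
    · intro z
      rfl)

/-- The pushforward of isomorphism classes. -/
def push (f : X →[G] Y) : Semi G X → Semi G Y :=
  Quotient.map (GSetOver.push f) (by
    rintro A B ⟨e, he, hp⟩
    exact ⟨e, he, fun a => congrArg f (hp a)⟩)

instance : Mul (Semi G X) :=
  ⟨Quotient.map₂ prod (by
    rintro A A' ⟨e, he, hp⟩ B B' ⟨e', he', hp'⟩
    refine iso_of_bijective (A := prod A B) (B := prod A' B')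
      (fun z => ⟨e z.fst, e' z.snd, by rw [hp, hp', z.eq]⟩) ⟨?_, ?_⟩ ?_ ?_
    · intro z w h
      exact FibrePt.ext (e.injective (congrArg FibrePt.fst h))
        (e'.injective (congrArg FibrePt.snd h))
    · intro z
      refine ⟨⟨e.symm z.fst, e'.symm z.snd, ?_⟩, ?_⟩
      · rw [← hp, ← hp', Equiv.apply_symm_apply, Equiv.apply_symm_apply]
        exact z.eq
      · exact FibrePt.ext (e.apply_symm_apply _) (e'.apply_symm_apply _)
    · intro g z
      exact FibrePt.ext (he g z.fst) (he' g z.snd)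
    · intro z
      exact hp' z.snd)⟩

/-- The class of `Π_f(A)`, as a function of the class of `A`. -/
def norm [Finite X] [Finite Y] (f : X →[G] Y) : Semi G X → Semi G Y :=
  Quotient.map (dprod f) (by
    rintro A B ⟨e, he, hp⟩
    refine iso_of_bijective (A := dprod f A) (B := dprod f B) (Sec.map e hp)
      ⟨Sec.map_injective e hp e.injective, fun t => ?_⟩ ?_ ?_
    · refine ⟨⟨t.base, fun x h => e.symm (t.sec x h), fun x h => by
        rw [← hp, Equiv.apply_symm_apply, t.proj_sec]⟩, ?_⟩
      exact Sec.ext_sec rfl fun x hs ht => e.apply_symm_apply _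
    · intro g s
      exact Sec.ext_sec rfl fun x hs ht => he g _
    · intro s
      rfl)

theorem mk_add (A B : GSetOver G X) : mk A + mk B = mk (sum A B) := rfl

theorem mk_mul (A B : GSetOver G X) : mk A * mk B = mk (prod A B) := rfl

protected theorem add_assoc' (a b c : Semi G X) : a + b + c = a + (b + c) := by
  induction a using ind with | _ A
  induction b using ind with | _ B
  induction c using ind with | _ C
  refine mk_eq_of_equiv (Equiv.sumAssoc A B C) ?_ ?_
  · rintro g ((a | a) | a) <;> rfl
  · rintro ((a | a) | a) <;> rfl

protected theorem add_comm' (a b : Semi G X) : a + b = b + a := by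
  induction a using ind with | _ A
  induction b using ind with | _ B
  refine mk_eq_of_equiv (Equiv.sumComm A B) ?_ ?_
  · rintro g (a | a) <;> rfl
  · rintro (a | a) <;> rfl

protected theorem zero_add' (a : Semi G X) : 0 + a = a := by
  induction a using ind with | _ A
  refine mk_eq_of_equiv (Equiv.emptySum PEmpty A) ?_ ?_
  · rintro g (a | a)
    · exact a.elim
    · rfl
  · rintro (a | a)
    · exact a.elim
    · rfl

protected theorem mul_comm' (a b : Semi G X) : a * b = b * a := by
  induction a using ind with | _ A
  induction b using ind with | _ B
  refine mk_eq_of_bijective (A := prod A B) (B := prod B A)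
    (fun z => ⟨z.snd, z.fst, z.eq.symm⟩) ⟨?_, ?_⟩ ?_ ?_
  · intro z w h
    exact FibrePt.ext (congrArg FibrePt.snd h) (congrArg FibrePt.fst h)
  · intro z
    exact ⟨⟨z.snd, z.fst, z.eq.symm⟩, rfl⟩
  · intro g z
    rfl
  · intro z
    exact z.eq

protected theorem mul_assoc' (a b c : Semi G X) : a * b * c = a * (b * c) := by
  induction a using ind with | _ A
  induction b using ind with | _ B
  induction c using ind with | _ C
  refine mk_eq_of_bijective (A := prod (prod A B) C) (B := prod A (prod B C))
    (fun z => ⟨z.fst.fst, ⟨z.fst.snd, z.snd, z.eq⟩, z.fst.eq.trans z.eq⟩) ⟨?_, ?_⟩ ?_ ?_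
  · intro z w h
    have h₁ := congrArg FibrePt.fst h
    have h₂ := congrArg FibrePt.snd h
    have h₃ := congrArg FibrePt.fst h₂
    have h₄ := congrArg FibrePt.snd h₂
    exact FibrePt.ext (FibrePt.ext h₁ h₃) h₄
  · intro z
    exact ⟨⟨⟨z.fst, z.snd.fst, z.eq.trans z.snd.eq.symm⟩, z.snd.snd, z.snd.eq⟩, rfl⟩
  · intro g z
    rfl
  · intro z
    rfl

protected theorem one_mul' [Finite X] (a : Semi G X) : 1 * a = a := by
  induction a using ind with | _ A
  refine mk_eq_of_bijective (A := prod self A) (B := A) (fun z => z.snd) ⟨?_, ?_⟩ ?_ ?_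
  · intro z w (h : z.snd = w.snd)
    exact FibrePt.ext (z.eq.trans ((congrArg A.proj h).trans w.eq.symm)) h
  · intro a
    exact ⟨⟨A.proj a, a, rfl⟩, rfl⟩
  · intro g z
    rfl
  · intro z
    rfl

protected theorem zero_mul' (a : Semi G X) : 0 * a = 0 := by
  induction a using ind with | _ A
  exact mk_eq_of_bijective (A := prod empty A) (B := empty) (fun z => z.fst)
    ⟨fun z => z.fst.elim, fun z => z.elim⟩ (fun _ z => z.fst.elim) (fun z => z.fst.elim)

protected theorem add_mul' (a b c : Semi G X) : (a + b) * c = a * c + b * c := by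
  induction a using ind with | _ A
  induction b using ind with | _ B
  induction c using ind with | _ C
  symm
  refine mk_eq_of_bijective (A := sum (prod A C) (prod B C)) (B := prod (sum A B) C)
    (Sum.elim (fun z => ⟨Sum.inl z.fst, z.snd, z.eq⟩) (fun z => ⟨Sum.inr z.fst, z.snd, z.eq⟩))
    ⟨?_, ?_⟩ ?_ ?_
  · exact FibrePt.sumElim_injective
  · rintro ⟨a | a, c, h⟩
    · exact ⟨Sum.inl ⟨a, c, h⟩, rfl⟩
    · exact ⟨Sum.inr ⟨a, c, h⟩, rfl⟩
  · rintro g (z | z) <;> rfl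
  · rintro (z | z) <;> rfl

instance : AddCommMonoid (Semi G X) where
  add_assoc := Semi.add_assoc'
  zero_add := Semi.zero_add'
  add_zero a := (Semi.add_comm' a 0).trans (Semi.zero_add' a)
  add_comm := Semi.add_comm'
  nsmul := nsmulRec

instance [Finite X] : CommSemiring (Semi G X) where
  mul_assoc := Semi.mul_assoc'
  one_mul := Semi.one_mul'
  mul_one a := (Semi.mul_comm' a 1).trans (Semi.one_mul' a)
  zero_mul := Semi.zero_mul'
  mul_zero a := (Semi.mul_comm' a 0).trans (Semi.zero_mul' a)
  right_distrib := Semi.add_mul'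
  left_distrib a b c := by
    rw [Semi.mul_comm' a, Semi.add_mul', Semi.mul_comm' b, Semi.mul_comm' c]
  mul_comm := Semi.mul_comm'

/-- Pullback is a homomorphism of semirings. -/
def pullHom [Finite X] [Finite Y] (f : X →[G] Y) : Semi G Y →+* Semi G X where
  toFun := pull f
  map_zero' :=
    mk_eq_of_bijective (A := pullback f empty) (B := empty) (fun z => z.fst)
      ⟨fun z => z.fst.elim, fun z => z.elim⟩ (fun _ z => z.fst.elim) (fun z => z.fst.elim)
  map_one' := by
    refine mk_eq_of_bijective (A := pullback f self) (B := self) (fun z => z.snd) ⟨?_, ?_⟩ ?_ ?_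
    · intro z w (h : z.snd = w.snd)
      exact FibrePt.ext (z.eq.trans ((congrArg f h).trans w.eq.symm)) h
    · intro x
      exact ⟨⟨f x, x, rfl⟩, rfl⟩
    · intro g z
      rfl
    · intro z
      rfl
  map_add' a b := by
    induction a using ind with | _ A
    induction b using ind with | _ B
    symm
    refine mk_eq_of_bijective (A := sum (pullback f A) (pullback f B))
      (B := pullback f (sum A B))
      (Sum.elim (fun z => ⟨Sum.inl z.fst, z.snd, z.eq⟩) (fun z => ⟨Sum.inr z.fst, z.snd, z.eq⟩))
      ⟨?_, ?_⟩ ?_ ?_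
    · exact FibrePt.sumElim_injective
    · rintro ⟨a | a, c, h⟩
      · exact ⟨Sum.inl ⟨a, c, h⟩, rfl⟩
      · exact ⟨Sum.inr ⟨a, c, h⟩, rfl⟩
    · rintro g (z | z) <;> rfl
    · rintro (z | z) <;> rfl
  map_mul' a b := by
    induction a using ind with | _ A
    induction b using ind with | _ B
    refine mk_eq_of_bijective (A := pullback f (prod A B))
      (B := prod (pullback f A) (pullback f B))
      (fun z => ⟨⟨z.fst.fst, z.snd, z.fst.eq.trans z.eq⟩, ⟨z.fst.snd, z.snd, z.eq⟩, rfl⟩)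
      ⟨?_, ?_⟩ ?_ ?_
    · intro z w h
      have h₁ := congrArg FibrePt.fst h
      have h₂ := congrArg FibrePt.snd h
      have h₃ := congrArg FibrePt.fst h₁
      have h₄ := congrArg FibrePt.fst h₂
      have h₅ := congrArg FibrePt.snd h₂
      exact FibrePt.ext (FibrePt.ext h₃ h₄) h₅
    · rintro ⟨⟨a, x, h₁⟩, ⟨b, x', h₂⟩, h₃⟩
      obtain rfl : x = x' := h₃
      exact ⟨⟨⟨a, b, h₁.trans h₂.symm⟩, x, h₂⟩, rfl⟩
    · intro g z
      rfl
    · intro z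
      rfl

/-- Pushforward is additive. -/
def pushHom (f : X →[G] Y) : Semi G X →+ Semi G Y where
  toFun := push f
  map_zero' := by
    refine mk_eq_of_equiv (Equiv.refl _) ?_ ?_
    · exact fun g x => x.elim
    · exact fun x => x.elim
  map_add' a b := by
    induction a using ind with | _ A
    induction b using ind with | _ B
    refine mk_eq_of_equiv (Equiv.refl _) ?_ ?_
    · rintro g (a | a) <;> rfl
    · rintro (a | a) <;> rfl

end Semi
end Burnside

/-! ## The extension of the multiplicative transfer to virtual `G`-sets -/

namespace Burnside
namespace GSetOver

variable {G : Type u} [Group G] {X : Type u} [MulAction G X] {Y : Type u} [MulAction G Y]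

/-- A point of the disjoint union of copies of `B` indexed by `J`. -/
@[ext]
structure CopyPt (B : GSetOver G X) (J : Type) where
  pt : B
  idx : J

instance (B : GSetOver G X) (J : Type) : MulAction G (CopyPt B J) where
  smul g z := ⟨g • z.pt, z.idx⟩
  one_smul z := CopyPt.ext (one_smul G z.pt) rfl
  mul_smul g h z := CopyPt.ext (mul_smul g h z.pt) rfl

instance (B : GSetOver G X) (J : Type) [Finite J] : Finite (CopyPt B J) :=
  Finite.of_injective (β := B × J) (fun z => (z.pt, z.idx)) fun _ _ h =>
    CopyPt.ext (congrArg Prod.fst h) (congrArg Prod.snd h)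

/-- The disjoint union of copies of `B` indexed by `J`. -/
def copies (B : GSetOver G X) (J : Type) [Finite J] : GSetOver G X where
  carrier := CopyPt B J
  proj := { toFun := fun z => B.proj z.pt, map_smul' := fun g z => B.proj_smul g z.pt }

/-- The sub-`G`-set of the points with an invariant property. -/
def sep (A : GSetOver G X) (P : A → Prop) (hP : ∀ (g : G) (a : A), P a → P (g • a)) :
    GSetOver G X where
  carrier := { a : A // P a }
  action :=
    { smul := fun g a => ⟨g • a.1, hP g a.1 a.2⟩
      one_smul := fun a => Subtype.ext (one_smul G a.1)
      mul_smul := fun g h a => Subtype.ext (mul_smul g h a.1) }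
  proj :=
    letI : SMul G { a : A // P a } := ⟨fun g a => ⟨g • a.1, hP g a.1 a.2⟩⟩
    { toFun := fun a => A.proj a.1, map_smul' := fun g a => A.proj_smul g a.1 }

/-- The disjoint union of `A`, of copies of `B` indexed by `J` and of copies of `C` indexed by
`L`. -/
abbrev tot (A B C : GSetOver G X) (J L : Type) [Finite J] [Finite L] : GSetOver G X :=
  sum A (sum (copies B J) (copies C L))

section Hit

variable {f : X →[G] Y} {A B C : GSetOver G X} {J L J' L' : Type} [Finite J] [Finite L]
  [Finite J'] [Finite L']

/-- The section meets the copy of `B` with index `j`. -/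
def HitB (s : Sec f (tot A B C J L)) (j : J) : Prop :=
  ∃ (x : X) (h : f x = s.base) (b : B), s.sec x h = Sum.inr (Sum.inl ⟨b, j⟩)

/-- The section meets the copy of `C` with index `l`. -/
def HitC (s : Sec f (tot A B C J L)) (l : L) : Prop :=
  ∃ (x : X) (h : f x = s.base) (c : C), s.sec x h = Sum.inr (Sum.inr ⟨c, l⟩)

theorem HitB.smul {s : Sec f (tot A B C J L)} {j : J} (h : HitB s j) (g : G) :
    HitB (g • s) j := by
  obtain ⟨x, hx, b, e⟩ := h
  refine ⟨g • x, by rw [map_smul, hx, Sec.smul_base], g • b, ?_⟩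
  rw [Sec.smul_sec_smul g s x hx, e]
  rfl

theorem HitC.smul {s : Sec f (tot A B C J L)} {l : L} (h : HitC s l) (g : G) :
    HitC (g • s) l := by
  obtain ⟨x, hx, c, e⟩ := h
  refine ⟨g • x, by rw [map_smul, hx, Sec.smul_base], g • c, ?_⟩
  rw [Sec.smul_sec_smul g s x hx, e]
  rfl

theorem hitB_smul_iff (g : G) (s : Sec f (tot A B C J L)) (j : J) :
    HitB (g • s) j ↔ HitB s j :=
  ⟨fun h => by simpa using h.smul g⁻¹, fun h => h.smul g⟩

theorem hitC_smul_iff (g : G) (s : Sec f (tot A B C J L)) (l : L) :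
    HitC (g • s) l ↔ HitC s l :=
  ⟨fun h => by simpa using h.smul g⁻¹, fun h => h.smul g⟩

/-- Relabelling of the copies. -/
def relabel (ι : J → J') (κ : L → L') : tot A B C J L → tot A B C J' L' :=
  Sum.map id (Sum.map (fun z => ⟨z.pt, ι z.idx⟩) (fun z => ⟨z.pt, κ z.idx⟩))

theorem relabel_injective {ι : J → J'} {κ : L → L'} (hι : Function.Injective ι)
    (hκ : Function.Injective κ) : Function.Injective (relabel (A := A) (B := B) (C := C) ι κ) := by
  refine Function.injective_id.sumMap (Function.Injective.sumMap ?_ ?_)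
  · intro z w h
    have h₁ := congrArg CopyPt.pt h
    have h₂ := congrArg CopyPt.idx h
    exact CopyPt.ext h₁ (hι h₂)
  · intro z w h
    have h₁ := congrArg CopyPt.pt h
    have h₂ := congrArg CopyPt.idx h
    exact CopyPt.ext h₁ (hκ h₂)

theorem proj_relabel (ι : J → J') (κ : L → L') (v : tot A B C J L) :
    (tot A B C J' L').proj (relabel ι κ v) = (tot A B C J L).proj v := by
  rcases v with a | b | c <;> rfl

theorem relabel_smul (ι : J → J') (κ : L → L') (g : G) (v : tot A B C J L) :
    relabel ι κ (g • v) = g • relabel ι κ v := by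
  rcases v with a | b | c <;> rfl

theorem hitB_map_iff {ι : J → J'} {κ : L → L'} (s : Sec f (tot A B C J L)) (j : J') :
    HitB (Sec.map (relabel ι κ) (proj_relabel ι κ) s) j ↔ ∃ i, ι i = j ∧ HitB s i := by
  constructor
  · rintro ⟨x, h, b, e⟩
    change relabel ι κ (s.sec x h) = _ at e
    rcases hv : s.sec x h with a | z | z
    · rw [hv] at e
      exact absurd e Sum.inl_ne_inr
    · rw [hv] at e
      have e' := Sum.inl.inj (Sum.inr.inj e)
      exact ⟨z.idx, congrArg CopyPt.idx e', x, h, z.pt, hv⟩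
    · rw [hv] at e
      exact absurd (Sum.inr.inj e) Sum.inr_ne_inl
  · rintro ⟨i, rfl, x, h, b, e⟩
    refine ⟨x, h, b, ?_⟩
    change relabel ι κ (s.sec x h) = _
    rw [e]
    rfl

theorem hitC_map_iff {ι : J → J'} {κ : L → L'} (s : Sec f (tot A B C J L)) (l : L') :
    HitC (Sec.map (relabel ι κ) (proj_relabel ι κ) s) l ↔ ∃ i, κ i = l ∧ HitC s i := by
  constructor
  · rintro ⟨x, h, b, e⟩
    change relabel ι κ (s.sec x h) = _ at e
    rcases hv : s.sec x h with a | z | z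
    · rw [hv] at e
      exact absurd e Sum.inl_ne_inr
    · rw [hv] at e
      exact absurd (Sum.inr.inj e) Sum.inl_ne_inr
    · rw [hv] at e
      have e' := Sum.inr.inj (Sum.inr.inj e)
      exact ⟨z.idx, congrArg CopyPt.idx e', x, h, z.pt, hv⟩
  · rintro ⟨i, rfl, x, h, b, e⟩
    refine ⟨x, h, b, ?_⟩
    change relabel ι κ (s.sec x h) = _
    rw [e]
    rfl

variable [Finite X] [Finite Y]

variable (f A B C) in
/-- The sections that meet exactly the copies with index in `S` and in `T`. -/
def hitExactly (S : Set J) (T : Set L) : GSetOver G Y :=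
  sep (dprod f (tot A B C J L))
    (fun s => (∀ j, HitB (f := f) s j ↔ j ∈ S) ∧ ∀ l, HitC (f := f) s l ↔ l ∈ T)
    (fun g s h => ⟨fun j => (hitB_smul_iff g s j).trans (h.1 j),
      fun l => (hitC_smul_iff g s l).trans (h.2 l)⟩)

end Hit

end GSetOver

namespace Semi

open GSetOver Finset

variable {G : Type u} [Group G] {X : Type u} [MulAction G X] {Y : Type u} [MulAction G Y]

theorem mk_copies (B : GSetOver G X) (j : ℕ) : mk (copies B (Fin j)) = j • mk B := by
  induction j with
  | zero =>
    rw [zero_nsmul]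
    exact mk_eq_of_bijective (A := copies B (Fin 0)) (B := empty) (fun z => z.idx.elim0)
      ⟨fun z => z.idx.elim0, fun z => z.elim⟩ (fun _ z => z.idx.elim0) (fun z => z.idx.elim0)
  | succ j ih =>
    rw [succ_nsmul, ← ih, mk_add]
    symm
    refine mk_eq_of_bijective (A := sum (copies B (Fin j)) B) (B := copies B (Fin (j + 1)))
      (Sum.elim (fun z => ⟨z.pt, z.idx.castSucc⟩) (fun b => ⟨b, Fin.last j⟩)) ⟨?_, ?_⟩ ?_ ?_
    · rintro (z | z) (w | w) h
      · have h₁ := congrArg CopyPt.pt h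
        have h₂ := congrArg CopyPt.idx h
        exact congrArg Sum.inl (CopyPt.ext h₁ (Fin.castSucc_injective j h₂))
      · exact absurd (congrArg CopyPt.idx h) (Fin.castSucc_lt_last _).ne
      · exact absurd (congrArg CopyPt.idx h) (Fin.castSucc_lt_last _).ne'
      · exact congrArg Sum.inr (congrArg CopyPt.pt h)
    · rintro ⟨b, i⟩
      induction i using Fin.lastCases with
      | last => exact ⟨Sum.inr b, rfl⟩
      | cast i => exact ⟨Sum.inl ⟨b, i⟩, rfl⟩
    · rintro g (z | z) <;> rfl
    · rintro (z | z) <;> rfl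

theorem mk_tot (A B C : GSetOver G X) (j l : ℕ) :
    mk (tot A B C (Fin j) (Fin l)) = mk A + (j • mk B + l • mk C) := by
  rw [← mk_copies, ← mk_copies]
  rfl

theorem mk_eq_sum_sep {ι : Type} [Fintype ι] [DecidableEq ι] (D : GSetOver G X) (κ : D → ι)
    (hκ : ∀ (g : G) (d : D), κ (g • d) = κ d) :
    mk D = ∑ i, mk (sep D (fun d => κ d = i) (fun g d h => (hκ g d).trans h)) := by
  have key (s : Finset ι) : mk (sep D (fun d => κ d ∈ s) (fun g d h => by rwa [hκ])) =
      ∑ i ∈ s, mk (sep D (fun d => κ d = i) (fun g d h => (hκ g d).trans h)) := by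
    induction s using Finset.induction_on with
    | empty =>
      rw [Finset.sum_empty]
      exact mk_eq_of_bijective (B := empty)
        (fun d => absurd d.2 (Finset.notMem_empty _))
        ⟨fun d => absurd d.2 (Finset.notMem_empty _), fun z => z.elim⟩
        (fun _ d => absurd d.2 (Finset.notMem_empty _))
        (fun d => absurd d.2 (Finset.notMem_empty _))
    | insert i s hi ih =>
      rw [Finset.sum_insert hi, ← ih, mk_add]
      symm
      refine mk_eq_of_bijective
        (Sum.elim (fun d => ⟨d.1, (congrArg (· ∈ insert i s) d.2).mpr (Finset.mem_insert_self i s)⟩)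
          (fun d => ⟨d.1, Finset.mem_insert_of_mem d.2⟩)) ⟨?_, ?_⟩ ?_ ?_
      · rintro (z | z) (w | w) h
        · have h' := congrArg Subtype.val h
          exact congrArg Sum.inl (Subtype.ext h')
        · have h' : z.1 = w.1 := congrArg Subtype.val h
          exact absurd (z.2 ▸ h' ▸ w.2 : i ∈ s) hi
        · have h' : z.1 = w.1 := congrArg Subtype.val h
          exact absurd (w.2 ▸ h' ▸ z.2 : i ∈ s) hi
        · have h' := congrArg Subtype.val h
          exact congrArg Sum.inr (Subtype.ext h')
      · rintro ⟨d, hd⟩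
        rcases Finset.mem_insert.mp hd with h | h
        · exact ⟨Sum.inl ⟨d, h⟩, rfl⟩
        · exact ⟨Sum.inr ⟨d, h⟩, rfl⟩
      · rintro g (z | z) <;> rfl
      · rintro (z | z) <;> rfl
  rw [← key Finset.univ]
  exact mk_eq_of_bijective (fun d => ⟨d, Finset.mem_univ _⟩)
    ⟨fun d e h => congrArg Subtype.val h, fun d => ⟨d.1, rfl⟩⟩ (fun _ _ => rfl) (fun _ => rfl)

variable [Finite X] [Finite Y]

theorem mk_hitExactly (f : X →[G] Y) (A B C : GSetOver G X) {j l : ℕ} (S : Finset (Fin j))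
    (T : Finset (Fin l)) :
    mk (hitExactly f A B C (S : Set (Fin j)) (T : Set (Fin l))) =
      mk (hitExactly f A B C (Set.univ : Set (Fin #S)) (Set.univ : Set (Fin #T))) := by
  symm
  set ι : Fin #S → Fin j := fun i => (S.equivFin.symm i).1 with hι
  set κ : Fin #T → Fin l := fun i => (T.equivFin.symm i).1 with hκ
  have iι : Function.Injective ι := Subtype.val_injective.comp S.equivFin.symm.injective
  have iκ : Function.Injective κ := Subtype.val_injective.comp T.equivFin.symm.injective
  have mι (i : Fin j) : i ∈ S ↔ ∃ k, ι k = i :=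
    ⟨fun h => ⟨S.equivFin ⟨i, h⟩, by simp [hι]⟩, by rintro ⟨k, rfl⟩; exact (S.equivFin.symm k).2⟩
  have mκ (i : Fin l) : i ∈ T ↔ ∃ k, κ k = i :=
    ⟨fun h => ⟨T.equivFin ⟨i, h⟩, by simp [hκ]⟩, by rintro ⟨k, rfl⟩; exact (T.equivFin.symm k).2⟩
  refine mk_eq_of_bijective (fun s => ⟨Sec.map (relabel ι κ) (proj_relabel ι κ) s.1, ?_, ?_⟩)
    ⟨?_, ?_⟩ ?_ ?_
  · intro i
    refine (hitB_map_iff s.1 i).trans (Iff.trans ?_ (mι i).symm)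
    exact exists_congr fun k => and_iff_left ((s.2.1 k).mpr trivial)
  · intro i
    refine (hitC_map_iff s.1 i).trans (Iff.trans ?_ (mκ i).symm)
    exact exists_congr fun k => and_iff_left ((s.2.2 k).mpr trivial)
  · intro s t h
    exact Subtype.ext (Sec.map_injective _ (proj_relabel ι κ) (relabel_injective iι iκ)
      (congrArg Subtype.val h))
  · rintro ⟨t, hB, hC⟩
    have lift (x : X) (h : f x = t.base) :
        ∃ v : tot A B C (Fin #S) (Fin #T), relabel ι κ v = t.sec x h := by
      rcases hv : t.sec x h with a | ⟨b, i⟩ | ⟨c, i⟩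
      · exact ⟨Sum.inl a, rfl⟩
      · obtain ⟨k, rfl⟩ := (mι i).mp ((hB i).mp ⟨x, h, b, hv⟩)
        exact ⟨Sum.inr (Sum.inl ⟨b, k⟩), rfl⟩
      · obtain ⟨k, rfl⟩ := (mκ i).mp ((hC i).mp ⟨x, h, c, hv⟩)
        exact ⟨Sum.inr (Sum.inr ⟨c, k⟩), rfl⟩
    choose v hv using lift
    let s : Sec f (tot A B C (Fin #S) (Fin #T)) :=
      ⟨t.base, v, fun x h => by rw [← proj_relabel ι κ, hv, t.proj_sec]⟩
    have hs : Sec.map (relabel ι κ) (proj_relabel ι κ) s = t :=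
      Sec.ext_sec rfl fun x _ h => hv x h
    refine ⟨⟨s, fun k => iff_of_true ?_ trivial, fun k => iff_of_true ?_ trivial⟩,
      Subtype.ext hs⟩
    · have := (hB (ι k)).mpr ((mι _).mpr ⟨k, rfl⟩)
      rw [← hs] at this
      obtain ⟨k', hk, h⟩ := (hitB_map_iff s _).mp this
      rwa [← iι hk]
    · have := (hC (κ k)).mpr ((mκ _).mpr ⟨k, rfl⟩)
      rw [← hs] at this
      obtain ⟨k', hk, h⟩ := (hitC_map_iff s _).mp this
      rwa [← iκ hk]
  · intro g s
    exact Subtype.ext (Sec.ext_sec rfl fun x _ _ => relabel_smul ι κ g _)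
  · intro s
    rfl

theorem mk_hitExactly_eq_zero (f : X →[G] Y) (A B C : GSetOver G X) {s t : ℕ}
    (h : Nat.card X < s + t) :
    mk (hitExactly f A B C (Set.univ : Set (Fin s)) (Set.univ : Set (Fin t))) = 0 := by
  have hE : IsEmpty (hitExactly f A B C (Set.univ : Set (Fin s)) (Set.univ : Set (Fin t))) := by
    refine ⟨fun u => ?_⟩
    obtain ⟨u, hB, hC⟩ := u
    have hB' (i : Fin s) := (hB i).mpr trivial
    have hC' (i : Fin t) := (hC i).mpr trivial
    choose x hx b hb using hB'
    choose y hy c hc using hC'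
    have inj : Function.Injective (Sum.elim x y) := by
      rintro (i | i) (k | k) (e : _ = _)
      · have := (hb i).symm.trans ((u.sec_congr e (hx i) (hx k)).trans (hb k))
        exact congrArg Sum.inl (congrArg CopyPt.idx (Sum.inl.inj (Sum.inr.inj this)))
      · have := (hb i).symm.trans ((u.sec_congr e (hx i) (hy k)).trans (hc k))
        exact absurd (Sum.inr.inj this) Sum.inl_ne_inr
      · have := (hc i).symm.trans ((u.sec_congr e (hy i) (hx k)).trans (hb k))
        exact absurd (Sum.inr.inj this) Sum.inr_ne_inl
      · have := (hc i).symm.trans ((u.sec_congr e (hy i) (hy k)).trans (hc k))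
        exact congrArg Sum.inr (congrArg CopyPt.idx (Sum.inr.inj (Sum.inr.inj this)))
    have := Nat.card_le_card_of_injective _ inj
    rw [Nat.card_sum, Nat.card_fin, Nat.card_fin] at this
    omega
  exact mk_eq_of_bijective (B := empty) (fun d => hE.elim d)
    ⟨fun d => hE.elim d, fun z => z.elim⟩ (fun _ d => hE.elim d) (fun d => hE.elim d)

/-- The multiplicative transfer is a numerical function. -/
theorem exists_norm_eq (f : X →[G] Y) (a b c : Semi G X) :
    ∃ w : ℕ → ℕ → Semi G Y, (∀ s t, Nat.card X < s + t → w s t = 0) ∧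
      ∀ j l : ℕ, norm f (a + (j • b + l • c)) =
        ∑ s ∈ range (Nat.card X + 1), ∑ t ∈ range (Nat.card X + 1),
          (j.choose s * l.choose t) • w s t := by
  classical
  induction a using ind with | _ A
  induction b using ind with | _ B
  induction c using ind with | _ C
  set w : ℕ → ℕ → Semi G Y := fun s t =>
    mk (hitExactly f A B C (Set.univ : Set (Fin s)) (Set.univ : Set (Fin t))) with hw
  have w0 : ∀ s t, Nat.card X < s + t → w s t = 0 := fun s t h => mk_hitExactly_eq_zero f A B C h
  refine ⟨w, w0, fun j l => ?_⟩
  have ext_range (m : ℕ) (u : ℕ → Semi G Y) (hu : ∀ s, Nat.card X < s → u s = 0) :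
      ∑ s ∈ range (m + 1), m.choose s • u s =
        ∑ s ∈ range (Nat.card X + 1), m.choose s • u s := by
    rcases le_total m (Nat.card X) with h | h
    · refine Finset.sum_subset (range_subset_range.mpr (by omega)) fun s _ hs => ?_
      rw [Nat.choose_eq_zero_of_lt (by simpa using hs), zero_nsmul]
    · refine (Finset.sum_subset (range_subset_range.mpr (by omega)) fun s _ hs => ?_).symm
      rw [hu s (by simpa using hs), nsmul_zero]
  have h1 : norm f (mk A + (j • mk B + l • mk C)) =
      mk (dprod f (tot A B C (Fin j) (Fin l))) := by
    rw [← mk_tot]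
    rfl
  rw [h1, mk_eq_sum_sep (ι := Finset (Fin j) × Finset (Fin l))
    (dprod f (tot A B C (Fin j) (Fin l)))
    (fun s => (Finset.univ.filter fun i => HitB (f := f) s i,
      Finset.univ.filter fun i => HitC (f := f) s i))
    (fun g s => Prod.ext (Finset.filter_congr fun i _ => hitB_smul_iff g s i)
      (Finset.filter_congr fun i _ => hitC_smul_iff g s i)), Fintype.sum_prod_type]
  have h2 (S : Finset (Fin j)) (T : Finset (Fin l)) :
      mk (sep (dprod f (tot A B C (Fin j) (Fin l)))
        (fun s => (Finset.univ.filter (fun i => HitB (f := f) s i),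
          Finset.univ.filter (fun i => HitC (f := f) s i)) = (S, T))
        (fun g s h => (Prod.ext (Finset.filter_congr fun i _ => hitB_smul_iff g s i)
          (Finset.filter_congr fun i _ => hitC_smul_iff g s i)).trans h)) = w #S #T := by
    refine Eq.trans ?_ (mk_hitExactly f A B C S T)
    have hiff (s : Sec f (tot A B C (Fin j) (Fin l))) :
        (Finset.univ.filter (fun i => HitB (f := f) s i),
          Finset.univ.filter (fun i => HitC (f := f) s i)) = (S, T) ↔
        ((∀ i, HitB s i ↔ i ∈ (S : Set (Fin j))) ∧ ∀ i, HitC s i ↔ i ∈ (T : Set (Fin l))) := by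
      rw [Prod.mk.injEq, Finset.ext_iff, Finset.ext_iff]
      simp
    exact mk_eq_of_bijective (fun d => ⟨d.1, (hiff d.1).mp d.2⟩)
      ⟨fun d e h => by
          have h' := congrArg Subtype.val h
          exact Subtype.ext h',
        fun d => ⟨⟨d.1, (hiff d.1).mpr d.2⟩, rfl⟩⟩ (fun _ _ => rfl) (fun _ => rfl)
  calc _ = ∑ S : Finset (Fin j), ∑ T : Finset (Fin l), w #S #T :=
        Finset.sum_congr rfl fun S _ => Finset.sum_congr rfl fun T _ => h2 S T
    _ = ∑ S : Finset (Fin j), ∑ t ∈ range (Nat.card X + 1), l.choose t • w #S t := by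
        refine Finset.sum_congr rfl fun S _ => ?_
        rw [← Finset.powerset_univ, Finset.sum_powerset_apply_card (fun t => w #S t),
          Finset.card_univ, Fintype.card_fin]
        exact ext_range l _ fun t ht => w0 _ _ (by omega)
    _ = _ := by
        rw [← Finset.powerset_univ, Finset.sum_powerset_apply_card
          (fun s => ∑ t ∈ range (Nat.card X + 1), l.choose t • w s t),
          Finset.card_univ, Fintype.card_fin,
          ext_range j _ fun s hs => Finset.sum_eq_zero fun t _ => by
            rw [w0 _ _ (by omega), nsmul_zero]]
        refine Finset.sum_congr rfl fun s _ => ?_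
        rw [Finset.smul_sum]
        exact Finset.sum_congr rfl fun t _ => (mul_nsmul' _ _ _).symm

/-- A binomial identity: the `(n + 1)`-st difference of a polynomial of degree at most `n`
vanishes. -/
theorem sum_choose_eq_zero {n s t : ℕ} (h : s + t < n) :
    ∑ j ∈ range (n + 1),
      ((-1) ^ j * (n + 1).choose (j + 1) * (j.choose s * (j + 1).choose (t + 1)) : ℤ) = 0 := by
  open Polynomial in
  set P : ℚ[X] := descPochhammer ℚ (t + 1) * (descPochhammer ℚ s).comp (X - 1) with hP
  have hdeg : P.natDegree < n + 1 := by
    refine lt_of_le_of_lt natDegree_mul_le ?_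
    have h1 : (descPochhammer ℚ (t + 1)).natDegree = t + 1 := descPochhammer_natDegree _ _
    have h2 : ((descPochhammer ℚ s).comp (X - 1)).natDegree ≤ s := by
      refine natDegree_comp_le.trans ?_
      rw [descPochhammer_natDegree, ← C_1, natDegree_X_sub_C, mul_one]
    omega
  have h0 := congrFun (Polynomial.fwdDiff_iter_eq_zero_of_degree_lt hdeg) 0
  rw [fwdDiff_iter_eq_sum_shift, Finset.sum_range_succ'] at h0
  have e0 : P.eval 0 = 0 := by
    rw [hP, eval_mul, descPochhammer_eval_zero, if_neg (Nat.succ_ne_zero t), zero_mul]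
  have e1 (j : ℕ) : P.eval (0 + (j + 1) • (1 : ℚ)) =
      ((t + 1).factorial * s.factorial) * (j.choose s * (j + 1).choose (t + 1)) := by
    have a1 := descPochhammer_eval_eq_descFactorial ℚ (j + 1) (t + 1)
    have a2 := descPochhammer_eval_eq_descFactorial ℚ j s
    rw [Nat.descFactorial_eq_factorial_mul_choose] at a1 a2
    have a3 : (0 + (j + 1) • (1 : ℚ)) = ((j + 1 : ℕ) : ℚ) := by simp
    rw [a3, hP, eval_mul, eval_comp, a1]
    have a4 : (X - 1 : ℚ[X]).eval ((j + 1 : ℕ) : ℚ) = (j : ℚ) := by simp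
    rw [a4, a2]
    push_cast
    ring
  have h1 : ∑ k ∈ range (n + 1), ((-1) ^ (n + 1 - (k + 1)) * ((n + 1).choose (k + 1) : ℤ)) •
      P.eval (0 + (k + 1) • (1 : ℚ)) = 0 := by
    rw [zero_nsmul, add_zero, e0, smul_zero, add_zero] at h0
    exact h0
  have hc : ((t + 1).factorial * s.factorial : ℚ) ≠ 0 := by positivity
  have key : ((-1) ^ n * ((t + 1).factorial * s.factorial) : ℚ) *
      ∑ j ∈ range (n + 1),
        ((-1) ^ j * (n + 1).choose (j + 1) * (j.choose s * (j + 1).choose (t + 1)) : ℚ) = 0 := by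
    rw [Finset.mul_sum]
    refine (Finset.sum_congr rfl fun j hj => ?_).trans h1
    have hj' : j ≤ n := by simpa [Nat.lt_succ_iff] using hj
    have hs : ((-1) ^ (n + 1 - (j + 1)) : ℤ) = (-1) ^ n * (-1) ^ j := by
      rw [Nat.add_sub_add_right]
      obtain ⟨m, rfl⟩ := Nat.exists_eq_add_of_le hj'
      rw [Nat.add_sub_cancel_left, pow_add, mul_right_comm, ← mul_pow]
      simp
    rw [e1 j, hs, zsmul_eq_mul]
    push_cast
    ring
  have := (mul_eq_zero.mp key).resolve_left (mul_ne_zero (pow_ne_zero n (by norm_num)) hc)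
  exact_mod_cast this

/-- The value of the multiplicative transfer at the formal difference `a - b`. As
`x ↦ f_•(a + x b)` is a polynomial function of degree at most `n = |X|`, its value at `x = -1` is
obtained from those at `x = 0, …, n` by extrapolation. -/
noncomputable def normSub (f : X →[G] Y) (a b : Semi G X) : GrothendieckRing (Semi G Y) :=
  ∑ j ∈ range (Nat.card X + 1),
    ((-1 : ℤ) ^ j * ((Nat.card X + 1).choose (j + 1) : ℤ)) •
      GrothendieckRing.of (norm f (a + j • b))

theorem normSub_add (f : X →[G] Y) (a b c : Semi G X) :
    normSub f (a + c) (b + c) = normSub f a b := by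
  obtain ⟨w, hw, h⟩ := exists_norm_eq f a b c
  have e1 (j : ℕ) : norm f (a + c + j • (b + c)) =
      ∑ s ∈ range (Nat.card X + 1), ∑ t ∈ range (Nat.card X + 1),
        (j.choose s * (j + 1).choose t) • w s t := by
    rw [← h]
    congr 1
    rw [nsmul_add, succ_nsmul]
    abel
  have e2 (j : ℕ) : norm f (a + j • b) =
      ∑ s ∈ range (Nat.card X + 1), ∑ t ∈ range (Nat.card X + 1),
        (j.choose s * (0 : ℕ).choose t) • w s t := by
    rw [← h, zero_nsmul, add_zero]
  have key (m : ℕ → ℕ) : ∑ j ∈ range (Nat.card X + 1),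
      ((-1 : ℤ) ^ j * ((Nat.card X + 1).choose (j + 1) : ℤ)) •
        GrothendieckRing.of (∑ s ∈ range (Nat.card X + 1), ∑ t ∈ range (Nat.card X + 1),
          (j.choose s * (m j).choose t) • w s t) =
      ∑ s ∈ range (Nat.card X + 1), ∑ t ∈ range (Nat.card X + 1),
        (∑ j ∈ range (Nat.card X + 1), ((-1) ^ j * (Nat.card X + 1).choose (j + 1) *
          (j.choose s * (m j).choose t) : ℤ)) • GrothendieckRing.of (w s t) := by
    simp only [map_sum, map_nsmul, Finset.smul_sum, Finset.sum_smul]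
    rw [Finset.sum_comm]
    refine Finset.sum_congr rfl fun s _ => ?_
    rw [Finset.sum_comm]
    refine Finset.sum_congr rfl fun t _ => Finset.sum_congr rfl fun j _ => ?_
    rw [← natCast_zsmul, smul_smul]
    push_cast
    rfl
  unfold normSub
  simp only [e1, e2]
  rw [key (fun j => j + 1), key (fun _ => 0)]
  refine Finset.sum_congr rfl fun s hs => Finset.sum_congr rfl fun t ht => ?_
  rcases lt_or_ge (Nat.card X) (s + t) with hst | hst
  · rw [hw s t hst, map_zero, smul_zero, smul_zero]
  · cases t with
    | zero => simp only [Nat.choose_zero_right]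
    | succ t =>
      rw [sum_choose_eq_zero (by omega)]
      simp

theorem normSub_zero (f : X →[G] Y) (a : Semi G X) :
    normSub f a 0 = GrothendieckRing.of (norm f a) := by
  have h : ∑ j ∈ range (Nat.card X + 1),
      ((-1 : ℤ) ^ j * ((Nat.card X + 1).choose (j + 1) : ℤ)) = 1 := by
    have := Int.alternating_sum_range_choose_of_ne (Nat.succ_ne_zero (Nat.card X))
    rw [Finset.sum_range_succ'] at this
    simp only [pow_succ, mul_neg, mul_one, neg_mul, Finset.sum_neg_distrib, pow_zero,
      Nat.choose_zero_right, Nat.cast_one] at this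
    linarith
  unfold normSub
  simp only [smul_zero, add_zero]
  rw [← Finset.sum_smul, h, one_smul]

end Semi
end Burnside

/-! ## The Burnside Tambara functor -/

namespace Burnside

/-- `Ω_G(X)`, the Grothendieck ring of the category of finite `G`-sets over `X`. -/
abbrev Omega (G : Type u) [Group G] (X : Type u) [MulAction G X] [Finite X] : Type (u + 1) :=
  GrothendieckRing (Semi G X)

section Transfers

variable {G : Type u} [Group G] {X : Type u} [MulAction G X] [Finite X]
  {Y : Type u} [MulAction G Y] [Finite Y]

/-- The restriction `f^*`, given by fibre products. -/
noncomputable def resMap (f : X →[G] Y) : Omega G Y →+* Omega G X :=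
  GrothendieckRing.map (Semi.pullHom f)

/-- The additive transfer `f_+`, given by composition with `f`. -/
noncomputable def addTransfer (f : X →[G] Y) : Omega G X →+ Omega G Y :=
  GrothendieckRing.mapAdd (Semi.pushHom f)

/-- The multiplicative transfer `f_•`, the polynomial extension to `Ω_G(X)` of the map
`(A → X) ↦ (Π_f(A) → Y)`. -/
noncomputable def mulTransfer (f : X →[G] Y) : Omega G X → Omega G Y :=
  GrothendieckRing.liftSub (Semi.normSub f) (Semi.normSub_add f)

theorem mulTransfer_of (f : X →[G] Y) (A : GSetOver G X) :
    mulTransfer f (GrothendieckRing.of (Semi.mk A)) =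
      GrothendieckRing.of (Semi.mk (A.dprod f)) := by
  have h := GrothendieckRing.liftSub_of_sub (Semi.normSub f) (Semi.normSub_add f) (Semi.mk A) 0
  rw [map_zero, sub_zero, Semi.normSub_zero] at h
  exact h

end Transfers

/-! ## Ideals and prime ideals of the Burnside Tambara functor -/

/-- A finite `G`-set. -/
structure FinGSet (G : Type u) [Group G] where
  carrier : Type u
  [action : MulAction G carrier]
  [finite : Finite carrier]

namespace FinGSet

instance (G : Type u) [Group G] : CoeSort (FinGSet G) (Type u) := ⟨FinGSet.carrier⟩

instance {G : Type u} [Group G] (X : FinGSet G) : MulAction G X := X.action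

instance {G : Type u} [Group G] (X : FinGSet G) : Finite X := X.finite

/-- The `G`-set `G / H`. -/
def orbit {G : Type u} [Group G] [Finite G] (H : Subgroup G) : FinGSet G where
  carrier := G ⧸ H

end FinGSet

/-- A family of ideals `I(X) ⊆ Ω_G(X)`, one for each finite `G`-set `X`. Families are ordered by
inclusion. -/
abbrev Family (G : Type u) [Group G] : Type (u + 1) := ∀ X : FinGSet G, Ideal (Omega G X)

/-- The family is an ideal of the Tambara functor `Ω_G`. -/
structure IsTambaraIdeal {G : Type u} [Group G] (I : Family G) : Prop where
  resMap_mem : ∀ (X Y : FinGSet G) (f : X →[G] Y), ∀ b ∈ I Y, resMap f b ∈ I X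
  addTransfer_mem : ∀ (X Y : FinGSet G) (f : X →[G] Y), ∀ a ∈ I X, addTransfer f a ∈ I Y
  mulTransfer_mem : ∀ (X Y : FinGSet G) (f : X →[G] Y), ∀ a ∈ I X,
    mulTransfer f a - mulTransfer f 0 ∈ I Y

/-- The `G`-set `X` is transitive. -/
def IsTransitive {G : Type u} [Group G] (X : FinGSet G) : Prop :=
  Nonempty X ∧ MulAction.IsPretransitive G X

/-- The family is a prime ideal of the Tambara functor `Ω_G`. -/
structure IsTambaraPrime {G : Type u} [Group G] (I : Family G) : Prop where
  isTambaraIdeal : IsTambaraIdeal I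
  proper : ∃ X : FinGSet G, I X ≠ ⊤
  prime : ∀ X Y : FinGSet G, IsTransitive X → IsTransitive Y →
    ∀ (a : Omega G X) (b : Omega G Y),
      (∀ (C D D' : FinGSet G) (v : D →[G] C) (w : D →[G] X) (v' : D' →[G] C) (w' : D' →[G] Y),
        (mulTransfer v (resMap w a) - mulTransfer v 0) *
          (mulTransfer v' (resMap w' b) - mulTransfer v' 0) ∈ I C) ↔
      (a ∈ I X ∨ b ∈ I Y)

/-- `Spec Ω_G`, the set of prime ideals of `Ω_G`. -/
def spec (G : Type u) [Group G] : Set (Family G) := { P | IsTambaraPrime P }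

/-! ## Ideals as sequences, when `G` is a cyclic `p`-group -/

section Sequences

/-- The subgroup `H_k` of the elements whose order divides `p ^ k`. When `G` is cyclic of order
`p ^ r` and `k ≤ r`, it is the unique subgroup of order `p ^ k`. -/
def subgroupH (G : Type u) [CommGroup G] (p k : ℕ) : Subgroup G :=
  (powMonoidHom (p ^ k) : G →* G).ker

theorem subgroupH_le_succ (G : Type u) [CommGroup G] (p k : ℕ) :
    subgroupH G p k ≤ subgroupH G p (k + 1) := by
  intro g hg
  have h : g ^ p ^ k = 1 := hg
  change g ^ p ^ (k + 1) = 1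
  rw [pow_succ, pow_mul, h, one_pow]

variable (G : Type u) [CommGroup G] [Finite G] (p : ℕ)

/-- The `G`-set `G / H_k`. -/
abbrev orbitH (k : ℕ) : FinGSet G := FinGSet.orbit (subgroupH G p k)

/-- The natural projection `G / H_k → G / H_{k+1}`. -/
def projH (k : ℕ) : orbitH G p k →[G] orbitH G p (k + 1) where
  toFun := Subgroup.quotientMapOfLE (subgroupH_le_succ G p k)
  map_smul' g x := by
    induction x using QuotientGroup.induction_on with
    | H x => rfl

/-- The ring `R_k = Ω_G(G / H_k)`. -/
abbrev R (k : ℕ) : Type (u + 1) := Omega G (orbitH G p k)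

/-- The restriction from `R_{k+1}` to `R_k`. -/
noncomputable def res (k : ℕ) : R G p (k + 1) →+* R G p k := resMap (projH G p k)

/-- The additive transfer from `R_k` to `R_{k+1}`. -/
noncomputable def ind (k : ℕ) : R G p k →+ R G p (k + 1) := addTransfer (projH G p k)

/-- The multiplicative transfer from `R_k` to `R_{k+1}`. -/
noncomputable def jnd (k : ℕ) : R G p k → R G p (k + 1) := mulTransfer (projH G p k)

variable {G p}

/-- The ideal `L(I)` of `R_{k+1}`. -/
noncomputable def idealL {k : ℕ} (I : Ideal (R G p k)) : Ideal (R G p (k + 1)) :=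
  I.comap (res G p k)

/-- The ideal `S(I)` of `R_{k+1}`. -/
noncomputable def idealS {k : ℕ} (I : Ideal (R G p k)) : Ideal (R G p (k + 1)) :=
  Ideal.span (ind G p k '' I) ⊔ Ideal.span (jnd G p k '' I)

variable (G p) in
/-- Sequences `[I_0, …, I_m]` of ideals `I_k ⊆ R_k`. -/
abbrev IdealSeq (m : ℕ) : Type (u + 1) := ∀ k : Fin (m + 1), Ideal (R G p k)

/-- The sequence `[I_0]` of length one. -/
def single (I : Ideal (R G p 0)) : IdealSeq G p 0 :=
  Fin.cons (α := fun k : Fin 1 => Ideal (R G p k)) I (fun k => k.elim0)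

/-- The sequence `𝓛I = [I_0, …, I_m, L(I_m)]`. -/
noncomputable def seqL {m : ℕ} (I : IdealSeq G p m) : IdealSeq G p (m + 1) :=
  Fin.snoc (α := fun k : Fin (m + 2) => Ideal (R G p k)) I (idealL (I (Fin.last m)))

/-- The sequence `𝓢I = [I_0, …, I_m, S(I_m)]`. -/
noncomputable def seqS {m : ℕ} (I : IdealSeq G p m) : IdealSeq G p (m + 1) :=
  Fin.snoc (α := fun k : Fin (m + 2) => Ideal (R G p k)) I (idealS (I (Fin.last m)))

/-- The `n`-fold iterate of `𝓛`. -/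
noncomputable def seqLPow {m : ℕ} (n : ℕ) (I : IdealSeq G p m) : IdealSeq G p (m + n) :=
  match n with
  | 0 => I
  | n + 1 => seqL (seqLPow n I)

/-- The `n`-fold iterate of `𝓢`. -/
noncomputable def seqSPow {m : ℕ} (n : ℕ) (I : IdealSeq G p m) : IdealSeq G p (m + n) :=
  match n with
  | 0 => I
  | n + 1 => seqS (seqSPow n I)

/-- The family of ideals described by a sequence `[I_0, …, I_m]`, when `G` is cyclic of order
`p ^ m`: as every finite `G`-set is a disjoint union of orbits `G / H_k`, an ideal of `Ω_G` with
value `I_k` at `G / H_k` consists at `X` of the elements whose restriction along any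
`G / H_k → X` lies in `I_k`. -/
noncomputable def ofSeq {m : ℕ} (I : IdealSeq G p m) : Family G := fun X =>
  ⨅ k : Fin (m + 1), ⨅ f : orbitH G p k →[G] X, (I k).comap (resMap f)

/-- The value at `G / H_k` of the family of ideals described by a sequence is its `k`-th term, for
every `k`. -/
def IsSeqOf {m : ℕ} (P : Family G) (I : IdealSeq G p m) : Prop :=
  ∀ k : Fin (m + 1), P (orbitH G p k) = I k

variable (p) in
/-- The prime ideals of `Ω_G` over the ideal `J ⊆ R_0`. -/
def primesOver (J : Ideal (R G p 0)) : Set (Family G) :=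
  { P | P ∈ spec G ∧ P (orbitH G p 0) = J }

variable (G p) in
/-- The ideal `(n) ⊆ R_0`. -/
noncomputable def idealR0 (n : ℕ) : Ideal (R G p 0) := Ideal.span {(n : R G p 0)}

variable (G p) in
/-- The sequence `𝓛^i 𝓢^{r-i} (n)`, for `i ≤ r`. -/
noncomputable def seqLS (r n i : ℕ) : IdealSeq G p (0 + (r - i) + i) :=
  seqLPow i (seqSPow (r - i) (single (idealR0 G p n)))

variable (G p) in
/-- The sequence `𝓛^i (0)`, for `i ≤ r`, where `0` is the zero ideal of `Ω_{H_{r-i}}`. -/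
noncomputable def seqL0 (r i : ℕ) : IdealSeq G p (r - i + i) :=
  seqLPow i (fun _ => ⊥ : IdealSeq G p (r - i))

variable (G p) in
/-- The sequence `𝓛^r (p)`. -/
noncomputable def seqLp (r : ℕ) : IdealSeq G p (0 + r) :=
  seqLPow r (single (idealR0 G p p))

end Sequences

end Burnside

/-! Everything is read off from marks. Counting the `H`-fixed points over a point `x` gives a map
from the Burnside ring to ℤ, which is a ring homomorphism if `H` fixes `x` and is zero otherwise.
All operations are visible on marks: restriction preserves them, the additive transfer sums them
over a fibre, and the multiplicative transfer multiplies them over the `H`-orbits of a fibre, at the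
subgroups `H ⊓ Stab x` (`mark_mulTransfer`). On the rings `R_k` the marks at `H_0, …, H_k` are
jointly injective (`eq_zero_of_phi`).

For `n ≤ r` and `q` prime or zero, divisibility by `q` of all marks at subgroups of `H_n` defines an
ideal, `markFamily`. It is prime: a mark at `L ≤ H_n` is carried unchanged, by restriction to `G/L`
and multiplicative transfer to `G/H_n`, to a mark at `H_n`, and there two values prime to `q` have a
product prime to `q` (nonzero values, if `q = 0`).

Conversely, let `I` be prime. The element `topElt k` of `R_k` has `H_k` as its only subgroup with
nonzero mark. Take the largest `n` with `topElt n ∉ I`; the integers `c` with `c * topElt n ∈ I`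
form a prime ideal `(q)`, and `I` is the mark ideal of `n` and `q`. For one inclusion
(`phi_mem_topIdeal`), a mark of an element of `I` is carried to the top mark over `G/H_n` and
isolated by multiplying with `topElt n`. For the other (`IsTambaraPrime.mem_of_phi_mem`) one inducts
on `k`: if `k ≤ n`, primality is applied to the transfer of `a` times `topElt n`; if `k > n`, the
difference of `a ^ p` and `jnd (res a)` is a multiple of `topElt k ∈ I`, so `a ^ p ∈ I`. What makes
primality usable is `IsTambaraPrime.mem_or_mem_of_mulTransfer_mul`: when the proper restrictions of
both elements are already in `I`, a single product replaces all diagrams.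

The sequences match because mark conditions at `H_0, …, H_n` are inherited by `L` beyond level `n`,
are generated by `S` up to level `n` when `q ≠ p` is prime, and leave only zero up to level `n` when
`q = 0`. For `q = p` all marks over a point agree modulo `p`, so `n` is immaterial and one prime
remains; otherwise `topElt n` separates the levels. -/

namespace Burnside

open GSetOver

/-! ### Marks: fixed-point counts on Burnside rings. -/

section Marks

variable {G : Type u} [Group G] {X : Type u} [MulAction G X] {Y : Type u} [MulAction G Y]

/-- The points over `x` fixed by `H`. -/
def FixedFibre (x : X) (H : Subgroup G) (A : GSetOver G X) : Type u :=
  { a : A // A.proj a = x ∧ ∀ h ∈ H, h • a = a }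

instance (x : X) (H : Subgroup G) (A : GSetOver G X) : Finite (FixedFibre x H A) :=
  Subtype.finite

/-- The number of points over `x` fixed by `H`. -/
noncomputable def Semi.mark (x : X) (H : Subgroup G) : Semi G X →+ ℕ where
  toFun := Quotient.lift (Nat.card <| FixedFibre x H ·) (by
    rintro A B ⟨e, he, hp⟩
    refine Nat.card_congr (e.subtypeEquiv fun a => ?_)
    rw [hp]
    refine and_congr_right fun _ => forall₂_congr fun _ _ => ?_
    rw [← he, e.injective.eq_iff])
  map_zero' := by
    have : IsEmpty (FixedFibre x H (empty : GSetOver G X)) := ⟨fun a => a.1.elim⟩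
    exact Nat.card_of_isEmpty
  map_add' a b := by
    induction a using Semi.ind with | _ A
    induction b using Semi.ind with | _ B
    change Nat.card (FixedFibre x H (sum A B)) =
      Nat.card (FixedFibre x H A) + Nat.card (FixedFibre x H B)
    rw [← Nat.card_sum]
    refine (Nat.card_congr (Equiv.ofBijective (Sum.elim
      (fun a => ⟨Sum.inl a.1, a.2.1, fun h hh => congrArg Sum.inl (a.2.2 h hh)⟩)
      (fun b => ⟨Sum.inr b.1, b.2.1, fun h hh => congrArg Sum.inr (b.2.2 h hh)⟩)) ⟨?_, ?_⟩)).symm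
    · rintro (a | a) (b | b) h
      · exact congrArg Sum.inl (Subtype.ext (Sum.inl.inj (congrArg Subtype.val h)))
      · exact absurd (congrArg Subtype.val h) Sum.inl_ne_inr
      · exact absurd (congrArg Subtype.val h) Sum.inr_ne_inl
      · exact congrArg Sum.inr (Subtype.ext (Sum.inr.inj (congrArg Subtype.val h)))
    · rintro ⟨a | b, h₁, h₂⟩
      · exact ⟨Sum.inl ⟨a, h₁, fun h hh => Sum.inl.inj (h₂ h hh)⟩, rfl⟩
      · exact ⟨Sum.inr ⟨b, h₁, fun h hh => Sum.inr.inj (h₂ h hh)⟩, rfl⟩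

variable [Finite X] [Finite Y]

/-- The class of a finite `G`-set over `X` in the Burnside ring. -/
noncomputable def cls (A : GSetOver G X) : Omega G X := GrothendieckRing.of (Semi.mk A)

theorem exists_cls_sub (a : Omega G X) : ∃ A B : GSetOver G X, a = cls A - cls B := by
  obtain ⟨s, t, rfl⟩ := GrothendieckRing.exists_eq_sub a
  induction s using Semi.ind with | _ A
  induction t using Semi.ind with | _ B
  exact ⟨A, B, rfl⟩

theorem hom_eq_of_cls {M : Type*} [AddCommGroup M] {f g : Omega G X →+ M}
    (h : ∀ A, f (cls A) = g (cls A)) (a : Omega G X) : f a = g a := by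
  obtain ⟨A, B, rfl⟩ := exists_cls_sub a
  rw [map_sub, map_sub, h, h]

/-- The mark: the number of points over `x` fixed by `H`, extended to the Burnside ring. -/
noncomputable def mark (x : X) (H : Subgroup G) : Omega G X →+ ℤ :=
  GrothendieckRing.liftAdd ((Nat.castAddMonoidHom ℤ).comp (Semi.mark x H))

theorem mark_of (x : X) (H : Subgroup G) (s : Semi G X) :
    mark x H (GrothendieckRing.of s) = (Semi.mark x H s : ℤ) :=
  GrothendieckRing.liftAdd_ofAdd _ _

theorem mark_cls (x : X) (H : Subgroup G) (A : GSetOver G X) :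
    mark x H (cls A) = (Nat.card (FixedFibre x H A) : ℤ) :=
  mark_of x H _

theorem resMap_cls (f : X →[G] Y) (B : GSetOver G Y) :
    resMap f (cls B) = cls (B.pullback f) :=
  GrothendieckRing.liftAdd_ofAdd _ _

theorem addTransfer_cls (f : X →[G] Y) (A : GSetOver G X) :
    addTransfer f (cls A) = cls (A.push f) :=
  GrothendieckRing.liftAdd_ofAdd _ _

theorem cls_self : cls (self : GSetOver G X) = 1 := map_one GrothendieckRing.of

theorem cls_prod (A B : GSetOver G X) : cls (prod A B) = cls A * cls B :=
  map_mul GrothendieckRing.of (Semi.mk A) (Semi.mk B)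

theorem mark_mul (x : X) (H : Subgroup G) (a b : Omega G X) :
    mark x H (a * b) = mark x H a * mark x H b := by
  have key (A B : GSetOver G X) :
      mark x H (cls A * cls B) = mark x H (cls A) * mark x H (cls B) := by
    rw [← cls_prod, mark_cls, mark_cls, mark_cls, ← Nat.cast_mul, ← Nat.card_prod]
    refine congrArg _ (Nat.card_congr ?_)
    exact
      { toFun := fun z => (⟨z.1.fst, z.1.eq.trans z.2.1,
            fun h hh => congrArg FibrePt.fst (z.2.2 h hh)⟩,
          ⟨z.1.snd, z.2.1, fun h hh => congrArg FibrePt.snd (z.2.2 h hh)⟩)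
        invFun := fun z => ⟨⟨z.1.1, z.2.1, z.1.2.1.trans z.2.2.1.symm⟩, z.2.2.1,
          fun h hh => FibrePt.ext (z.1.2.2 h hh) (z.2.2.2 h hh)⟩
        left_inv := fun _ => rfl
        right_inv := fun _ => rfl }
  obtain ⟨A, B, rfl⟩ := exists_cls_sub a
  obtain ⟨C, D, rfl⟩ := exists_cls_sub b
  simp only [sub_mul, mul_sub, map_sub, key]

/-- A fixed point over `x` forces `H` to fix `x`. Because of this vanishing, later divisibility
conditions can range over all pairs `(x, H)` without a stabilizer hypothesis. -/
theorem mark_eq_zero {x : X} {H : Subgroup G} (hH : ¬ H ≤ MulAction.stabilizer G x)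
    (a : Omega G X) : mark x H a = 0 := by
  refine hom_eq_of_cls (g := 0) (fun A => ?_) a
  have : IsEmpty (FixedFibre x H A) := ⟨fun a => hH fun h hh => by
    rw [MulAction.mem_stabilizer_iff, ← a.2.1, ← A.proj_smul, a.2.2 h hh]⟩
  rw [mark_cls, Nat.card_of_isEmpty]
  rfl

theorem mark_one {x : X} {H : Subgroup G} (hH : H ≤ MulAction.stabilizer G x) :
    mark x H (1 : Omega G X) = 1 := by
  rw [← cls_self, mark_cls]
  have : Unique (FixedFibre x H (self : GSetOver G X)) :=
    { default := ⟨x, rfl, fun h hh => hH hh⟩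
      uniq := fun a => Subtype.ext a.2.1 }
  rw [Nat.card_unique]
  rfl

/-- The mark as a ring homomorphism. -/
noncomputable def markHom {x : X} {H : Subgroup G} (hH : H ≤ MulAction.stabilizer G x) :
    Omega G X →+* ℤ where
  __ := mark x H
  map_one' := mark_one hH
  map_mul' := mark_mul x H

theorem mark_intCast {x : X} {H : Subgroup G} (hH : H ≤ MulAction.stabilizer G x) (n : ℤ) :
    mark x H (n : Omega G X) = n := map_intCast (markHom hH) n

theorem mark_natCast {x : X} {H : Subgroup G} (hH : H ≤ MulAction.stabilizer G x) (n : ℕ) :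
    mark x H (n : Omega G X) = n := map_natCast (markHom hH) n

theorem mark_pow {x : X} {H : Subgroup G} (hH : H ≤ MulAction.stabilizer G x) (a : Omega G X)
    (n : ℕ) : mark x H (a ^ n) = mark x H a ^ n := map_pow (markHom hH) a n

/-- The fibre of the pullback over `x` is the fibre over `f x`. The hypothesis ensures that the
second coordinate `x` of such a point is fixed as well. -/
theorem mark_resMap {x : X} {H : Subgroup G} (hH : H ≤ MulAction.stabilizer G x) (f : X →[G] Y)
    (b : Omega G Y) : mark x H (resMap f b) = mark (f x) H b := by
  refine hom_eq_of_cls (f := (mark x H).comp (resMap f).toAddMonoidHom) (fun B => ?_) b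
  change mark x H (resMap f (cls B)) = _
  rw [resMap_cls, mark_cls, mark_cls]
  refine congrArg _ (Nat.card_congr ?_)
  exact
    { toFun := fun z => ⟨z.1.fst, z.1.eq.trans (congrArg f z.2.1),
        fun h hh => congrArg FibrePt.fst (z.2.2 h hh)⟩
      invFun := fun b => ⟨⟨b.1, x, b.2.1⟩, rfl, fun h hh => FibrePt.ext (b.2.2 h hh) (hH hh)⟩
      left_inv := fun z => Subtype.ext (FibrePt.ext rfl z.2.1.symm)
      right_inv := fun _ => rfl }

theorem mark_addTransfer [Fintype X] [DecidableEq Y] (f : X →[G] Y) (y : Y) (H : Subgroup G)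
    (a : Omega G X) : mark y H (addTransfer f a) = ∑ x : X with f x = y, mark x H a := by
  have := hom_eq_of_cls (f := (mark y H).comp (addTransfer f))
    (g := ∑ x : X with f x = y, mark x H) (fun A => ?_) a
  · simpa [AddMonoidHom.finsetSum_apply] using this
  rw [AddMonoidHom.comp_apply, addTransfer_cls, mark_cls, AddMonoidHom.finsetSum_apply]
  simp only [mark_cls]
  rw [← Nat.cast_sum, Finset.sum_subtype (Finset.univ.filter fun x => f x = y)
    (p := fun x => f x = y) (fun x => by simp), ← Nat.card_sigma]
  refine congrArg _ (Nat.card_congr ?_)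
  exact
    { toFun := fun a => ⟨⟨A.proj a.1, a.2.1⟩, ⟨a.1, rfl, a.2.2⟩⟩
      invFun := fun a => ⟨a.2.1, (congrArg f a.2.2.1).trans a.1.2, a.2.2.2⟩
      left_inv := fun a => rfl
      right_inv := by
        rintro ⟨⟨x, hx⟩, a, hax, ha⟩
        obtain rfl : A.proj a = x := hax
        rfl }

end Marks

/-- Translation by `g` would in general conjugate `H`; commutativity makes it preserve `H`-fixed
points. -/
theorem mark_smul {G : Type u} [CommGroup G] {X : Type u} [MulAction G X] [Finite X] (g : G) (x : X)
    (H : Subgroup G) (a : Omega G X) : mark (g • x) H a = mark x H a := by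
  refine hom_eq_of_cls (fun A => ?_) a
  rw [mark_cls, mark_cls]
  refine congrArg _ (Nat.card_congr (Equiv.symm ?_))
  refine (MulAction.toPerm g : Equiv.Perm A).subtypeEquiv fun a => ?_
  refine and_congr ?_ (forall₂_congr fun h _ => ?_)
  · rw [MulAction.toPerm_apply, A.proj_smul, smul_left_cancel_iff]
  · rw [MulAction.toPerm_apply, smul_comm, smul_left_cancel_iff]

theorem mark_congr {G : Type u} [CommGroup G] {X : Type u} [MulAction G X] [Finite X]
    [MulAction.IsPretransitive G X] (x y : X) (H : Subgroup G) (a : Omega G X) :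
    mark x H a = mark y H a := by
  obtain ⟨g, rfl⟩ := MulAction.exists_smul_eq G y x
  exact mark_smul g y H a

/-- The `p`-group `H` acts on the fibre over `x`, and its nontrivial orbits have size divisible by
`p`. This congruence is what merges all mark ideals over `(p)`. -/
theorem mark_modEq {G : Type u} [Group G] {X : Type u} [MulAction G X] [Finite X] {p : ℕ}
    [Fact p.Prime] {x : X} {H : Subgroup G} (hp : IsPGroup p H)
    (hH : H ≤ MulAction.stabilizer G x) (a : Omega G X) :
    (p : ℤ) ∣ mark x ⊥ a - mark x H a := by
  have key (A : GSetOver G X) : (p : ℤ) ∣ mark x ⊥ (cls A) - mark x H (cls A) := by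
    let _ : MulAction H { a : A // A.proj a = x } :=
      { smul := fun h a => ⟨(h : G) • a.1, by rw [A.proj_smul, a.2]; exact hH h.2⟩
        one_smul := fun a => Subtype.ext (one_smul G a.1)
        mul_smul := fun h k a => Subtype.ext (mul_smul (h : G) (k : G) a.1) }
    have h₁ := hp.card_modEq_card_fixedPoints { a : A // A.proj a = x }
    have h₂ : Nat.card (FixedFibre x ⊥ A) = Nat.card { a : A // A.proj a = x } := by
      refine Nat.card_congr (Equiv.subtypeEquivRight fun a => and_iff_left fun h hh => ?_)
      rw [Subgroup.mem_bot.mp hh, one_smul]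
    have h₃ : Nat.card (FixedFibre x H A) =
        Nat.card (MulAction.fixedPoints H { a : A // A.proj a = x }) :=
      Nat.card_congr
        { toFun := fun a => ⟨⟨a.1, a.2.1⟩, fun h => Subtype.ext (a.2.2 h h.2)⟩
          invFun := fun a => ⟨a.1.1, a.1.2, fun h hh => congrArg Subtype.val (a.2 ⟨h, hh⟩)⟩
          left_inv := fun _ => rfl
          right_inv := fun _ => rfl }
    rw [mark_cls, mark_cls, h₂, h₃]
    exact (Nat.modEq_iff_dvd.mp h₁.symm)
  obtain ⟨A, B, rfl⟩ := exists_cls_sub a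
  rw [map_sub, map_sub, sub_sub_sub_comm]
  exact dvd_sub (key A) (key B)

/-! ### Marks of the multiplicative transfer. -/

section Norm

variable {G : Type u} [Group G] {X : Type u} [MulAction G X] {Y : Type u} [MulAction G Y]

/-- A fixed section is equivariant. The separate variable `z` lets the translate be given up to an
equation, which the dependent argument of `s.sec` would otherwise obstruct. -/
theorem sec_smul_of_fixed {f : X →[G] Y} {A : GSetOver G X} {s : Sec f A} {g : G} (hg : g • s = s)
    {x z : X} (hz : g • x = z) (hx : f x = s.base) (hgx : f z = s.base) :
    s.sec z hgx = g • s.sec x hx := by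
  subst hz
  have h' : f (g • x) = (g • s).base := by rw [hg]; exact hgx
  rw [← Sec.smul_sec_smul g s x hx h']
  exact Sec.sec_eq_of_eq hg.symm _ _ _

theorem exists_smul_out {H : Subgroup G} (x : X) :
    ∃ h : H, (h : G) • (Quotient.mk (MulAction.orbitRel H X) x).out = x := by
  have : (MulAction.orbitRel H X) (Quotient.mk (MulAction.orbitRel H X) x).out x :=
    Quotient.mk_out (s := MulAction.orbitRel H X) x
  obtain ⟨h, hh⟩ := MulAction.mem_orbit_symm.mp (MulAction.orbitRel_apply.mp this)
  exact ⟨h, hh⟩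

theorem map_smul_of_le_stabilizer (f : X →[G] Y) {y : Y} {H : Subgroup G}
    (hH : H ≤ MulAction.stabilizer G y) {g : G} (hg : g ∈ H) {x : X} :
    f (g • x) = y ↔ f x = y := by
  rw [map_smul]
  refine ⟨fun h => ?_, fun h => by rw [h]; exact hH hg⟩
  rw [← inv_smul_smul g (f x), h]
  exact hH (inv_mem hg)

variable [Finite X] [Finite Y]

/-- The `H`-fixed sections of `A` over the fibre of `y` are described by their values at
representatives of the `H`-orbits of the fibre. -/
theorem card_fixedFibre_dprod (f : X →[G] Y) (y : Y) {H : Subgroup G}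
    (hH : H ≤ MulAction.stabilizer G y) (A : GSetOver G X) :
    Nat.card (FixedFibre y H (dprod f A)) =
      Nat.card (∀ ω : MulAction.orbitRel.Quotient H X, f ω.out = y →
        FixedFibre ω.out (H ⊓ MulAction.stabilizer G ω.out) A) := by
  -- By equivariance an `H`-fixed section is determined by its values at orbit representatives, and
  -- each such value is fixed by the stabilizer of the representative in `H`.
  refine Nat.card_congr (Equiv.ofBijective (fun s ω h =>
    ⟨s.1.sec ω.out (h.trans s.2.1.symm), s.1.proj_sec _ _, fun g hg => ?_⟩) ⟨?_, ?_⟩)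
  · exact (sec_smul_of_fixed (s.2.2 g hg.1) hg.2 _ _).symm
  · rintro ⟨s, hs, hs'⟩ ⟨t, ht, ht'⟩ hst
    refine Subtype.ext (Sec.ext_sec (hs.trans ht.symm) fun x hx hx' => ?_)
    obtain ⟨h, hh⟩ := exists_smul_out (H := H) x
    have hs₀ : s.base = y := hs
    have hout : f (Quotient.mk (MulAction.orbitRel H X) x).out = y := by
      rw [← map_smul_of_le_stabilizer f hH h.2, hh, hx, hs₀]
    rw [sec_smul_of_fixed (hs' h h.2) hh (hout.trans hs.symm),
      sec_smul_of_fixed (ht' h h.2) hh (hout.trans ht.symm)]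
    exact congrArg _ (congrArg Subtype.val (congrFun (congrFun hst _) hout))
  · intro c
    -- Conversely, spread the chosen values along orbits: `k x` carries the representative of the
    -- orbit of `x` to `x`.
    choose k hk using fun x : X => exists_smul_out (H := H) x
    have hout (x : X) (hx : f x = y) : f (Quotient.mk (MulAction.orbitRel H X) x).out = y := by
      rw [← map_smul_of_le_stabilizer f hH (k x).2, hk, hx]
    let s : Sec f A := ⟨y, fun x hx => (k x : G) • (c (Quotient.mk _ x) (hout x hx)).1,
      fun x hx => by rw [A.proj_smul, (c _ _).2.1, hk]⟩
    have cinv (x x' : X) (hx : f x = y) (hx' : f x' = y)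
        (e : Quotient.mk (MulAction.orbitRel H X) x = Quotient.mk (MulAction.orbitRel H X) x') :
        (c (Quotient.mk _ x) (hout x hx)).1 = (c (Quotient.mk _ x') (hout x' hx')).1 := by
      -- Generalising to orbit variables allows `subst` despite the dependence of `c` on a proof.
      have (ω ω' : MulAction.orbitRel.Quotient H X) (h : f ω.out = y) (h' : f ω'.out = y)
          (e : ω = ω') : (c ω h).1 = (c ω' h').1 := by subst e; rfl
      exact this _ _ _ _ e
    have outeq {x x' : X}
        (e : Quotient.mk (MulAction.orbitRel H X) x = Quotient.mk (MulAction.orbitRel H X) x') :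
        (Quotient.mk (MulAction.orbitRel H X) x').out =
          (Quotient.mk (MulAction.orbitRel H X) x).out := by rw [e]
    -- The two ways of reaching `x` from the representative differ by an element of `H` fixing the
    -- representative, and such an element fixes the value of `c` there.
    have move (x x' : X) (hx : f x = y) (hx' : f x' = y) (g : G) (hg : g ∈ H) (e : g • x' = x) :
        s.sec x hx = g • s.sec x' hx' := by
      have hq : Quotient.mk (MulAction.orbitRel H X) x = Quotient.mk (MulAction.orbitRel H X) x' :=
        Quotient.sound ⟨⟨g, hg⟩, e⟩
      change (k x : G) • (c (Quotient.mk _ x) (hout x hx)).1 =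
        g • (k x' : G) • (c (Quotient.mk _ x') (hout x' hx')).1
      rw [← cinv x x' hx hx' hq, ← mul_smul, ← inv_smul_eq_iff, ← mul_smul]
      refine (c _ _).2.2 _ ⟨?_, ?_⟩
      · exact H.mul_mem (H.inv_mem (H.mul_mem hg (k x').2)) (k x).2
      · change ((g * (k x' : G))⁻¹ * (k x : G)) • (_ : X) = _
        rw [mul_smul, inv_smul_eq_iff, hk, mul_smul, ← outeq hq, hk, e]
    refine ⟨⟨s, rfl, fun g hg => ?_⟩, ?_⟩
    · refine Sec.ext_sec (hH hg) fun x hx hx' => ?_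
      exact (Sec.smul_sec g s x hx).trans (move _ _ _ _ g hg (smul_inv_smul g x)).symm
    · funext ω h
      refine Subtype.ext ?_
      change (k ω.out : G) • (c (Quotient.mk _ ω.out) (hout ω.out h)).1 = (c ω h).1
      -- The element chosen for a representative need not be `1`, but it fixes the representative
      -- and hence the prescribed value.
      have (ω' : MulAction.orbitRel.Quotient H X) (h' : f ω'.out = y) (e : ω' = ω) (g : H)
          (hg : (g : G) • ω'.out = ω.out) : (g : G) • (c ω' h').1 = (c ω h).1 := by
        subst e
        exact (c _ _).2.2 _ ⟨g.2, hg⟩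
      exact this _ _ (Quotient.out_eq ω) _ (hk _)

open Classical in
/-- The contribution of the point `x` to the mark at `y` of a multiplicative transfer. -/
noncomputable def normFactor (f : X →[G] Y) (y : Y) (H : Subgroup G) (a : Omega G X) (x : X) : ℤ :=
  if f x = y then mark x (H ⊓ MulAction.stabilizer G x) a else 1

theorem card_fun_prop {P : Prop} [Decidable P] (F : Type*) :
    Nat.card (P → F) = if P then Nat.card F else 1 := by
  split_ifs with h
  · exact Nat.card_congr ⟨fun c => c h, fun a _ => a, fun _ => rfl, fun _ => rfl⟩
  · have : Unique (P → F) := ⟨⟨fun p => absurd p h⟩, fun c => funext fun p => absurd p h⟩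
    exact Nat.card_unique

theorem mark_mulTransfer_cls (f : X →[G] Y) (y : Y) {H : Subgroup G}
    [Fintype (MulAction.orbitRel.Quotient H X)] (hH : H ≤ MulAction.stabilizer G y)
    (A : GSetOver G X) : mark y H (cls (dprod f A)) =
      ∏ ω : MulAction.orbitRel.Quotient H X, normFactor f y H (cls A) ω.out := by
  classical
  rw [mark_cls, card_fixedFibre_dprod f y hH, Nat.card_pi, Nat.cast_prod]
  refine Finset.prod_congr rfl fun ω _ => ?_
  rw [card_fun_prop, normFactor, mark_cls]
  split_ifs <;> simp

/-- Extrapolation of a polynomial of degree at most `n` from its values at `0, …, n` to `-1`. -/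
theorem sum_extrapolate {P : Polynomial ℤ} {n : ℕ} (hP : P.natDegree ≤ n) :
    ∑ j ∈ Finset.range (n + 1), (-1 : ℤ) ^ j * ((n + 1).choose (j + 1) : ℤ) * P.eval (j : ℤ) =
      P.eval (-1) := by
  -- The difference of order `n + 1` is based at `-1`, so that its shifts run through `-1, 0, …, n`;
  -- the unshifted term is the one to be solved for.
  have h := congrFun (Polynomial.fwdDiff_iter_eq_zero_of_degree_lt (Nat.lt_succ_of_le hP)) (-1)
  rw [fwdDiff_iter_eq_sum_shift, Finset.sum_range_succ'] at h
  have e (j : ℕ) (hj : j ∈ Finset.range (n + 1)) :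
      ((-1 : ℤ) ^ (n + 1 - (j + 1)) * ((n + 1).choose (j + 1) : ℤ)) •
        P.eval (-1 + (j + 1) • (1 : ℤ)) = (-1) ^ n *
        ((-1 : ℤ) ^ j * ((n + 1).choose (j + 1) : ℤ) * P.eval (j : ℤ)) := by
    obtain ⟨m, rfl⟩ := Nat.exists_eq_add_of_le (Nat.lt_succ_iff.mp (Finset.mem_range.mp hj))
    have : (-1 + (j + 1) • (1 : ℤ)) = j := by simp
    rw [this, Nat.add_sub_add_right, Nat.add_sub_cancel_left, pow_add, smul_eq_mul]
    have := Even.neg_one_pow (α := ℤ) (Even.add_self j)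
    rw [pow_add] at this
    linear_combination (-(-1) ^ m * ((j + m + 1).choose (j + 1) : ℤ) * P.eval (j : ℤ)) * this
  rw [Nat.succ_eq_add_one, Finset.sum_congr rfl e, ← Finset.mul_sum] at h
  simp only [Nat.sub_zero, Nat.choose_zero_right, zero_smul, add_zero, Pi.zero_apply, smul_eq_mul,
    pow_succ] at h
  have hn : ((-1 : ℤ) ^ n) * (-1) ^ n = 1 := by rw [← mul_pow]; simp
  push_cast at h
  linear_combination (-1) ^ n * h - (∑ j ∈ Finset.range (n + 1),
    (-1 : ℤ) ^ j * ((n + 1).choose (j + 1) : ℤ) * P.eval (j : ℤ) - P.eval (-1)) * hn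

/-- The marks of a multiplicative transfer. -/
theorem mark_mulTransfer (f : X →[G] Y) (y : Y) {H : Subgroup G}
    [Fintype (MulAction.orbitRel.Quotient H X)] (hH : H ≤ MulAction.stabilizer G y)
    (a : Omega G X) : mark y H (mulTransfer f a) =
      ∏ ω : MulAction.orbitRel.Quotient H X, normFactor f y H a ω.out := by
  classical
  obtain ⟨s, t, rfl⟩ := GrothendieckRing.exists_eq_sub a
  change mark y H (mulTransfer f (GrothendieckRing.of s - GrothendieckRing.of t)) =
    ∏ ω : MulAction.orbitRel.Quotient H X,
      normFactor f y H (GrothendieckRing.of s - GrothendieckRing.of t) ω.out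
  have hof (s : Semi G X) : mark y H (GrothendieckRing.of (Semi.norm f s)) =
      ∏ ω : MulAction.orbitRel.Quotient H X, normFactor f y H (GrothendieckRing.of s) ω.out := by
    induction s using Semi.ind with | _ A
    exact mark_mulTransfer_cls f y hH A
  let m (ω : MulAction.orbitRel.Quotient H X) (s : Semi G X) : ℤ :=
    mark ω.out (H ⊓ MulAction.stabilizer G ω.out) (GrothendieckRing.of s)
  -- This polynomial interpolates the marks of the transfers of `s + j • t`. Its degree is at most
  -- the number of orbits, hence at most `|X|`, so the extrapolation in the definition of `normSub`
  -- computes its value at `-1`.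
  let P : Polynomial ℤ := ∏ ω : MulAction.orbitRel.Quotient H X,
    if f ω.out = y then Polynomial.C (m ω t) * Polynomial.X + Polynomial.C (m ω s) else 1
  have hP : P.natDegree ≤ Nat.card X := by
    refine (Polynomial.natDegree_prod_le _ _).trans ?_
    refine (Finset.sum_le_card_nsmul _ _ 1 fun ω _ => ?_).trans ?_
    · split_ifs
      · exact Polynomial.natDegree_linear_le
      · simp
    · rw [smul_eq_mul, mul_one, Finset.card_univ, ← Nat.card_eq_fintype_card]
      exact Nat.card_le_card_of_surjective _ Quotient.mk_surjective
  have heval (c : ℤ) : P.eval c = ∏ ω : MulAction.orbitRel.Quotient H X,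
      if f ω.out = y then m ω s + c * m ω t else 1 := by
    rw [Polynomial.eval_prod]
    refine Finset.prod_congr rfl fun ω _ => ?_
    split_ifs
    · simp only [Polynomial.eval_add, Polynomial.eval_mul, Polynomial.eval_C, Polynomial.eval_X]
      ring
    · simp
  rw [mulTransfer, GrothendieckRing.liftSub_of_sub, Semi.normSub, map_sum]
  refine Eq.trans (Finset.sum_congr rfl fun j _ => ?_) ((sum_extrapolate hP).trans ?_)
  · rw [map_zsmul, smul_eq_mul, hof, heval]
    refine congrArg _ (Finset.prod_congr rfl fun ω _ => ?_)
    rw [normFactor]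
    congr 1
    rw [map_add, map_nsmul, map_add, map_nsmul, nsmul_eq_mul]
  · rw [heval]
    refine Finset.prod_congr rfl fun ω _ => ?_
    rw [normFactor, map_sub]
    congr 1
    change _ = m ω s - m ω t
    ring

end Norm

/-! ### Multiplicative transfers over a commutative group. -/

section CommNorm

variable {G : Type u} [CommGroup G] {X : Type u} [MulAction G X] {Y : Type u} [MulAction G Y]

theorem stabilizer_smul_comm (g : G) (x : X) :
    MulAction.stabilizer G (g • x) = MulAction.stabilizer G x := by
  ext h
  rw [MulAction.mem_stabilizer_iff, MulAction.mem_stabilizer_iff, smul_comm, smul_left_cancel_iff]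

theorem stabilizer_congr [MulAction.IsPretransitive G X] (x y : X) :
    MulAction.stabilizer G x = MulAction.stabilizer G y := by
  obtain ⟨g, rfl⟩ := MulAction.exists_smul_eq G y x
  exact stabilizer_smul_comm g y

theorem stabilizer_le_map {G : Type u} [Group G] {X : Type u} [MulAction G X] {Y : Type u}
    [MulAction G Y] (f : X →[G] Y) (x : X) :
    MulAction.stabilizer G x ≤ MulAction.stabilizer G (f x) := fun g hg => by
  rw [MulAction.mem_stabilizer_iff, ← map_smul, MulAction.mem_stabilizer_iff.mp hg]

theorem stabilizer_map_injective {G : Type u} [Group G] {X : Type u} [MulAction G X] {Y : Type u}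
    [MulAction G Y] {f : X →[G] Y} (hf : Function.Injective f) (x : X) :
    MulAction.stabilizer G (f x) = MulAction.stabilizer G x := by
  refine le_antisymm (fun g hg => hf ?_) (stabilizer_le_map f x)
  rw [map_smul]
  exact hg

theorem card_mul_card_eq_card_sup_mul_card_inf (H K : Subgroup G) :
    Nat.card H * Nat.card K = Nat.card (H ⊔ K : Subgroup G) * Nat.card (H ⊓ K : Subgroup G) := by
  have h₁ := Subgroup.relIndex_mul_relIndex ⊥ K (H ⊔ K) bot_le le_sup_right
  have h₂ := Subgroup.relIndex_mul_relIndex ⊥ (H ⊓ K) H bot_le inf_le_left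
  rw [Subgroup.relIndex_bot_left, Subgroup.relIndex_bot_left] at h₁ h₂
  rw [Subgroup.relIndex_sup_right] at h₁
  rw [Subgroup.inf_relIndex_left] at h₂
  rw [← h₁, ← h₂]
  ring

/-- The stabilizer of `f x` acts transitively on the fibre through `x`, and since the group is
commutative, `H`-orbits there correspond to cosets of `H ⊔ Stab x`. -/
theorem card_orbits_of_fibre [MulAction.IsPretransitive G X] (f : X →[G] Y) (x : X)
    {H : Subgroup G} (hH : H ≤ MulAction.stabilizer G (f x)) :
    Nat.card { ω : MulAction.orbitRel.Quotient H X // f ω.out = f x } =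
      (H ⊔ MulAction.stabilizer G x).relIndex (MulAction.stabilizer G (f x)) := by
  -- Elements of `H` fix `f x`, hence by commutativity every point of its orbit, so moving to an
  -- orbit representative does not change the value of `f`.
  have hfib {z : X} : f (Quotient.mk (MulAction.orbitRel H X) z).out = f z := by
    obtain ⟨h, hh⟩ := exists_smul_out (H := H) z
    obtain ⟨g, rfl⟩ := MulAction.exists_smul_eq G x z
    have h₁ : f ((h : G)⁻¹ • g • x) = f (g • x) := by
      rw [smul_comm, map_smul, map_smul, map_smul]
      congr 1
      exact (MulAction.stabilizer G (f x)).inv_mem (hH h.2)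
    rw [← h₁, inv_smul_eq_iff.mpr hh.symm]
  have hiff (k k' : MulAction.stabilizer G (f x)) :
      (QuotientGroup.leftRel ((H ⊔ MulAction.stabilizer G x).subgroupOf
        (MulAction.stabilizer G (f x)))) k k' ↔
      (MulAction.orbitRel H X) ((k : G) • x) ((k' : G) • x) := by
    rw [QuotientGroup.leftRel_apply, Subgroup.mem_subgroupOf, Subgroup.mem_sup,
      MulAction.orbitRel_apply]
    constructor
    · rintro ⟨h, hh, s, hs, e⟩
      refine ⟨⟨h⁻¹, H.inv_mem hh⟩, ?_⟩
      change h⁻¹ • (k' : G) • x = (k : G) • x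
      have e' : (k' : G) = h * ((k : G) * s) := by
        rw [mul_left_comm, e]
        simp
      rw [e', mul_smul, inv_smul_smul, mul_smul, MulAction.mem_stabilizer_iff.mp hs]
    · rintro ⟨h, hh⟩
      have hh' : (h : G) • (k' : G) • x = (k : G) • x := hh
      refine ⟨(h : G)⁻¹, H.inv_mem h.2, h * ((k : G)⁻¹ * k'), ?_, ?_⟩
      · rw [MulAction.mem_stabilizer_iff, mul_left_comm, mul_smul, inv_smul_eq_iff, mul_smul, hh']
      · simp
  rw [Subgroup.relIndex, Subgroup.index_eq_card]
  refine (Nat.card_congr (Equiv.ofBijective (Quotient.lift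
    (fun k : MulAction.stabilizer G (f x) =>
      (⟨Quotient.mk _ ((k : G) • x), hfib.trans ((map_smul f (k : G) x).trans k.2)⟩ :
        { ω : MulAction.orbitRel.Quotient H X // f ω.out = f x }))
    fun k k' h => Subtype.ext (Quotient.sound ((hiff k k').mp h))) ⟨?_, ?_⟩)).symm
  · intro a b h
    induction a using Quotient.inductionOn with | _ k
    induction b using Quotient.inductionOn with | _ k'
    exact Quotient.sound ((hiff k k').mpr (Quotient.exact (congrArg Subtype.val h)))
  · rintro ⟨ω, hω⟩
    obtain ⟨g, hg⟩ := MulAction.exists_smul_eq G x ω.out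
    refine ⟨Quotient.mk _ ⟨g, ?_⟩, Subtype.ext ?_⟩
    · rw [MulAction.mem_stabilizer_iff, ← map_smul, hg, hω]
    · change Quotient.mk _ (g • x) = ω
      rw [hg]
      exact Quotient.out_eq ω

/-- This is the orbit count for the trivial subgroup, whose orbits are single points. -/
theorem card_fibre [MulAction.IsPretransitive G X]
    (f : X →[G] Y) (x : X) : Nat.card { z : X // f z = f x } =
      (MulAction.stabilizer G x).relIndex (MulAction.stabilizer G (f x)) := by
  rw [← bot_sup_eq (MulAction.stabilizer G x), ← card_orbits_of_fibre f x bot_le]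
  have hout (z : X) : (Quotient.mk (MulAction.orbitRel (⊥ : Subgroup G) X) z).out = z := by
    obtain ⟨h, hh⟩ := exists_smul_out (H := (⊥ : Subgroup G)) z
    rwa [Subgroup.mem_bot.mp h.2, one_smul] at hh
  exact Nat.card_congr
    { toFun := fun z => ⟨Quotient.mk _ z.1, by rw [hout]; exact z.2⟩
      invFun := fun ω => ⟨ω.1.out, ω.2⟩
      left_inv := fun z => Subtype.ext (hout z.1)
      right_inv := fun ω => Subtype.ext (Quotient.out_eq ω.1) }

variable [Finite X]

theorem normFactor_smul (f : X →[G] Y) {y : Y} {H : Subgroup G}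
    (hH : H ≤ MulAction.stabilizer G y) (a : Omega G X) {g : G} (hg : g ∈ H) (x : X) :
    normFactor f y H a (g • x) = normFactor f y H a x := by
  rw [normFactor, normFactor, stabilizer_smul_comm, mark_smul]
  have h := map_smul_of_le_stabilizer f hH hg (x := x)
  by_cases hx : f x = y
  · rw [if_pos hx, if_pos (h.mpr hx)]
  · rw [if_neg hx, if_neg (mt h.mp hx)]

variable [Finite Y]

/-- The multiplicative transfer from a disjoint union is the product of those from its parts. -/
theorem mark_mulTransfer_sum {X₁ X₂ : Type u} [MulAction G X₁] [MulAction G X₂] [Finite X₁]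
    [Finite X₂] {i₁ : X₁ →[G] X} {i₂ : X₂ →[G] X}
    (hi : Function.Bijective (Sum.elim i₁ i₂ : X₁ ⊕ X₂ → X)) (f : X →[G] Y) {y : Y}
    {H : Subgroup G} (hH : H ≤ MulAction.stabilizer G y) (a : Omega G X) :
    mark y H (mulTransfer f a) = mark y H (mulTransfer (f.comp i₁) (resMap i₁ a)) *
      mark y H (mulTransfer (f.comp i₂) (resMap i₂ a)) := by
  classical
  have := Fintype.ofFinite (MulAction.orbitRel.Quotient H X)
  have := Fintype.ofFinite (MulAction.orbitRel.Quotient H X₁)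
  have := Fintype.ofFinite (MulAction.orbitRel.Quotient H X₂)
  have hi₁ : Function.Injective i₁ := hi.1.comp Sum.inl_injective
  have hi₂ : Function.Injective i₂ := hi.1.comp Sum.inr_injective
  have factor {Z : Type u} [MulAction G Z] [Finite Z] {i : Z →[G] X} (hi : Function.Injective i)
      (z : Z) : normFactor (f.comp i) y H (resMap i a) z = normFactor f y H a (i z) := by
    rw [normFactor, normFactor, mark_resMap inf_le_right, stabilizer_map_injective hi]
    rfl
  rw [mark_mulTransfer f y hH, mark_mulTransfer _ y hH, mark_mulTransfer _ y hH]
  have hmap {Z : Type u} [MulAction G Z] (i : Z →[G] X) (z w : Z)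
      (h : MulAction.orbitRel H Z z w) : MulAction.orbitRel H X (i z) (i w) := by
    obtain ⟨g, rfl⟩ := h
    exact ⟨g, (map_smul i (g : G) w).symm⟩
  -- The orbits of `H` on the disjoint union are those on its two parts, and the product of factors
  -- splits accordingly.
  let φ : MulAction.orbitRel.Quotient H X₁ ⊕ MulAction.orbitRel.Quotient H X₂ →
      MulAction.orbitRel.Quotient H X :=
    Sum.elim (Quotient.map i₁ (hmap i₁)) (Quotient.map i₂ (hmap i₂))
  have hφ : Function.Bijective φ := by
    constructor
    · rintro (ω | ω) (ω' | ω') h <;> induction ω using Quotient.inductionOn with | _ z <;>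
        induction ω' using Quotient.inductionOn with | _ w <;> obtain ⟨g, hg⟩ := Quotient.exact h
      · have hg' : i₁ ((g : G) • w) = i₁ z := (map_smul i₁ (g : G) w).trans hg
        exact congrArg Sum.inl (Quotient.sound ⟨g, hi₁ hg'⟩)
      · have hg' : i₂ ((g : G) • w) = i₁ z := (map_smul i₂ (g : G) w).trans hg
        exact absurd (hi.1 (a₁ := Sum.inr _) (a₂ := Sum.inl _) hg') Sum.inr_ne_inl
      · have hg' : i₁ ((g : G) • w) = i₂ z := (map_smul i₁ (g : G) w).trans hg
        exact absurd (hi.1 (a₁ := Sum.inl _) (a₂ := Sum.inr _) hg') Sum.inl_ne_inr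
      · have hg' : i₂ ((g : G) • w) = i₂ z := (map_smul i₂ (g : G) w).trans hg
        exact congrArg Sum.inr (Quotient.sound ⟨g, hi₂ hg'⟩)
    · intro ω
      induction ω using Quotient.inductionOn with | _ x
      obtain ⟨z | z, rfl⟩ := hi.2 x
      · exact ⟨Sum.inl (Quotient.mk _ z), rfl⟩
      · exact ⟨Sum.inr (Quotient.mk _ z), rfl⟩
  have hout (x : X) : normFactor f y H a (Quotient.mk (MulAction.orbitRel H X) x).out =
      normFactor f y H a x := by
    obtain ⟨h, hh⟩ := exists_smul_out (H := H) x
    exact (normFactor_smul f hH a h.2 _).symm.trans (congrArg _ hh)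
  rw [← (Equiv.ofBijective φ hφ).prod_comp, Fintype.prod_sum_type]
  congr 1
  · refine Finset.prod_congr rfl fun ω _ => ?_
    rw [factor hi₁, ← hout (i₁ _)]
    exact congrArg (fun ω' => normFactor f y H a (φ (Sum.inl ω')).out) (Quotient.out_eq ω).symm
  · refine Finset.prod_congr rfl fun ω _ => ?_
    rw [factor hi₂, ← hout (i₂ _)]
    exact congrArg (fun ω' => normFactor f y H a (φ (Sum.inr ω')).out) (Quotient.out_eq ω).symm

/-- The product over an empty fibre is `1`, even for `a = 0`. This is why multiplicative transfers
must be compared with their value at zero. -/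
theorem mark_mulTransfer_of_isEmpty (f : X →[G] Y) {y : Y} {H : Subgroup G}
    (hH : H ≤ MulAction.stabilizer G y) (hy : ∀ x, f x ≠ y) (a : Omega G X) :
    mark y H (mulTransfer f a) = 1 := by
  have := Fintype.ofFinite (MulAction.orbitRel.Quotient H X)
  rw [mark_mulTransfer f y hH]
  exact Finset.prod_eq_one fun ω _ => if_neg (hy _)

/-- The orbit of `x` contributes this factor to the product. The subgroup only shrinks, which makes
conditions on all subgroups of a given one stable under transfer. -/
theorem dvd_mark_mulTransfer (f : X →[G] Y) (x : X) {H : Subgroup G}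
    (hH : H ≤ MulAction.stabilizer G (f x)) (a : Omega G X) :
    mark x (H ⊓ MulAction.stabilizer G x) a ∣ mark (f x) H (mulTransfer f a) := by
  have := Fintype.ofFinite (MulAction.orbitRel.Quotient H X)
  rw [mark_mulTransfer f (f x) hH]
  obtain ⟨h, hh⟩ := exists_smul_out (H := H) x
  refine dvd_trans (dvd_of_eq ?_) (Finset.dvd_prod_of_mem _
    (Finset.mem_univ (Quotient.mk (MulAction.orbitRel H X) x)))
  conv_rhs => rw [← normFactor_smul f hH a h.2, hh, normFactor, if_pos rfl]

theorem mark_mulTransfer_zero (f : X →[G] Y) (x : X) {H : Subgroup G}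
    (hH : H ≤ MulAction.stabilizer G (f x)) : mark (f x) H (mulTransfer f 0) = 0 := by
  have := dvd_mark_mulTransfer f x hH 0
  rwa [map_zero, zero_dvd_iff] at this

/-- The marks of the multiplicative transfer along a map of transitive `G`-sets. -/
theorem exists_mark_mulTransfer_eq_pow [MulAction.IsPretransitive G X] (f : X →[G] Y)
    (x : X) {H : Subgroup G} (hH : H ≤ MulAction.stabilizer G (f x)) : ∃ e : ℕ,
    e * (Nat.card H * Nat.card (MulAction.stabilizer G x)) =
      Nat.card (MulAction.stabilizer G (f x)) *
        Nat.card (H ⊓ MulAction.stabilizer G x : Subgroup G) ∧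
    ∀ a : Omega G X, mark (f x) H (mulTransfer f a) =
      mark x (H ⊓ MulAction.stabilizer G x) a ^ e := by
  classical
  have := Fintype.ofFinite (MulAction.orbitRel.Quotient H X)
  -- The exponent is the number of `H`-orbits in the fibre. Recording it by a multiplicative
  -- relation between orders lets exponents of different maps be compared by cancellation.
  refine ⟨(H ⊔ MulAction.stabilizer G x).relIndex (MulAction.stabilizer G (f x)), ?_, fun a => ?_⟩
  · have h := Subgroup.relIndex_mul_relIndex ⊥ (H ⊔ MulAction.stabilizer G x) _ bot_le
      (sup_le hH (stabilizer_le_map f x))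
    rw [Subgroup.relIndex_bot_left, Subgroup.relIndex_bot_left] at h
    rw [card_mul_card_eq_card_sup_mul_card_inf, ← h]
    ring
  · rw [mark_mulTransfer f (f x) hH, ← card_orbits_of_fibre f x hH, Nat.card_eq_fintype_card,
      Fintype.card_subtype, ← Finset.prod_const, Finset.prod_filter]
    refine Finset.prod_congr rfl fun ω _ => ?_
    rw [normFactor, stabilizer_congr ω.out x, mark_congr ω.out x]

/-- The full stabilizer of `f x` has a single orbit on the fibre, so the exponent is one. This
carries a mark at a small subgroup unchanged to a mark at a larger one. -/
theorem mark_mulTransfer_stabilizer [Finite G] [MulAction.IsPretransitive G X] (f : X →[G] Y)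
    (x : X) (a : Omega G X) :
    mark (f x) (MulAction.stabilizer G (f x)) (mulTransfer f a) =
      mark x (MulAction.stabilizer G x) a := by
  obtain ⟨e, he, h⟩ := exists_mark_mulTransfer_eq_pow f x le_rfl
  rw [inf_eq_right.mpr (stabilizer_le_map f x)] at he h
  have he' : e = 1 := Nat.eq_of_mul_eq_mul_right (Nat.mul_pos Nat.card_pos Nat.card_pos)
    (he.trans (one_mul _).symm)
  rw [h, he', pow_one]

end CommNorm

/-! ### Decomposition of classes into orbits. -/

section Classes

variable {G : Type u} [Group G] {X Y Z : Type u} [MulAction G X] [MulAction G Y] [MulAction G Z]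
  [Finite X] [Finite Y] [Finite Z]

theorem addTransfer_comp (f : Y →[G] Z) (g : X →[G] Y) (a : Omega G X) :
    addTransfer (f.comp g) a = addTransfer f (addTransfer g a) :=
  hom_eq_of_cls (g := (addTransfer f).comp (addTransfer g)) (fun A => by
    rw [AddMonoidHom.comp_apply, addTransfer_cls, addTransfer_cls, addTransfer_cls]
    rfl) a

theorem cls_eq_of_bijective {A B : GSetOver G X} (φ : A → B) (hφ : Function.Bijective φ)
    (hg : ∀ (g : G) (a : A), φ (g • a) = g • φ a) (hp : ∀ a : A, B.proj (φ a) = A.proj a) :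
    cls A = cls B :=
  congrArg GrothendieckRing.of (Semi.mk_eq_of_bijective φ hφ hg hp)

theorem cls_eq_sum_sep {n : ℕ} (A : GSetOver G X) (κ : A → Fin n)
    (hκ : ∀ (g : G) (a : A), κ (g • a) = κ a) :
    cls A = ∑ i, cls (sep A (fun a => κ a = i) fun g a h => (hκ g a).trans h) := by
  rw [cls, Semi.mk_eq_sum_sep A κ hκ, map_sum]
  rfl

theorem addTransfer_one_of_bijective {f : X →[G] Y} (hf : Function.Bijective f) :
    addTransfer f 1 = 1 := by
  rw [← cls_self, ← cls_self, addTransfer_cls]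
  exact cls_eq_of_bijective (A := push f self) (B := self) f hf (map_smul f) fun _ => rfl

variable (G X) in
/-- A numbering of the orbits of a finite `G`-set. -/
theorem exists_orbit_numbering : ∃ (n : ℕ) (κ : X → Fin n) (x : Fin n → X),
    (∀ (g : G) (y : X), κ (g • y) = κ y) ∧ (∀ i, κ (x i) = i) ∧
      ∀ y, y ∈ MulAction.orbit G (x (κ y)) := by
  let e := Finite.equivFin (MulAction.orbitRel.Quotient G X)
  refine ⟨_, fun y => e (Quotient.mk _ y), fun i => (e.symm i).out, fun g y => ?_, fun i => ?_,
    fun y => ?_⟩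
  · exact congrArg e (Quotient.sound ⟨g, rfl⟩)
  · exact (congrArg e (Quotient.out_eq _)).trans (e.apply_symm_apply i)
  · change y ∈ MulAction.orbit G (e.symm (e (Quotient.mk _ y))).out
    rw [e.symm_apply_apply]
    exact MulAction.mem_orbit_symm.mp (Quotient.mk_out (s := MulAction.orbitRel G X) y)

end Classes

/-! ### Orbits as generators of Burnside rings. -/

section Orbits

variable {G : Type u} [Group G] [Finite G]

/-- The base point of `G / H`. -/
def basePt (H : Subgroup G) : FinGSet.orbit H := ((1 : G) : G ⧸ H)

theorem exists_smul_basePt {H : Subgroup G} (x : FinGSet.orbit H) : ∃ g : G, g • basePt H = x := by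
  obtain ⟨g, rfl⟩ := QuotientGroup.mk_surjective (s := H) x
  exact ⟨g, congrArg (QuotientGroup.mk (s := H)) (mul_one g)⟩

instance (H : Subgroup G) : MulAction.IsPretransitive G (FinGSet.orbit H) where
  exists_smul_eq x y := by
    obtain ⟨g, rfl⟩ := exists_smul_basePt x
    obtain ⟨h, rfl⟩ := exists_smul_basePt y
    exact ⟨h * g⁻¹, by rw [mul_smul, inv_smul_smul]⟩

theorem isTransitive_orbit (H : Subgroup G) : IsTransitive (FinGSet.orbit H) :=
  ⟨⟨basePt H⟩, inferInstance⟩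

theorem stabilizer_basePt (H : Subgroup G) : MulAction.stabilizer G (basePt H) = H :=
  MulAction.stabilizer_quotient H

variable {X : Type u} [MulAction G X]

/-- The map `G / H → X` with value `x` at the base point. -/
def orbitMap (x : X) {H : Subgroup G} (hH : H ≤ MulAction.stabilizer G x) :
    FinGSet.orbit H →[G] X where
  toFun := Quotient.lift (fun g : G => g • x) fun g h e => by
    have := hH (QuotientGroup.leftRel_apply.mp e)
    rw [MulAction.mem_stabilizer_iff, mul_smul, inv_smul_eq_iff] at this
    exact this.symm
  map_smul' g y := by
    induction y using QuotientGroup.induction_on with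
    | H h => exact mul_smul g h x

theorem orbitMap_basePt (x : X) {H : Subgroup G} (hH : H ≤ MulAction.stabilizer G x) :
    orbitMap x hH (basePt H) = x := one_smul G x

theorem orbitMap_injective (x : X) {H : Subgroup G} (hH : H = MulAction.stabilizer G x) :
    Function.Injective (orbitMap x hH.le) := by
  intro y z h
  obtain ⟨g, rfl⟩ := exists_smul_basePt y
  obtain ⟨g', rfl⟩ := exists_smul_basePt z
  rw [map_smul, map_smul, orbitMap_basePt, ← inv_smul_eq_iff, ← mul_smul] at h
  rw [← inv_smul_eq_iff, ← mul_smul, ← MulAction.mem_stabilizer_iff, stabilizer_basePt, hH]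
  exact h

theorem mem_range_orbitMap {x y : X} {H : Subgroup G} (hH : H ≤ MulAction.stabilizer G x) :
    y ∈ Set.range (orbitMap x hH) ↔ y ∈ MulAction.orbit G x := by
  constructor
  · rintro ⟨z, rfl⟩
    obtain ⟨g, rfl⟩ := exists_smul_basePt z
    exact ⟨g, by rw [map_smul, orbitMap_basePt]⟩
  · rintro ⟨g, rfl⟩
    exact ⟨g • basePt H, by rw [map_smul, orbitMap_basePt]⟩

theorem hom_ext_basePt {H : Subgroup G} {f g : FinGSet.orbit H →[G] X}
    (h : f (basePt H) = g (basePt H)) : f = g := by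
  ext x
  obtain ⟨g, rfl⟩ := exists_smul_basePt x
  rw [map_smul, map_smul, h]

variable [Finite X]

/-- The Burnside ring over `X` is additively generated by the classes of the orbits over `X`. -/
theorem mem_of_orbits (P : AddSubgroup (Omega G X))
    (h : ∀ (x : X) (H : Subgroup G) (hH : H ≤ MulAction.stabilizer G x),
      addTransfer (orbitMap x hH) 1 ∈ P) (a : Omega G X) : a ∈ P := by
  suffices key : ∀ A : GSetOver G X, cls A ∈ P by
    obtain ⟨A, B, rfl⟩ := exists_cls_sub a
    exact P.sub_mem (key A) (key B)
  intro A
  -- Here the total space `A` is cut into orbits; each orbit, viewed over `X`, is the image of the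
  -- unit under an additive transfer from `G / Stab`.
  obtain ⟨n, κ, r, hκ, hr, hr'⟩ := exists_orbit_numbering G A
  rw [cls_eq_sum_sep A κ hκ]
  refine P.sum_mem fun i _ => ?_
  have hle := stabilizer_le_map A.proj (r i)
  have hmem (z : FinGSet.orbit (MulAction.stabilizer G (r i))) :
      κ (orbitMap (r i) le_rfl z) = i := by
    obtain ⟨g, hg⟩ := (mem_range_orbitMap (x := r i) le_rfl).mp ⟨z, rfl⟩
    rw [← hg]
    exact (hκ g _).trans (hr i)
  have hproj : A.proj.comp (orbitMap (r i) le_rfl) = orbitMap (A.proj (r i)) hle :=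
    hom_ext_basePt (by rw [MulActionHom.comp_apply, orbitMap_basePt, orbitMap_basePt])
  have hcls : cls (push (orbitMap (A.proj (r i)) hle) self) =
      cls (sep A (fun a => κ a = i) fun g a h => (hκ g a).trans h) := by
    refine cls_eq_of_bijective (A := push (orbitMap (A.proj (r i)) hle) self)
      (fun z : FinGSet.orbit (MulAction.stabilizer G (r i)) => ⟨orbitMap (r i) le_rfl z, hmem z⟩)
      ⟨?_, ?_⟩ ?_ ?_
    · intro z w hzw
      exact orbitMap_injective (r i) rfl (congrArg Subtype.val hzw)
    · rintro ⟨a, rfl⟩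
      obtain ⟨z, hz⟩ := (mem_range_orbitMap (x := r (κ a)) le_rfl).mpr (hr' a)
      exact ⟨z, Subtype.ext hz⟩
    · intro g z
      exact Subtype.ext (map_smul (orbitMap (r i) le_rfl) g z)
    · intro z
      exact DFunLike.congr_fun hproj z
  rw [← hcls, ← addTransfer_cls, cls_self]
  exact h _ _ hle

variable (G X) in
/-- Every element of the Burnside ring over `X` is the sum of its restrictions to the orbits. -/
theorem eq_sum_orbits : ∃ (n : ℕ) (x : Fin n → X), ∀ a : Omega G X,
    a = ∑ i, addTransfer (orbitMap (x i) le_rfl) (resMap (orbitMap (x i) le_rfl) a) := by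
  -- Now the base `X` is cut into orbits: the part of `A` over an orbit is obtained by restricting
  -- to that orbit and pushing forward again.
  obtain ⟨n, κ, r, hκ, hr, hr'⟩ := exists_orbit_numbering G X
  refine ⟨n, r, fun a => ?_⟩
  suffices key : ∀ A : GSetOver G X, cls A =
      ∑ i, addTransfer (orbitMap (r i) le_rfl) (resMap (orbitMap (r i) le_rfl) (cls A)) by
    obtain ⟨A, B, rfl⟩ := exists_cls_sub a
    simp only [map_sub, Finset.sum_sub_distrib]
    rw [← key A, ← key B]
  intro A
  have hκA (g : G) (a : A) : κ (A.proj (g • a)) = κ (A.proj a) := by rw [A.proj_smul, hκ]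
  refine (cls_eq_sum_sep A (fun a => κ (A.proj a)) hκA).trans (Finset.sum_congr rfl fun i _ => ?_)
  rw [resMap_cls, addTransfer_cls]
  have hmem (z : FibrePt (orbitMap (r i) le_rfl) A) : κ (A.proj z.fst) = i := by
    obtain ⟨g, hg⟩ := (mem_range_orbitMap (x := r i) le_rfl).mp ⟨z.snd, rfl⟩
    rw [z.eq, ← hg]
    exact (hκ g _).trans (hr i)
  refine (cls_eq_of_bijective
    (A := push (orbitMap (r i) le_rfl) (pullback (orbitMap (r i) le_rfl) A))
    (B := sep A (fun a => κ (A.proj a) = i) fun g a h => (hκA g a).trans h)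
    (fun z : FibrePt (orbitMap (r i) le_rfl) A => ⟨z.fst, hmem z⟩) ⟨?_, ?_⟩ ?_ ?_).symm
  · intro z w hzw
    have h₁ : z.fst = w.fst := congrArg Subtype.val hzw
    exact FibrePt.ext h₁ (orbitMap_injective _ rfl (z.eq.symm.trans ((congrArg _ h₁).trans w.eq)))
  · rintro ⟨a, rfl⟩
    obtain ⟨z, hz⟩ := (mem_range_orbitMap (x := r (κ (A.proj a))) le_rfl).mpr (hr' _)
    exact ⟨⟨a, z, hz.symm⟩, rfl⟩
  · intro g z
    rfl
  · intro z
    exact z.eq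

end Orbits

/-- The group `G` is cyclic of order `p ^ r` for a prime `p`. -/
structure IsCyclicPGroup (G : Type u) [CommGroup G] (p r : ℕ) : Prop where
  prime : p.Prime
  isCyclic : IsCyclic G
  card : Nat.card G = p ^ r

/-! ### The chain of subgroups of a cyclic `p`-group. -/

section Subgroups

variable {G : Type u} [CommGroup G] {p r : ℕ}

theorem subgroupH_mono {j k : ℕ} (h : j ≤ k) : subgroupH G p j ≤ subgroupH G p k :=
  monotone_nat_of_le_succ (subgroupH_le_succ G p) h

theorem subgroupH_zero : subgroupH G p 0 = ⊥ := by
  refine (Subgroup.eq_bot_iff_forall _).mpr fun g hg => ?_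
  have h : g ^ p ^ 0 = 1 := hg
  rwa [pow_zero, pow_one] at h

theorem isPGroup_subgroup (hG : IsCyclicPGroup G p r) (H : Subgroup G) : IsPGroup p H := by
  have : IsPGroup p G := IsPGroup.of_card hG.card
  exact this.to_subgroup H

variable [Finite G]

theorem card_subgroupH (hG : IsCyclicPGroup G p r) {k : ℕ} (hk : k ≤ r) :
    Nat.card (subgroupH G p k) = p ^ k := by
  have := hG.isCyclic
  rw [subgroupH, IsCyclic.card_powMonoidHom_ker, hG.card]
  exact Nat.gcd_eq_right (pow_dvd_pow p hk)

theorem subgroupH_le_iff (hG : IsCyclicPGroup G p r) {j k : ℕ} (hj : j ≤ r) (hk : k ≤ r) :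
    subgroupH G p j ≤ subgroupH G p k ↔ j ≤ k := by
  refine ⟨fun h => ?_, subgroupH_mono⟩
  have := Subgroup.card_le_of_le h
  rw [card_subgroupH hG hj, card_subgroupH hG hk] at this
  exact (Nat.pow_le_pow_iff_right hG.prime.one_lt).mp this

/-- A subgroup of order `p ^ j` is killed by `p ^ j`, hence lies in `H_j`, and the orders agree. -/
theorem exists_eq_subgroupH (hG : IsCyclicPGroup G p r) (H : Subgroup G) :
    ∃ j ≤ r, H = subgroupH G p j := by
  have hd := Subgroup.card_subgroup_dvd_card H
  rw [hG.card] at hd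
  obtain ⟨j, hj, hc⟩ := (Nat.dvd_prime_pow hG.prime).mp hd
  refine ⟨j, hj, Subgroup.eq_of_le_of_card_ge (fun g hg => ?_) ?_⟩
  · change g ^ p ^ j = 1
    rw [← hc]
    exact congrArg Subtype.val (pow_card_eq_one' (x := (⟨g, hg⟩ : H)))
  · rw [hc, card_subgroupH hG hj]

theorem le_subgroupH_of_lt (hG : IsCyclicPGroup G p r) {k : ℕ} (hk : k + 1 ≤ r) {H : Subgroup G}
    (hH : H ≤ subgroupH G p (k + 1)) (hne : H ≠ subgroupH G p (k + 1)) : H ≤ subgroupH G p k := by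
  obtain ⟨j, hj, rfl⟩ := exists_eq_subgroupH hG H
  have h := (subgroupH_le_iff hG hj hk).mp hH
  refine subgroupH_mono (Nat.lt_succ_iff.mp (lt_of_le_of_ne h ?_))
  rintro rfl
  exact hne rfl

theorem stabilizer_orbit {H : Subgroup G} (x : FinGSet.orbit H) :
    MulAction.stabilizer G x = H :=
  (stabilizer_congr x (basePt H)).trans (stabilizer_basePt H)

end Subgroups

/-! ### Marks on the rings `R_k`. -/

section Phi

variable {G : Type u} [CommGroup G] [Finite G] {p r : ℕ}

/-- The mark of an element of `R_k` at the subgroup `H_j`. -/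
noncomputable def phi (k j : ℕ) : R G p k →+ ℤ := mark (basePt (subgroupH G p k)) (subgroupH G p j)

theorem subgroupH_le_stabilizer {j k : ℕ} (h : j ≤ k) (x : orbitH G p k) :
    subgroupH G p j ≤ MulAction.stabilizer G x := by
  rw [stabilizer_orbit]
  exact subgroupH_mono h

theorem mark_eq_phi {k j : ℕ} (x : orbitH G p k) (a : R G p k) :
    mark x (subgroupH G p j) a = phi k j a :=
  mark_congr _ _ _ _

theorem phi_mul {k j : ℕ} (a b : R G p k) : phi k j (a * b) = phi k j a * phi k j b :=
  mark_mul _ _ _ _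

theorem phi_one {k j : ℕ} (h : j ≤ k) : phi k j (1 : R G p k) = 1 :=
  mark_one (subgroupH_le_stabilizer h _)

theorem phi_pow {k j : ℕ} (h : j ≤ k) (a : R G p k) (n : ℕ) : phi k j (a ^ n) = phi k j a ^ n :=
  mark_pow (subgroupH_le_stabilizer h _) a n

theorem phi_intCast {k j : ℕ} (h : j ≤ k) (n : ℤ) : phi k j (n : R G p k) = n :=
  mark_intCast (subgroupH_le_stabilizer h _) n

theorem phi_natCast {k j : ℕ} (h : j ≤ k) (n : ℕ) : phi k j (n : R G p k) = n :=
  mark_natCast (subgroupH_le_stabilizer h _) n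

theorem phi_eq_zero (hG : IsCyclicPGroup G p r) {k j : ℕ} (hj : j ≤ r) (hk : k ≤ r) (h : k < j)
    (a : R G p k) : phi k j a = 0 := by
  refine mark_eq_zero (fun hle => ?_) a
  rw [stabilizer_basePt, subgroupH_le_iff hG hj hk] at hle
  omega

/-- An equivariant map can only enlarge stabilizers. -/
theorem le_of_hom (hG : IsCyclicPGroup G p r) {i k : ℕ} (hi : i ≤ r) (hk : k ≤ r)
    (f : orbitH G p i →[G] orbitH G p k) : i ≤ k := by
  have := stabilizer_le_map f (basePt _)
  rwa [stabilizer_orbit, stabilizer_orbit, subgroupH_le_iff hG hi hk] at this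

theorem phi_resMap {i j k : ℕ} (hj : j ≤ i) (f : orbitH G p i →[G] orbitH G p k) (a : R G p k) :
    phi i j (resMap f a) = phi k j a :=
  (mark_resMap (subgroupH_le_stabilizer hj _) f a).trans (mark_eq_phi _ a)

theorem phi_res {j k : ℕ} (hj : j ≤ k) (a : R G p (k + 1)) :
    phi k j (res G p k a) = phi (k + 1) j a :=
  phi_resMap hj _ a

/-- The fibre of the projection has `p` points, and all of them carry the same mark. -/
theorem mark_ind (hG : IsCyclicPGroup G p r) {k : ℕ} (hk : k + 1 ≤ r) (y : orbitH G p (k + 1))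
    (x : orbitH G p k) (H : Subgroup G) (a : R G p k) :
    mark y H (ind G p k a) = p * mark x H a := by
  classical
  have := Fintype.ofFinite (orbitH G p k)
  rw [mark_congr y (projH G p k x), ind, mark_addTransfer,
    Finset.sum_congr rfl fun z _ => mark_congr z x H a, Finset.sum_const, nsmul_eq_mul,
    ← Fintype.card_subtype, ← Nat.card_eq_fintype_card, card_fibre, stabilizer_orbit,
    stabilizer_orbit]
  have h := Subgroup.relIndex_mul_relIndex ⊥ _ _ bot_le (subgroupH_le_succ G p k)
  rw [Subgroup.relIndex_bot_left, Subgroup.relIndex_bot_left, card_subgroupH hG hk,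
    card_subgroupH hG (by omega), pow_succ] at h
  rw [Nat.eq_of_mul_eq_mul_left (pow_pos hG.prime.pos k) h]

theorem phi_ind (hG : IsCyclicPGroup G p r) {k : ℕ} (hk : k + 1 ≤ r) (j : ℕ) (a : R G p k) :
    phi (k + 1) j (ind G p k a) = p * phi k j a :=
  mark_ind hG hk _ _ _ a

/-- The exponent counts the `H_j`-orbits on a fibre isomorphic to `H_n / H_k`, that is, the index in
`H_n` of the larger of `H_j` and `H_k`. -/
theorem phi_mulTransfer (hG : IsCyclicPGroup G p r) {j k n : ℕ} (hj : j ≤ n) (hk : k ≤ r)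
    (hn : n ≤ r) (g : orbitH G p k →[G] orbitH G p n) (a : R G p k) :
    phi n j (mulTransfer g a) = phi k (min j k) a ^ (p ^ (n - max j k)) := by
  have hkn := le_of_hom hG hk hn g
  obtain ⟨e, he, h⟩ := exists_mark_mulTransfer_eq_pow g (basePt _)
    (subgroupH_le_stabilizer (j := j) hj _)
  have hinf : subgroupH G p j ⊓ subgroupH G p k = subgroupH G p (min j k) := by
    rcases le_total j k with hjk | hjk
    · rw [min_eq_left hjk, inf_eq_left.mpr (subgroupH_mono hjk)]
    · rw [min_eq_right hjk, inf_eq_right.mpr (subgroupH_mono hjk)]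
  rw [stabilizer_orbit, stabilizer_orbit, hinf, card_subgroupH hG (by omega),
    card_subgroupH hG (by omega), card_subgroupH hG (by omega), card_subgroupH hG (by omega),
    ← pow_add _ n] at he
  have he' : e = p ^ (n - max j k) := by
    have h₁ : n + min j k = (n - max j k) + (j + k) := by omega
    rw [h₁, pow_add _ (n - max j k), pow_add _ j] at he
    exact Nat.eq_of_mul_eq_mul_right (mul_pos (pow_pos hG.prime.pos j) (pow_pos hG.prime.pos k)) he
  rw [← mark_eq_phi (g (basePt _)), h, stabilizer_orbit, hinf, he']
  rfl

theorem phi_mulTransfer_top (hG : IsCyclicPGroup G p r) {k n : ℕ} (hk : k ≤ r)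
    (hn : n ≤ r) (g : orbitH G p k →[G] orbitH G p n) (a : R G p k) :
    phi n n (mulTransfer g a) = phi k k a := by
  have hkn := le_of_hom hG hk hn g
  rw [phi_mulTransfer hG le_rfl hk hn, min_eq_right hkn, max_eq_left hkn, Nat.sub_self, pow_zero,
    pow_one]

theorem phi_jnd_top (hG : IsCyclicPGroup G p r) {k : ℕ} (hk : k + 1 ≤ r) (a : R G p k) :
    phi (k + 1) (k + 1) (jnd G p k a) = phi k k a :=
  phi_mulTransfer_top hG (by omega) hk _ a

theorem phi_jnd (hG : IsCyclicPGroup G p r) {j k : ℕ} (hk : k + 1 ≤ r) (hj : j ≤ k) (a : R G p k) :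
    phi (k + 1) j (jnd G p k a) = phi k j a ^ p := by
  have := phi_mulTransfer hG (j := j) (by omega) (by omega) hk (projH G p k) a
  rwa [min_eq_left hj, max_eq_right hj, Nat.add_sub_cancel_left, pow_one] at this

/-! ### The structure of the rings `R_k` -/

theorem addTransfer_orbitMap_one {H : Subgroup G} {k : ℕ} (x : orbitH G p k)
    (hH : H = subgroupH G p k) (hle : H ≤ MulAction.stabilizer G x) :
    addTransfer (orbitMap x hle) 1 = 1 := by
  refine addTransfer_one_of_bijective ⟨orbitMap_injective x (hH.trans (stabilizer_orbit x).symm),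
    fun y => (mem_range_orbitMap hle).mpr (MulAction.exists_smul_eq G x y)⟩

/-- Since `H_0` is trivial, the only orbit over `G / H_0` is the identity, whose class is `1`. -/
theorem exists_eq_intCast (a : R G p 0) : ∃ c : ℤ, a = c := by
  have h := mem_of_orbits (Int.castAddHom (R G p 0)).range (fun x H hH => ?_) a
  · obtain ⟨c, hc⟩ := h
    exact ⟨c, hc.symm⟩
  · rw [addTransfer_orbitMap_one x ?_ hH]
    · exact ⟨1, Int.cast_one⟩
    · rw [stabilizer_orbit, subgroupH_zero, le_bot_iff] at hH
      rw [hH, subgroupH_zero]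

/-- An orbit over `G / H_{k+1}` is either an isomorphism, with class `1`, or has stabilizer inside
`H_k` and then factors through `G / H_k`. This drives the inductions on `k`. -/
theorem exists_eq_intCast_add_ind (hG : IsCyclicPGroup G p r) {k : ℕ} (hk : k + 1 ≤ r)
    (a : R G p (k + 1)) : ∃ (c : ℤ) (b : R G p k), a = c + ind G p k b := by
  have h := mem_of_orbits ((Int.castAddHom (R G p (k + 1))).range ⊔ (ind G p k).range)
    (fun x H hH => ?_) a
  · obtain ⟨_, ⟨c, rfl⟩, _, ⟨b, rfl⟩, h⟩ := AddSubgroup.mem_sup.mp h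
    exact ⟨c, b, h.symm⟩
  · have hH' := hH
    rw [stabilizer_orbit] at hH'
    by_cases hne : H = subgroupH G p (k + 1)
    · rw [addTransfer_orbitMap_one x hne hH]
      exact AddSubgroup.mem_sup_left ⟨1, Int.cast_one⟩
    · have hHk := le_subgroupH_of_lt hG hk hH' hne
      -- Writing `x` as a translate of the projected base point provides its lift `g • basePt` to `G
      -- / H_k`.
      obtain ⟨g, rfl⟩ := MulAction.exists_smul_eq G (projH G p k (basePt _)) x
      have hle : H ≤ MulAction.stabilizer G (g • basePt (subgroupH G p k)) := by
        rwa [stabilizer_orbit]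
      have hcomp : orbitMap (g • projH G p k (basePt _)) hH =
          (projH G p k).comp (orbitMap (g • basePt (subgroupH G p k)) hle) :=
        hom_ext_basePt (by rw [MulActionHom.comp_apply, orbitMap_basePt, orbitMap_basePt, map_smul])
      rw [hcomp, addTransfer_comp]
      exact AddSubgroup.mem_sup_right ⟨_, rfl⟩

/-- The marks separate the elements of `R_k`. -/
theorem eq_zero_of_phi (hG : IsCyclicPGroup G p r) {k : ℕ} (hk : k ≤ r) {a : R G p k}
    (h : ∀ j ≤ k, phi k j a = 0) : a = 0 := by
  induction k with
  | zero =>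
    obtain ⟨c, rfl⟩ := exists_eq_intCast a
    have := h 0 le_rfl
    rw [phi_intCast le_rfl] at this
    rw [this, Int.cast_zero]
  | succ k ih =>
    obtain ⟨c, b, rfl⟩ := exists_eq_intCast_add_ind hG hk a
    -- The mark at `H_{k+1}` kills the induced part and so detects `c`; the remaining marks are `p`
    -- times those of `b`.
    have hc : c = 0 := by
      have := h (k + 1) le_rfl
      rwa [map_add, phi_intCast le_rfl, phi_ind hG hk, phi_eq_zero hG hk (by omega) (by omega),
        mul_zero, add_zero] at this
    rw [hc, Int.cast_zero, zero_add]
    suffices hb : b = 0 by rw [hb, map_zero]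
    refine ih (by omega) fun j hj => ?_
    have := h j (by omega)
    rw [hc, Int.cast_zero, zero_add, phi_ind hG hk] at this
    exact (mul_eq_zero.mp this).resolve_left (Int.natCast_ne_zero.mpr hG.prime.ne_zero)

theorem eq_of_phi (hG : IsCyclicPGroup G p r) {k : ℕ} (hk : k ≤ r) {a b : R G p k}
    (h : ∀ j ≤ k, phi k j a = phi k j b) : a = b := by
  refine sub_eq_zero.mp (eq_zero_of_phi hG hk fun j hj => ?_)
  rw [map_sub, h j hj, sub_self]

/-- The ring `R_0` is the ring of integers. -/
theorem nonempty_ringEquiv_int (hG : IsCyclicPGroup G p r) : Nonempty (R G p 0 ≃+* ℤ) := by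
  have hstab := subgroupH_le_stabilizer (p := p) (le_refl 0) (basePt (subgroupH G p 0))
  refine ⟨RingEquiv.ofBijective (markHom hstab) ⟨?_, fun c => ⟨c, map_intCast (markHom hstab) c⟩⟩⟩
  intro a b hab
  refine eq_of_phi hG (Nat.zero_le r) fun j hj => ?_
  obtain rfl := Nat.le_zero.mp hj
  exact hab

/-- The element of `R_k` whose marks vanish at the proper subgroups of `H_k`. -/
noncomputable def topElt : ∀ k : ℕ, R G p k
  | 0 => 1
  | k + 1 => p - ind G p k 1

variable (p) in
/-- The mark of `topElt` at `H_k`. -/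
def topMark (k : ℕ) : ℤ := if k = 0 then 1 else p

theorem phi_topElt_of_lt (hG : IsCyclicPGroup G p r) {j k : ℕ} (hk : k ≤ r) (h : j < k) :
    phi k j (topElt (G := G) (p := p) k) = 0 := by
  cases k with
  | zero => omega
  | succ k =>
    rw [topElt, map_sub, phi_natCast (by omega), phi_ind hG hk, phi_one (by omega), mul_one,
      sub_self]

theorem phi_topElt_self (hG : IsCyclicPGroup G p r) {k : ℕ} (hk : k ≤ r) :
    phi k k (topElt (G := G) (p := p) k) = topMark p k := by
  cases k with
  | zero => exact phi_one le_rfl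
  | succ k =>
    rw [topElt, map_sub, phi_natCast (by omega), phi_ind hG hk,
      phi_eq_zero hG hk (by omega) (by omega), mul_zero, sub_zero, topMark, if_neg (by omega)]

/-- Both sides have marks supported at `H_k` alone. Multiplying by `topElt k` thus isolates the top
mark. -/
theorem topElt_mul (hG : IsCyclicPGroup G p r) {k : ℕ} (hk : k ≤ r) (a : R G p k) :
    topElt k * a = (phi k k a : R G p k) * topElt k := by
  refine eq_of_phi hG hk fun j hj => ?_
  rw [phi_mul, phi_mul, phi_intCast hj]
  rcases hj.eq_or_lt with rfl | hj
  · ring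
  · rw [phi_topElt_of_lt hG hk hj]
    ring

/-- Conversely, support at the top mark forces an integer multiple of `topElt`: writing the element
as `c + ind b`, vanishing gives `c = -p * phi k 0 b`, so the coefficient is `-phi k 0 b`. -/
theorem eq_intCast_mul_topElt (hG : IsCyclicPGroup G p r) {k : ℕ} (hk : k + 1 ≤ r)
    {a : R G p (k + 1)} (h : ∀ j ≤ k, phi (k + 1) j a = 0) : ∃ c : ℤ, a = (c : R G p (k + 1)) * topElt (k + 1) := by
  obtain ⟨c, b, rfl⟩ := exists_eq_intCast_add_ind hG hk a
  have h' (j : ℕ) (hj : j ≤ k) : c + p * phi k j b = 0 := by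
    have := h j hj
    rwa [map_add, phi_intCast (by omega), phi_ind hG hk] at this
  refine ⟨-phi k 0 b, eq_of_phi hG hk fun j hj => ?_⟩
  rw [map_add, phi_intCast hj, phi_ind hG hk, phi_mul, phi_intCast hj]
  rcases hj.eq_or_lt with rfl | hj
  · rw [phi_topElt_self hG hk, phi_eq_zero hG hk (by omega) (by omega), topMark,
      if_neg (by omega)]
    linarith [h' 0 (Nat.zero_le k)]
  · rw [phi_topElt_of_lt hG hk hj, h' j (by omega), mul_zero]

end Phi

/-! ### The ideals cut out by marks, and their primality. -/

section MarkFamily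

variable {G : Type u} [CommGroup G]

/-- The family of the elements whose marks at the subgroups of `K` are divisible by `q`. -/
def markFamily (K : Subgroup G) (q : ℕ) : Family G := fun X =>
  { carrier := { a | ∀ (x : X), ∀ H ≤ K, (q : ℤ) ∣ mark x H a }
    add_mem' := fun ha hb x H hH => by
      rw [map_add]
      exact dvd_add (ha x H hH) (hb x H hH)
    zero_mem' := fun x H _ => by
      rw [map_zero]
      exact dvd_zero _
    smul_mem' := fun c a ha x H hH => by
      rw [smul_eq_mul, mark_mul]
      exact dvd_mul_of_dvd_right (ha x H hH) _ }

theorem mem_markFamily {K : Subgroup G} {q : ℕ} {X : FinGSet G} {a : Omega G X} :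
    a ∈ markFamily K q X ↔ ∀ (x : X), ∀ H ≤ K, (q : ℤ) ∣ mark x H a := Iff.rfl

theorem markFamily_anti {K K' : Subgroup G} (h : K ≤ K') (q : ℕ) :
    markFamily K' q ≤ markFamily K q := fun _ _ ha x H hH => ha x H (hH.trans h)

/-- Each operation expresses marks of the result through marks of the argument at `H` or smaller
subgroups, so only closure of the set of subgroups of `K` under passing to subgroups matters. -/
theorem isTambaraIdeal_markFamily (K : Subgroup G) (q : ℕ) :
    IsTambaraIdeal (markFamily K q) where
  resMap_mem X Y f b hb x H hH := by
    by_cases hx : H ≤ MulAction.stabilizer G x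
    · rw [mark_resMap hx]
      exact hb _ H hH
    · rw [mark_eq_zero hx]
      exact dvd_zero _
  addTransfer_mem X Y f a ha y H hH := by
    classical
    have := Fintype.ofFinite X
    rw [mark_addTransfer]
    exact Finset.dvd_sum fun x _ => ha x H hH
  mulTransfer_mem X Y f a ha y H hH := by
    by_cases hy : H ≤ MulAction.stabilizer G y
    · by_cases hx : ∃ x, f x = y
      · obtain ⟨x, rfl⟩ := hx
        rw [map_sub, mark_mulTransfer_zero f x hy, sub_zero]
        exact (ha x _ (inf_le_left.trans hH)).trans (dvd_mark_mulTransfer f x hy a)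
      -- Outside the image of `f` both transfers have mark `1`, and only their difference is
      -- divisible by `q`.
      · have hx' : ∀ x, f x ≠ y := fun x h => hx ⟨x, h⟩
        rw [map_sub, mark_mulTransfer_of_isEmpty f hy hx', mark_mulTransfer_of_isEmpty f hy hx',
          sub_self]
        exact dvd_zero _
    · rw [mark_eq_zero hy]
      exact dvd_zero _

theorem natCast_dvd_mul {q : ℕ} (hq : q.Prime ∨ q = 0) {a b : ℤ} (h : (q : ℤ) ∣ a * b) :
    (q : ℤ) ∣ a ∨ (q : ℤ) ∣ b := by
  rcases hq with hq | rfl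
  · exact (Nat.prime_iff_prime_int.mp hq).dvd_or_dvd h
  · simpa using h

theorem not_natCast_dvd_one {q : ℕ} (hq : q.Prime ∨ q = 0) : ¬ (q : ℤ) ∣ 1 := by
  rcases hq with hq | rfl
  · exact (Nat.prime_iff_prime_int.mp hq).not_dvd_one
  · simp

/-- Modulo `p`, each mark at a subgroup fixing `x` equals the mark at the trivial subgroup, so the
conditions for all `K` coincide. -/
theorem markFamily_prime {p r : ℕ} (hG : IsCyclicPGroup G p r) (K : Subgroup G) :
    markFamily K p = markFamily (subgroupH G p 0) p := by
  have := Fact.mk hG.prime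
  rw [subgroupH_zero]
  refine le_antisymm (markFamily_anti bot_le p) fun X a ha x H hH => ?_
  by_cases hx : H ≤ MulAction.stabilizer G x
  · exact (dvd_iff_dvd_of_dvd_sub (mark_modEq (isPGroup_subgroup hG H) hx a)).mp (ha x ⊥ le_rfl)
  · rw [mark_eq_zero hx]
    exact dvd_zero _

variable [Finite G]

/-- If `a` and `b` have marks not divisible by `q`, one diagram for each, with target `G / K`,
carries these marks to the same place, the subgroup `K` at the base point. Their product is there
not divisible by `q`. -/
theorem isTambaraPrime_markFamily (K : Subgroup G) {q : ℕ} (hq : q.Prime ∨ q = 0) :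
    IsTambaraPrime (markFamily K q) where
  isTambaraIdeal := isTambaraIdeal_markFamily K q
  proper := by
    refine ⟨FinGSet.orbit ⊥, fun h => not_natCast_dvd_one hq ?_⟩
    have h1 : (1 : Omega G (FinGSet.orbit (⊥ : Subgroup G))) ∈
        markFamily K q (FinGSet.orbit ⊥) := h ▸ Submodule.mem_top
    have := h1 (basePt ⊥) ⊥ bot_le
    rwa [mark_one bot_le] at this
  prime X Y hX hY a b := by
    have hI := isTambaraIdeal_markFamily K q
    constructor
    · intro h
      by_contra! hab
      obtain ⟨ha, hb⟩ := hab
      simp only [mem_markFamily, not_forall] at ha hb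
      obtain ⟨x, H, hH, ha⟩ := ha
      obtain ⟨y, H', hH', hb⟩ := hb
      -- Restriction to `G / L` followed by multiplicative transfer to `G / K` turns the mark at `L`
      -- into the mark at `K`, with exponent one.
      have value {Z : FinGSet G} {z : Z} {L : Subgroup G} {c : Omega G Z} (hL : L ≤ K)
          (hc : ¬ (q : ℤ) ∣ mark z L c) : ∃ (v : FinGSet.orbit L →[G] FinGSet.orbit K)
          (w : FinGSet.orbit L →[G] Z), mark (basePt K) K
            (mulTransfer v (resMap w c) - mulTransfer v 0) = mark z L c := by
        have hz : L ≤ MulAction.stabilizer G z := by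
          by_contra hz
          rw [mark_eq_zero hz] at hc
          exact hc (dvd_zero _)
        have hL' : L ≤ MulAction.stabilizer G (basePt K) := hL.trans (stabilizer_basePt K).ge
        refine ⟨orbitMap (basePt K) hL', orbitMap z hz, ?_⟩
        have h₁ (d : Omega G (FinGSet.orbit L)) :
            mark (basePt K) K (mulTransfer (orbitMap (basePt K) hL') d) = mark (basePt L) L d := by
          have := mark_mulTransfer_stabilizer (orbitMap (basePt K) hL') (basePt L) d
          rwa [orbitMap_basePt, stabilizer_basePt, stabilizer_basePt] at this
        rw [map_sub, h₁, h₁, map_zero, sub_zero, mark_resMap (stabilizer_basePt L).ge,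
          orbitMap_basePt]
      obtain ⟨v, w, hv⟩ := value hH ha
      obtain ⟨v', w', hv'⟩ := value hH' hb
      have := h _ _ _ v w v' w' (basePt K) K le_rfl
      rw [mark_mul, hv, hv'] at this
      exact (natCast_dvd_mul hq this).elim ha hb
    · rintro (ha | hb) C D D' v w v' w'
      · exact Ideal.mul_mem_right _ _ (hI.mulTransfer_mem D C v _ (hI.resMap_mem D X w a ha))
      · exact Ideal.mul_mem_left _ _ (hI.mulTransfer_mem D' C v' _ (hI.resMap_mem D' Y w' b hb))

end MarkFamily

/-! ### Values of the mark ideals on orbits, and the operations `L` and `S`. -/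

section Terms

variable {G : Type u} [CommGroup G] [Finite G] {p r : ℕ}

theorem mem_markFamily_orbitH (hG : IsCyclicPGroup G p r) {n q k : ℕ} (hn : n ≤ r)
    {a : R G p k} : a ∈ markFamily (subgroupH G p n) q (orbitH G p k) ↔
      ∀ j ≤ n, (q : ℤ) ∣ phi k j a := by
  constructor
  · intro h j hj
    exact h _ _ (subgroupH_mono hj)
  · intro h x H hH
    obtain ⟨j, hj, rfl⟩ := exists_eq_subgroupH hG H
    rw [mark_eq_phi]
    exact h j ((subgroupH_le_iff hG hj hn).mp hH)

theorem mem_markFamily_iff_resMap (hG : IsCyclicPGroup G p r) (K : Subgroup G) (q : ℕ)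
    {X : FinGSet G} {a : Omega G X} : a ∈ markFamily K q X ↔
      ∀ k ≤ r, ∀ f : orbitH G p k →[G] X, resMap f a ∈ markFamily K q (orbitH G p k) := by
  refine ⟨fun h k _ f => (isTambaraIdeal_markFamily K q).resMap_mem _ _ f a h, fun h x H hH => ?_⟩
  by_cases hx : H ≤ MulAction.stabilizer G x
  · obtain ⟨k, hk, rfl⟩ := exists_eq_subgroupH hG H
    have := h k hk (orbitMap x hx) (basePt _) _ hH
    rwa [mark_resMap (stabilizer_basePt _).ge, orbitMap_basePt] at this
  · rw [mark_eq_zero hx]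
    exact dvd_zero _

/-- A family detected by restriction to orbits is recovered from its sequence of values; `hP`
expresses this detection. -/
theorem ofSeq_eq_of_isSeqOf {m : ℕ} {P : Family G} {I : IdealSeq G p m} (hI : IsSeqOf P I)
    (hP : ∀ (X : FinGSet G) (a : Omega G X), a ∈ P X ↔
      ∀ k ≤ m, ∀ f : orbitH G p k →[G] X, resMap f a ∈ P (orbitH G p k)) : ofSeq I = P := by
  funext X
  ext a
  rw [hP]
  simp only [ofSeq, Ideal.mem_iInf, Ideal.mem_comap]
  refine ⟨fun h k hk f => ?_, fun h k f => ?_⟩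
  · rw [hI ⟨k, Nat.lt_succ_of_le hk⟩]
    exact h ⟨k, Nat.lt_succ_of_le hk⟩ f
  · rw [← hI k]
    exact h k (Nat.lt_succ_iff.mp k.2) f

theorem isSeqOf_single {P : Family G} {J : Ideal (R G p 0)} (h : P (orbitH G p 0) = J) :
    IsSeqOf P (single J) := by
  intro k
  obtain ⟨k, hk⟩ := k
  obtain rfl : k = 0 := by omega
  exact h

theorem IsSeqOf.snoc {m : ℕ} {P : Family G} {I : IdealSeq G p m} (hI : IsSeqOf P I)
    {J : Ideal (R G p (m + 1))} (h : P (orbitH G p (m + 1)) = J) :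
    IsSeqOf P (Fin.snoc (α := fun k : Fin (m + 2) => Ideal (R G p k)) I J : IdealSeq G p (m + 1)) := by
  intro k
  induction k using Fin.lastCases with
  | last => rw [Fin.snoc_last]; exact h
  | cast k => rw [Fin.snoc_castSucc]; exact hI k

theorem IsSeqOf.seqLPow {m : ℕ} {P : Family G} {I : IdealSeq G p m} (hI : IsSeqOf P I) (n : ℕ)
    (h : ∀ k, m ≤ k → k + 1 ≤ m + n → P (orbitH G p (k + 1)) = idealL (P (orbitH G p k))) :
    IsSeqOf P (seqLPow n I) := by
  induction n with
  | zero => exact hI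
  | succ n ih =>
    have hI' := ih fun k hk hk' => h k hk (by omega)
    refine hI'.snoc ((h (m + n) (by omega) (by omega)).trans ?_)
    exact congrArg idealL (hI' (Fin.last (m + n)))

theorem IsSeqOf.seqSPow {m : ℕ} {P : Family G} {I : IdealSeq G p m} (hI : IsSeqOf P I) (n : ℕ)
    (h : ∀ k, m ≤ k → k + 1 ≤ m + n → P (orbitH G p (k + 1)) = idealS (P (orbitH G p k))) :
    IsSeqOf P (seqSPow n I) := by
  induction n with
  | zero => exact hI
  | succ n ih =>
    have hI' := ih fun k hk hk' => h k hk (by omega)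
    refine hI'.snoc ((h (m + n) (by omega) (by omega)).trans ?_)
    exact congrArg idealS (hI' (Fin.last (m + n)))

theorem markFamily_orbitH_zero (hG : IsCyclicPGroup G p r) {n : ℕ} (hn : n ≤ r) (q : ℕ) :
    markFamily (subgroupH G p n) q (orbitH G p 0) = idealR0 G p q := by
  ext a
  obtain ⟨c, rfl⟩ := exists_eq_intCast a
  rw [mem_markFamily_orbitH hG hn, idealR0, Ideal.mem_span_singleton]
  constructor
  · intro h
    have := h 0 (Nat.zero_le n)
    rw [phi_intCast le_rfl] at this
    obtain ⟨d, rfl⟩ := this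
    exact ⟨d, by push_cast; rfl⟩
  · rintro ⟨d, hd⟩ j hj
    rw [hd, phi_mul]
    rcases Nat.eq_zero_or_pos j with rfl | hj'
    · rw [phi_natCast le_rfl]
      exact dvd_mul_right _ _
    · rw [phi_eq_zero hG (hj.trans hn) (Nat.zero_le r) hj', zero_mul]
      exact dvd_zero _

/-- From level `n` on no further mark is constrained, and restriction preserves those that are. -/
theorem markFamily_orbitH_succ_eq_idealL (hG : IsCyclicPGroup G p r) {n k : ℕ} (hn : n ≤ r)
    (hnk : n ≤ k) (q : ℕ) : markFamily (subgroupH G p n) q (orbitH G p (k + 1)) =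
      idealL (markFamily (subgroupH G p n) q (orbitH G p k)) := by
  ext a
  rw [idealL, Ideal.mem_comap, mem_markFamily_orbitH hG hn, mem_markFamily_orbitH hG hn]
  exact forall₂_congr fun j hj => by rw [phi_res (hj.trans hnk)]

/-- The target is transitive, so no fibre is empty and every mark has a zero factor. -/
theorem mulTransfer_zero_eq (hG : IsCyclicPGroup G p r) {k m : ℕ} (hm : m ≤ r)
    (g : orbitH G p k →[G] orbitH G p m) : mulTransfer g (0 : R G p k) = 0 := by
  refine eq_zero_of_phi hG hm fun j hj => ?_
  rw [← mark_eq_phi (g (basePt _))]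
  exact mark_mulTransfer_zero g _ (subgroupH_le_stabilizer hj _)

theorem IsTambaraIdeal.mulTransfer_mem_orbitH {I : Family G} (hI : IsTambaraIdeal I)
    (hG : IsCyclicPGroup G p r) {k m : ℕ} (hm : m ≤ r)
    (g : orbitH G p k →[G] orbitH G p m) {a : R G p k} (ha : a ∈ I (orbitH G p k)) :
    mulTransfer g a ∈ I (orbitH G p m) := by
  have := hI.mulTransfer_mem _ _ g a ha
  rwa [mulTransfer_zero_eq hG hm, sub_zero] at this

/-- The element `jnd q` has top mark `q`, so a multiple of it cancels the top mark of `a`. What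
remains is `ind b`, and since `q` is prime to `p`, divisibility of `p * phi k j b` by `q` puts `b`
in the ideal. -/
theorem markFamily_orbitH_succ_eq_idealS (hG : IsCyclicPGroup G p r) {n k q : ℕ} (hn : n ≤ r)
    (hkn : k + 1 ≤ n) (hq : q.Prime) (hqp : q ≠ p) :
    markFamily (subgroupH G p n) q (orbitH G p (k + 1)) =
      idealS (markFamily (subgroupH G p n) q (orbitH G p k)) := by
  have hI := isTambaraIdeal_markFamily (subgroupH G p n) q
  have hk : k + 1 ≤ r := hkn.trans hn
  refine le_antisymm (fun a ha => ?_) (sup_le ?_ ?_)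
  · have hjnd : jnd G p k q ∈ idealS (markFamily (subgroupH G p n) q (orbitH G p k)) := by
      refine (le_sup_right : _ ≤ idealS _) (Ideal.subset_span ⟨_, ?_, rfl⟩)
      rw [SetLike.mem_coe, mem_markFamily_orbitH hG hn]
      intro j hj
      by_cases hjk : j ≤ k
      · rw [phi_natCast hjk]
      · rw [phi_eq_zero hG (hj.trans hn) (by omega) (by omega)]
        exact dvd_zero _
    have hjnd' : jnd G p k q ∈ markFamily (subgroupH G p n) q (orbitH G p (k + 1)) := by
      refine hI.mulTransfer_mem_orbitH hG hk _ ((mem_markFamily_orbitH hG hn).mpr fun j hj => ?_)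
      by_cases hjk : j ≤ k
      · rw [phi_natCast hjk]
      · rw [phi_eq_zero hG (hj.trans hn) (by omega) (by omega)]
        exact dvd_zero _
    -- Here `m` is the top mark of `a` divided by `q`, the multiple of `jnd q` to subtract.
    obtain ⟨m, hm⟩ := (mem_markFamily_orbitH hG hn).mp ha (k + 1) hkn
    have ha' := Ideal.sub_mem _ ha (Ideal.mul_mem_left _ (m : R G p (k + 1)) hjnd')
    obtain ⟨c, b, hb⟩ := exists_eq_intCast_add_ind hG hk (a - m * jnd G p k q)
    have hc : c = 0 := by
      have := congrArg (phi (k + 1) (k + 1)) hb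
      rw [map_sub, phi_mul, phi_intCast le_rfl, phi_jnd_top hG hk, phi_natCast le_rfl, hm, map_add,
        phi_intCast le_rfl, phi_ind hG hk, phi_eq_zero hG hk (by omega) (by omega)] at this
      linarith
    rw [hc, Int.cast_zero, zero_add] at hb
    rw [hb] at ha'
    have hbmem : b ∈ markFamily (subgroupH G p n) q (orbitH G p k) := by
      refine (mem_markFamily_orbitH hG hn).mpr fun j hj => ?_
      have := (mem_markFamily_orbitH hG hn).mp ha' j hj
      rw [phi_ind hG hk] at this
      refine ((Nat.prime_iff_prime_int.mp hq).dvd_or_dvd this).resolve_left fun h => hqp ?_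
      exact (Nat.prime_dvd_prime_iff_eq hq hG.prime).mp (Int.natCast_dvd_natCast.mp h)
    rw [← sub_add_cancel a (m * jnd G p k q), hb]
    exact Ideal.add_mem _ ((le_sup_left : _ ≤ idealS _) (Ideal.subset_span ⟨b, hbmem, rfl⟩))
      (Ideal.mul_mem_left _ _ hjnd)
  · rw [Ideal.span_le]
    rintro _ ⟨b, hb, rfl⟩
    exact hI.addTransfer_mem _ _ _ b hb
  · rw [Ideal.span_le]
    rintro _ ⟨b, hb, rfl⟩
    exact hI.mulTransfer_mem_orbitH hG hk _ hb

/-- Up to level `n` the conditions include every mark that can be nonzero, and these separate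
elements. -/
theorem markFamily_zero_orbitH (hG : IsCyclicPGroup G p r) {n k : ℕ} (hn : n ≤ r) (hkn : k ≤ n) :
    markFamily (subgroupH G p n) 0 (orbitH G p k) = ⊥ := by
  ext a
  rw [mem_markFamily_orbitH hG hn, Ideal.mem_bot]
  simp only [Nat.cast_zero, zero_dvd_iff]
  constructor
  · exact fun h => eq_zero_of_phi hG (hkn.trans hn) fun j hj => h j (hj.trans hkn)
  · rintro rfl j _
    exact map_zero _

/-! ### The named sequences -/

theorem isSeqOf_seqLS (hG : IsCyclicPGroup G p r) {q i : ℕ} (hi : i ≤ r) (hq : q.Prime)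
    (hqp : q ≠ p) : IsSeqOf (markFamily (subgroupH G p (r - i)) q) (seqLS G p r q i) := by
  refine ((isSeqOf_single (markFamily_orbitH_zero hG (by omega) q)).seqSPow (r - i) ?_).seqLPow i ?_
  · exact fun k _ hk => markFamily_orbitH_succ_eq_idealS hG (by omega) (by omega) hq hqp
  · exact fun k hk _ => markFamily_orbitH_succ_eq_idealL hG (by omega) (by omega) q

theorem isSeqOf_seqL0 (hG : IsCyclicPGroup G p r) {i : ℕ} (hi : i ≤ r) :
    IsSeqOf (markFamily (subgroupH G p (r - i)) 0) (seqL0 G p r i) := by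
  refine IsSeqOf.seqLPow (fun k => ?_) i ?_
  · exact markFamily_zero_orbitH hG (by omega) (by omega)
  · exact fun k hk _ => markFamily_orbitH_succ_eq_idealL hG (by omega) (by omega) 0

theorem isSeqOf_seqLp (hG : IsCyclicPGroup G p r) :
    IsSeqOf (markFamily (subgroupH G p 0) p) (seqLp G p r) := by
  refine (isSeqOf_single (markFamily_orbitH_zero hG (by omega) p)).seqLPow r ?_
  exact fun k hk _ => markFamily_orbitH_succ_eq_idealL hG (by omega) (by omega) p

theorem ofSeq_eq_markFamily (hG : IsCyclicPGroup G p r) {K : Subgroup G} {q m : ℕ} (hm : m = r)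
    {I : IdealSeq G p m} (hI : IsSeqOf (markFamily K q) I) : ofSeq I = markFamily K q := by
  subst hm
  exact ofSeq_eq_of_isSeqOf hI fun X a => mem_markFamily_iff_resMap hG K q

end Terms

/-! ### Reducing primality to a test on orbits. -/

section PrimeTest

variable {G : Type u} [CommGroup G] [Finite G] {p r : ℕ} {I : Family G}

/-- An element is the sum of the additive transfers of its restrictions to the orbits of `X`, so
membership is decided there. -/
theorem IsTambaraIdeal.mem_iff_resMap (hI : IsTambaraIdeal I) (hG : IsCyclicPGroup G p r)
    {X : FinGSet G} {a : Omega G X} : a ∈ I X ↔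
      ∀ k ≤ r, ∀ f : orbitH G p k →[G] X, resMap f a ∈ I (orbitH G p k) := by
  refine ⟨fun h k _ f => hI.resMap_mem _ _ f a h, fun h => ?_⟩
  have key (x : X) (H : Subgroup G) (hH : H ≤ MulAction.stabilizer G x) :
      addTransfer (orbitMap x hH) (resMap (orbitMap x hH) a) ∈ I X := by
    obtain ⟨k, hk, rfl⟩ := exists_eq_subgroupH hG H
    exact hI.addTransfer_mem _ _ _ _ (h k hk _)
  obtain ⟨n, x, hx⟩ := eq_sum_orbits G X
  rw [hx a]
  exact Ideal.sum_mem _ fun i _ => key (x i) _ le_rfl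

theorem resMap_self (hG : IsCyclicPGroup G p r) {k : ℕ} (hk : k ≤ r)
    (f : orbitH G p k →[G] orbitH G p k) (a : R G p k) : resMap f a = a :=
  eq_of_phi hG hk fun _ hj => phi_resMap hj f a

theorem mulTransfer_id (hG : IsCyclicPGroup G p r) {k : ℕ} (hk : k ≤ r) (a : R G p k) :
    mulTransfer (MulActionHom.id G) a = a := by
  refine eq_of_phi hG hk fun j hj => ?_
  rw [phi_mulTransfer hG hj hk hk, min_eq_left hj, max_eq_right hj, Nat.sub_self, pow_zero, pow_one]

theorem phi_resMap_eq_mark {m j : ℕ} (hj : j ≤ m) {C : FinGSet G} (f : orbitH G p m →[G] C)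
    (z : Omega G C) : phi m j (resMap f z) = mark (f (basePt _)) (subgroupH G p j) z :=
  mark_resMap (subgroupH_le_stabilizer hj _) f z

theorem subgroupH_le_stabilizer_map {m j : ℕ} (hj : j ≤ m) {C : FinGSet G}
    (f : orbitH G p m →[G] C) : subgroupH G p j ≤ MulAction.stabilizer G (f (basePt _)) :=
  (subgroupH_le_stabilizer hj _).trans (stabilizer_le_map f _)

/-- The orbit of `d` contributes a zero factor to every mark; thus the correction `v_•(0)`
disappears after restriction whenever the fibre is nonempty. -/
theorem resMap_mulTransfer_zero (hG : IsCyclicPGroup G p r) {m : ℕ} (hm : m ≤ r) {C D : FinGSet G}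
    (f : orbitH G p m →[G] C) (v : D →[G] C) {d : D} (hd : v d = f (basePt _)) :
    resMap f (mulTransfer v 0) = 0 := by
  refine eq_zero_of_phi hG hm fun j hj => ?_
  rw [phi_resMap_eq_mark hj, ← hd]
  exact mark_mulTransfer_zero v d (hd ▸ subgroupH_le_stabilizer_map hj f)

/-- The complement of the orbit of `d`. -/
def orbitCompl (D : FinGSet G) (d : D) : FinGSet G where
  carrier := { y : D // y ∉ MulAction.orbit G d }
  action :=
    { smul := fun g y => ⟨g • y.1, fun ⟨h, hh⟩ => y.2 ⟨g⁻¹ * h, by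
        change (g⁻¹ * h) • d = y.1
        rw [mul_smul, inv_smul_eq_iff]
        exact hh⟩⟩
      one_smul := fun y => Subtype.ext (one_smul G y.1)
      mul_smul := fun g h y => Subtype.ext (mul_smul g h y.1) }

/-- The inclusion of the complement of the orbit of `d`. -/
def orbitComplIncl (D : FinGSet G) (d : D) : orbitCompl D d →[G] D where
  toFun y := y.1
  map_smul' _ _ := rfl

/-- Splitting `D` into the orbit of `d` and its complement makes the transfer a product; the
complement supplies `z`. -/
theorem resMap_mulTransfer_eq_mul (hG : IsCyclicPGroup G p r) {m : ℕ} (hm : m ≤ r)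
    {C D : FinGSet G} (f : orbitH G p m →[G] C) (v : D →[G] C) (d : D) {H : Subgroup G}
    (hH : H = MulAction.stabilizer G d) (x : Omega G D) : ∃ z,
    resMap f (mulTransfer v x) =
      resMap f (mulTransfer (v.comp (orbitMap d hH.le)) (resMap (orbitMap d hH.le) x)) * z := by
  refine ⟨resMap f (mulTransfer (v.comp (orbitComplIncl D d)) (resMap (orbitComplIncl D d) x)),
    eq_of_phi hG hm fun j hj => ?_⟩
  rw [phi_mul, phi_resMap_eq_mark hj, phi_resMap_eq_mark hj, phi_resMap_eq_mark hj]
  refine mark_mulTransfer_sum ⟨?_, fun y => ?_⟩ v (subgroupH_le_stabilizer_map hj f) x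
  · rintro (y | y) (z | z) h
    · exact congrArg Sum.inl (orbitMap_injective d hH h)
    · have h' : orbitMap d hH.le y = z.1 := h
      exact absurd ((mem_range_orbitMap hH.le).mp ⟨y, h'⟩) z.2
    · have h' : y.1 = orbitMap d hH.le z := h
      exact absurd ((mem_range_orbitMap hH.le).mp ⟨z, h'.symm⟩) y.2
    · exact congrArg Sum.inr (Subtype.ext h)
  · by_cases hy : y ∈ MulAction.orbit G d
    · obtain ⟨z, hz⟩ := (mem_range_orbitMap hH.le).mpr hy
      exact ⟨Sum.inl z, hz⟩
    · exact ⟨Sum.inr ⟨y, hy⟩, rfl⟩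

/-- If the proper restrictions of `a` lie in `I`, then so does the restriction to an orbit of a
difference `v_•w^*(a) - v_•(0)`, unless it is a multiple of a transfer of `a` itself. -/
theorem IsTambaraIdeal.resMap_mem_or_eq_mul (hI : IsTambaraIdeal I) (hG : IsCyclicPGroup G p r)
    {k m : ℕ} (hk : k ≤ r) (hm : m ≤ r) {a : R G p k}
    (ha : ∀ i < k, ∀ f : orbitH G p i →[G] orbitH G p k, resMap f a ∈ I (orbitH G p i))
    {C D : FinGSet G} (f : orbitH G p m →[G] C) (v : D →[G] C) (w : D →[G] orbitH G p k) :
    resMap f (mulTransfer v (resMap w a) - mulTransfer v 0) ∈ I (orbitH G p m) ∨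
      ∃ (u : orbitH G p k →[G] C) (z : R G p m), u (basePt _) = f (basePt _) ∧
        resMap f (mulTransfer v (resMap w a) - mulTransfer v 0) =
          resMap f (mulTransfer u a) * z := by
  by_cases hd : ∃ d, v d = f (basePt _)
  · obtain ⟨d, hd⟩ := hd
    obtain ⟨i, hi, hH⟩ := exists_eq_subgroupH hG (MulAction.stabilizer G d)
    have hik := le_of_hom hG hi hk (w.comp (orbitMap d hH.ge))
    obtain ⟨z, hz⟩ := resMap_mulTransfer_eq_mul hG hm f v d hH.symm (resMap w a)
    rw [map_sub, resMap_mulTransfer_zero hG hm f v hd, sub_zero, hz]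
    have hcomp : resMap (orbitMap d hH.ge) (resMap w a) = resMap (w.comp (orbitMap d hH.ge)) a := by
      refine eq_of_phi hG hi fun j hj => ?_
      rw [phi_resMap hj, phi_resMap_eq_mark hj,
        mark_resMap (subgroupH_le_stabilizer_map hj (orbitMap d hH.ge)), mark_eq_phi]
    have hbase : v.comp (orbitMap d hH.ge) (basePt _) = f (basePt _) := by
      rw [MulActionHom.comp_apply, orbitMap_basePt, hd]
    rw [hcomp]
    -- If the orbit of `d` is as small as `G / H_k`, restriction to it leaves `a` unchanged and the
    -- second alternative holds. Otherwise a proper restriction of `a` appears, which lies in `I` by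
    -- `ha`.
    rcases hik.eq_or_lt with rfl | hik
    · rw [resMap_self hG hk]
      exact Or.inr ⟨_, z, hbase, rfl⟩
    · have h₁ := hI.mulTransfer_mem _ _ (v.comp (orbitMap d hH.ge)) _
        (ha i hik (w.comp (orbitMap d hH.ge)))
      have h₂ := hI.resMap_mem _ _ f _ h₁
      rw [map_sub, resMap_mulTransfer_zero hG hm f _ hbase, sub_zero] at h₂
      exact Or.inl (Ideal.mul_mem_right _ _ h₂)
  -- Over an empty fibre both transfers have mark `1`, and their difference restricts to zero.
  · have hd' : ∀ d, v d ≠ f (basePt _) := fun d h => hd ⟨d, h⟩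
    left
    convert (I (orbitH G p m)).zero_mem
    refine eq_zero_of_phi hG hm fun j hj => ?_
    have hj' := subgroupH_le_stabilizer_map hj f
    rw [phi_resMap_eq_mark hj, map_sub, mark_mulTransfer_of_isEmpty v hj' hd',
      mark_mulTransfer_of_isEmpty v hj' hd', sub_self]

/-- This is transitivity of transfers together with multiplicativity. The maps `u` and `t.comp g`
need not coincide, but marks are translation invariant and the exponents depend only on stabilizers.
-/
theorem resMap_mulTransfer_mul (hG : IsCyclicPGroup G p r) {k m n : ℕ} (hm : m ≤ r)
    {C : FinGSet G} (f : orbitH G p m →[G] C) (u : orbitH G p k →[G] C) (t : orbitH G p n →[G] C)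
    (g : orbitH G p k →[G] orbitH G p n) (hu : u (basePt _) = f (basePt _))
    (ht : t (basePt _) = f (basePt _)) (a : R G p k) (b : R G p n) :
    resMap f (mulTransfer u a) * resMap f (mulTransfer t b) =
      resMap f (mulTransfer t (mulTransfer g a * b)) := by
  refine eq_of_phi hG hm fun j hj => ?_
  have hJ := subgroupH_le_stabilizer_map hj f
  have hkn := stabilizer_le_map g (basePt _)
  rw [stabilizer_orbit, stabilizer_orbit] at hkn
  obtain ⟨e₁, he₁, h₁⟩ := exists_mark_mulTransfer_eq_pow u (basePt _) (hJ.trans_eq (by rw [hu]))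
  obtain ⟨e₂, he₂, h₂⟩ := exists_mark_mulTransfer_eq_pow t (basePt _) (hJ.trans_eq (by rw [ht]))
  obtain ⟨e₃, he₃, h₃⟩ := exists_mark_mulTransfer_eq_pow g (basePt _)
    (H := subgroupH G p j ⊓ subgroupH G p n) (inf_le_right.trans_eq (stabilizer_orbit _).symm)
  have hinf : subgroupH G p j ⊓ subgroupH G p n ⊓ subgroupH G p k =
      subgroupH G p j ⊓ subgroupH G p k := by rw [inf_assoc, inf_eq_right.mpr hkn]
  rw [hu, stabilizer_orbit] at he₁ h₁
  rw [ht, stabilizer_orbit] at he₂ h₂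
  rw [stabilizer_orbit, stabilizer_orbit, hinf] at he₃
  rw [stabilizer_orbit, hinf] at h₃
  -- Exponents multiply along the tower; the three order relations give this after cancelling
  -- positive factors.
  have he : e₁ = e₃ * e₂ := by
    have hpos (H : Subgroup G) : 0 < Nat.card H := Nat.card_pos
    refine Nat.eq_of_mul_eq_mul_right (Nat.mul_pos (Nat.mul_pos (hpos (subgroupH G p j))
      (hpos (subgroupH G p k))) (Nat.mul_pos (hpos (subgroupH G p n))
      (hpos (subgroupH G p j ⊓ subgroupH G p n)))) ?_
    generalize Nat.card (subgroupH G p j ⊓ subgroupH G p n : Subgroup G) = x at *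
    generalize Nat.card (subgroupH G p j ⊓ subgroupH G p k : Subgroup G) = y at *
    generalize Nat.card (subgroupH G p j) = x₁ at *
    generalize Nat.card (subgroupH G p k) = x₂ at *
    generalize Nat.card (subgroupH G p n) = x₃ at *
    generalize Nat.card (MulAction.stabilizer G (f (basePt (subgroupH G p m)))) = x₄ at *
    calc e₁ * (x₁ * x₂ * (x₃ * x)) = e₁ * (x₁ * x₂) * (x₃ * x) := by ring
      _ = (e₃ * (x * x₂)) * (x₄ * x) := by rw [he₁, he₃]; ring
      _ = e₃ * e₂ * (x₁ * x₂ * (x₃ * x)) := by rw [← he₂]; ring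
  rw [phi_mul, phi_resMap_eq_mark hj, phi_resMap_eq_mark hj, phi_resMap_eq_mark hj, h₁, h₂, h₂,
    mark_mul, mark_congr _ (g (basePt _)) _ (mulTransfer g a), h₃, mul_pow, ← pow_mul, he]

/-- The form of primality that is used in the classification. -/
theorem IsTambaraPrime.mem_or_mem_of_mulTransfer_mul (hI : IsTambaraPrime I)
    (hG : IsCyclicPGroup G p r) {k n : ℕ} (hk : k ≤ r) (hn : n ≤ r)
    (g : orbitH G p k →[G] orbitH G p n) {a : R G p k} {b : R G p n}
    (ha : ∀ i < k, ∀ f : orbitH G p i →[G] orbitH G p k, resMap f a ∈ I (orbitH G p i))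
    (hb : ∀ i < n, ∀ f : orbitH G p i →[G] orbitH G p n, resMap f b ∈ I (orbitH G p i))
    (hab : mulTransfer g a * b ∈ I (orbitH G p n)) :
    a ∈ I (orbitH G p k) ∨ b ∈ I (orbitH G p n) := by
  have hT := hI.isTambaraIdeal
  refine (hI.prime _ _ (isTransitive_orbit _) (isTransitive_orbit _) a b).mp
    fun C D D' v w v' w' => ?_
  rw [hT.mem_iff_resMap hG]
  intro m hm f
  rw [map_mul]
  rcases hT.resMap_mem_or_eq_mul hG hk hm ha f v w with h | ⟨u, z, hu, h⟩
  · exact Ideal.mul_mem_right _ _ h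
  rcases hT.resMap_mem_or_eq_mul hG hn hm hb f v' w' with h' | ⟨t, z', ht, h'⟩
  · exact Ideal.mul_mem_left _ _ h'
  -- In the only case left, the two factors combine into a multiple of a restricted transfer of
  -- `mulTransfer g a * b`.
  rw [h, h', mul_mul_mul_comm, resMap_mulTransfer_mul hG hm f u t g hu ht]
  have h₁ := hT.resMap_mem _ _ f _ (hT.mulTransfer_mem _ _ t _ hab)
  rw [map_sub, resMap_mulTransfer_zero hG hm f t ht, sub_zero] at h₁
  exact Ideal.mul_mem_right _ _ h₁

/-- The primality test with the identity map removes squares, hence exponents `2 ^ t`, and any power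
of `b` divides such a power. -/
theorem IsTambaraPrime.mem_of_pow_mem (hI : IsTambaraPrime I) (hG : IsCyclicPGroup G p r) {k : ℕ}
    (hk : k ≤ r) {b : R G p k}
    (hb : ∀ i < k, ∀ f : orbitH G p i →[G] orbitH G p k, resMap f b ∈ I (orbitH G p i)) {s : ℕ}
    (hs : b ^ s ∈ I (orbitH G p k)) : b ∈ I (orbitH G p k) := by
  have key (t : ℕ) : b ^ 2 ^ t ∈ I (orbitH G p k) → b ∈ I (orbitH G p k) := by
    induction t with
    | zero => rw [pow_zero, pow_one]; exact id
    | succ t ih =>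
      intro h
      have hb' : ∀ i < k, ∀ f : orbitH G p i →[G] orbitH G p k,
          resMap f (b ^ 2 ^ t) ∈ I (orbitH G p i) := fun i hi f => by
        rw [map_pow]
        exact Ideal.pow_mem_of_mem _ (hb i hi f) _ (by positivity)
      refine ih (or_self_iff.mp (hI.mem_or_mem_of_mulTransfer_mul hG hk hk (MulActionHom.id G)
        hb' hb' ?_))
      rwa [mulTransfer_id hG hk, ← pow_add, ← two_mul, ← pow_succ']
  exact key s (Ideal.pow_mem_of_pow_mem _ hs Nat.lt_two_pow_self.le)

end PrimeTest

/-! ### Classification of the prime ideals. -/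

section Classification

variable {G : Type u} [CommGroup G] [Finite G] {p r : ℕ} {I : Family G}

theorem nonempty_hom {i k : ℕ} (h : i ≤ k) : Nonempty (orbitH G p i →[G] orbitH G p k) :=
  ⟨orbitMap (basePt _) (subgroupH_le_stabilizer h _)⟩

theorem resMap_topElt (hG : IsCyclicPGroup G p r) {i k : ℕ} (hk : k ≤ r) (hi : i < k)
    (f : orbitH G p i →[G] orbitH G p k) : resMap f (topElt k) = 0 := by
  refine eq_zero_of_phi hG (by omega) fun j hj => ?_
  rw [phi_resMap hj, phi_topElt_of_lt hG hk (by omega)]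

/-- Since `topElt 0 = 1`, membership would propagate `1` to all orbits by multiplicative transfer,
and `I` would not be proper. This starts the search for the largest excluded index. -/
theorem IsTambaraPrime.topElt_zero_notMem (hI : IsTambaraPrime I) (hG : IsCyclicPGroup G p r) :
    topElt 0 ∉ I (orbitH G p 0) := by
  have hT := hI.isTambaraIdeal
  intro h
  have key (k : ℕ) (hk : k ≤ r) : (1 : R G p k) ∈ I (orbitH G p k) := by
    induction k with
    | zero => exact h
    | succ k ih =>
      have h₁ := hT.mulTransfer_mem_orbitH hG hk (projH G p k) (ih (by omega))
      have h₂ : jnd G p k 1 = 1 := eq_of_phi hG hk fun j hj => by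
        rcases hj.eq_or_lt with rfl | hj'
        · rw [phi_jnd_top hG hk, phi_one le_rfl, phi_one le_rfl]
        · rw [phi_jnd hG hk (by omega), phi_one (by omega), phi_one hj, one_pow]
      rw [← h₂]
      exact h₁
  obtain ⟨X, hX⟩ := hI.proper
  refine hX ((Ideal.eq_top_iff_one _).mpr ((hT.mem_iff_resMap hG).mpr fun k hk f => ?_))
  rw [map_one]
  exact key k hk

/-- The integers `c` with `c • topElt n ∈ I`. -/
def topIdeal (p : ℕ) (I : Family G) (n : ℕ) : Ideal ℤ where
  carrier := { c | (c : R G p n) * topElt n ∈ I (orbitH G p n) }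
  add_mem' := fun ha hb => by
    change ((_ + _ : ℤ) : R G p n) * topElt n ∈ I (orbitH G p n)
    rw [Int.cast_add, add_mul]
    exact Ideal.add_mem _ ha hb
  zero_mem' := by
    change ((0 : ℤ) : R G p n) * topElt n ∈ I (orbitH G p n)
    rw [Int.cast_zero, zero_mul]
    exact Ideal.zero_mem _
  smul_mem' := fun c a ha => by
    change ((c * a : ℤ) : R G p n) * topElt n ∈ I (orbitH G p n)
    rw [Int.cast_mul, mul_assoc]
    exact Ideal.mul_mem_left _ _ ha

theorem mem_topIdeal {n : ℕ} {c : ℤ} :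
    c ∈ topIdeal p I n ↔ (c : R G p n) * topElt n ∈ I (orbitH G p n) := Iff.rfl

/-- Multiples of `topElt n` restrict to zero on proper suborbits, so the orbit test for primality
applies to `c * topElt n` and `d * topElt n`. -/
theorem IsTambaraPrime.isPrime_topIdeal (hI : IsTambaraPrime I) (hG : IsCyclicPGroup G p r) {n : ℕ}
    (hn : n ≤ r) (htop : topElt n ∉ I (orbitH G p n)) : (topIdeal p I n).IsPrime := by
  refine ⟨fun h => htop ?_, fun {c d} hcd => ?_⟩
  · have := (Ideal.eq_top_iff_one _).mp h
    rwa [mem_topIdeal, Int.cast_one, one_mul] at this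
  · have hres (c : ℤ) : ∀ i < n, ∀ f : orbitH G p i →[G] orbitH G p n,
        resMap f ((c : R G p n) * topElt n) ∈ I (orbitH G p i) := fun i hi f => by
      rw [map_mul, resMap_topElt hG hn hi, mul_zero]
      exact Ideal.zero_mem _
    refine hI.mem_or_mem_of_mulTransfer_mul hG hn hn (MulActionHom.id G) (hres c) (hres d) ?_
    rw [mulTransfer_id hG hn]
    have h := Ideal.mul_mem_right (topElt n) _ (mem_topIdeal.mp hcd)
    convert h using 1
    push_cast
    ring

/-- Restrict `a` to `G / H_j` and transfer it to `G / H_n`: the mark at `H_j` becomes the top mark,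
which multiplication by `topElt n` isolates. -/
theorem phi_mem_topIdeal (hI : IsTambaraIdeal I) (hG : IsCyclicPGroup G p r) {j k n : ℕ}
    (hk : k ≤ r) (hn : n ≤ r) (hj : j ≤ n) {a : R G p k} (ha : a ∈ I (orbitH G p k)) :
    phi k j a ∈ topIdeal p I n := by
  by_cases hjk : j ≤ k
  · obtain ⟨f⟩ := nonempty_hom (G := G) (p := p) hjk
    obtain ⟨g⟩ := nonempty_hom (G := G) (p := p) hj
    have h := hI.mulTransfer_mem_orbitH hG hn g (hI.resMap_mem _ _ f a ha)
    have h' := Ideal.mul_mem_left _ (topElt n) h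
    rwa [topElt_mul hG hn, phi_mulTransfer_top hG (hjk.trans hk) hn, phi_resMap le_rfl] at h'
  · rw [phi_eq_zero hG (by omega) hk (by omega)]
    exact Ideal.zero_mem _

/-- Strong induction supplies the proper restrictions required by the primality test. Up to level
`n` the test is made against `topElt n`; above it, `topElt k ∈ I` is used to show that a power of
`a` lies in `I`. -/
theorem IsTambaraPrime.mem_of_phi_mem (hI : IsTambaraPrime I) (hG : IsCyclicPGroup G p r)
    {n : ℕ} (hn : n ≤ r) (htop : topElt n ∉ I (orbitH G p n))
    (htop' : ∀ k, n < k → k ≤ r → topElt k ∈ I (orbitH G p k)) {k : ℕ} (hk : k ≤ r) {a : R G p k}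
    (ha : ∀ j ≤ n, phi k j a ∈ topIdeal p I n) : a ∈ I (orbitH G p k) := by
  have hT := hI.isTambaraIdeal
  induction k using Nat.strong_induction_on with | _ k ih
  have hres : ∀ i < k, ∀ f : orbitH G p i →[G] orbitH G p k, resMap f a ∈ I (orbitH G p i) := by
    refine fun i hi f => ih i hi (by omega) fun j hj => ?_
    by_cases hji : j ≤ i
    · rw [phi_resMap hji]
      exact ha j hj
    · rw [phi_eq_zero hG (by omega) (by omega) (by omega)]
      exact Ideal.zero_mem _
  rcases le_or_gt k n with hkn | hkn
  · obtain ⟨g⟩ := nonempty_hom (G := G) (p := p) hkn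
    refine (hI.mem_or_mem_of_mulTransfer_mul hG hk hn g hres (b := topElt n)
      (fun i hi f => ?_) ?_).resolve_right htop
    · rw [resMap_topElt hG hn hi]
      exact Ideal.zero_mem _
    · rw [mul_comm, topElt_mul hG hn, phi_mulTransfer_top hG hk hn]
      exact ha k hkn
  · obtain ⟨k, rfl⟩ := Nat.exists_eq_add_one_of_ne_zero (Nat.ne_zero_of_lt hkn)
    -- The exponent `p` is the one by which `jnd` raises lower marks, so `a ^ p` and `jnd (res a)`
    -- differ by a multiple of the top element.
    refine hI.mem_of_pow_mem hG hk hres (s := p) ?_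
    have h₁ : jnd G p k (res G p k a) ∈ I (orbitH G p (k + 1)) :=
      hT.mulTransfer_mem_orbitH hG hk _ (hres k (by omega) (projH G p k))
    obtain ⟨c, hc⟩ := eq_intCast_mul_topElt hG hk (a := a ^ p - jnd G p k (res G p k a))
      fun j hj => by
        rw [map_sub, phi_pow (by omega), phi_jnd hG hk hj, phi_res hj, sub_self]
    rw [← sub_add_cancel (a ^ p) (jnd G p k (res G p k a)), hc]
    exact Ideal.add_mem _ (Ideal.mul_mem_left _ _ (htop' (k + 1) hkn hk)) h₁

/-- The prime ideals of the Burnside Tambara functor of a cyclic `p`-group. -/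
theorem IsTambaraPrime.exists_eq_markFamily (hI : IsTambaraPrime I) (hG : IsCyclicPGroup G p r) :
    ∃ n ≤ r, ∃ q : ℕ, (q.Prime ∨ q = 0) ∧ I = markFamily (subgroupH G p n) q := by
  classical
  have hT := hI.isTambaraIdeal
  -- The default value of `findGreatest` is harmless, since `topElt 0` is never in `I`.
  set n := Nat.findGreatest (fun k => topElt k ∉ I (orbitH G p k)) r with hn_def
  have hn : n ≤ r := Nat.findGreatest_le r
  have htop : topElt n ∉ I (orbitH G p n) :=
    Nat.findGreatest_spec (P := fun k => topElt k ∉ I (orbitH G p k)) (Nat.zero_le r)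
      (hI.topElt_zero_notMem hG)
  have htop' (k : ℕ) (hnk : n < k) (hk : k ≤ r) : topElt k ∈ I (orbitH G p k) :=
    not_not.mp (Nat.findGreatest_is_greatest hnk hk)
  have hprime := hI.isPrime_topIdeal hG hn htop
  obtain ⟨c, hc⟩ := (IsPrincipalIdealRing.principal (topIdeal p I n)).principal
  have hmem (d : ℤ) : d ∈ topIdeal p I n ↔ (c.natAbs : ℤ) ∣ d := by
    rw [hc, Int.natAbs_dvd]
    exact Ideal.mem_span_singleton
  refine ⟨n, hn, c.natAbs, ?_, ?_⟩
  · by_cases hc0 : c = 0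
    · exact Or.inr (by rw [hc0, Int.natAbs_zero])
    · refine Or.inl (Int.prime_iff_natAbs_prime.mp ((Ideal.span_singleton_prime hc0).mp ?_))
      rw [hc] at hprime
      exact hprime
  · funext X
    ext a
    rw [hT.mem_iff_resMap hG, mem_markFamily_iff_resMap hG]
    refine forall_congr' fun k => forall_congr' fun hk => forall_congr' fun f => ?_
    rw [mem_markFamily_orbitH hG hn]
    simp only [← hmem]
    exact ⟨fun h j hj => phi_mem_topIdeal hT hG hk hn hj h, hI.mem_of_phi_mem hG hn htop htop' hk⟩

end Classification

/-! ### The chains and the whole spectrum. -/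

section Spectrum

variable {G : Type u} [CommGroup G] [Finite G] {p r : ℕ}

/-- The element `topElt n` separates the two ideals: its marks below `n` vanish and its mark at `n >
0` is `p`. -/
theorem markFamily_lt (hG : IsCyclicPGroup G p r) {m n q : ℕ} (hn : n ≤ r) (hmn : m < n)
    (hqp : ¬ (q : ℤ) ∣ p) : markFamily (subgroupH G p n) q < markFamily (subgroupH G p m) q := by
  refine lt_of_le_not_ge (markFamily_anti (subgroupH_mono hmn.le) q) fun h => hqp ?_
  have h₁ : topElt n ∈ markFamily (subgroupH G p m) q (orbitH G p n) := by
    refine (mem_markFamily_orbitH hG (hmn.le.trans hn)).mpr fun j hj => ?_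
    rw [phi_topElt_of_lt hG hn (hj.trans_lt hmn)]
    exact dvd_zero _
  have h₂ := (mem_markFamily_orbitH hG hn).mp (h _ h₁) n le_rfl
  rwa [phi_topElt_self hG hn, topMark, if_neg (Nat.ne_zero_of_lt hmn)] at h₂

theorem strictMono_markFamily (hG : IsCyclicPGroup G p r) {q : ℕ} (hqp : ¬ (q : ℤ) ∣ p) :
    StrictMono fun i : Fin (r + 1) => markFamily (subgroupH G p (r - i)) q := by
  intro i j hij
  have := j.2
  have hij' : (i : ℕ) < j := hij
  exact markFamily_lt hG (by omega) (by omega) hqp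

theorem idealR0_injective (hG : IsCyclicPGroup G p r) {q q' : ℕ}
    (h : idealR0 G p q = idealR0 G p q') : q = q' := by
  have key {a b : ℕ} (h : idealR0 G p a = idealR0 G p b) : a ∣ b := by
    have hb : (b : R G p 0) ∈ idealR0 G p a := h ▸ Ideal.mem_span_singleton_self _
    rw [← markFamily_orbitH_zero hG (Nat.zero_le r), mem_markFamily_orbitH hG (Nat.zero_le r)] at hb
    have := hb 0 le_rfl
    rwa [phi_natCast le_rfl, Int.natCast_dvd_natCast] at this
  exact Nat.dvd_antisymm (key h) (key h.symm)

theorem idealR0_zero : idealR0 G p 0 = ⊥ := by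
  rw [idealR0, Nat.cast_zero, Ideal.span_singleton_eq_bot]

/-- The value at `G / H_0` determines `q`, leaving only `n = r - i` free. The case `q = p` is
allowed; there the range has a single element. -/
theorem primesOver_idealR0 (hG : IsCyclicPGroup G p r) {q : ℕ} (hq : q.Prime ∨ q = 0) :
    primesOver p (idealR0 G p q) =
      Set.range fun i : Fin (r + 1) => markFamily (subgroupH G p (r - i)) q := by
  ext P
  constructor
  · rintro ⟨hP, hP'⟩
    obtain ⟨n, hn, q', hq', rfl⟩ := IsTambaraPrime.exists_eq_markFamily hP hG
    rw [markFamily_orbitH_zero hG hn] at hP'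
    obtain rfl := idealR0_injective hG hP'
    refine ⟨⟨r - n, by omega⟩, ?_⟩
    change markFamily (subgroupH G p (r - (r - n))) q' = _
    rw [Nat.sub_sub_self hn]
  · rintro ⟨i, rfl⟩
    exact ⟨isTambaraPrime_markFamily _ hq, markFamily_orbitH_zero hG (Nat.sub_le r i) q⟩

theorem markFamily_top_zero (hG : IsCyclicPGroup G p r) : markFamily (subgroupH G p r) 0 = ⊥ := by
  refine le_bot_iff.mp fun X a ha => ?_
  have key (x : X) (H : Subgroup G) (hH : H ≤ MulAction.stabilizer G x) :
      resMap (orbitMap x hH) a = 0 := by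
    obtain ⟨k, hk, rfl⟩ := exists_eq_subgroupH hG H
    have := (mem_markFamily_iff_resMap hG _ _).mp ha k hk (orbitMap x hH)
    rwa [markFamily_zero_orbitH hG le_rfl hk, Ideal.mem_bot] at this
  obtain ⟨n, x, hx⟩ := eq_sum_orbits G X
  refine Ideal.mem_bot.mpr ((hx a).trans (Finset.sum_eq_zero fun i _ => ?_))
  rw [key, map_zero]

theorem ofSeq_seqLS (hG : IsCyclicPGroup G p r) {q i : ℕ} (hi : i ≤ r) (hq : q.Prime)
    (hqp : q ≠ p) : ofSeq (seqLS G p r q i) = markFamily (subgroupH G p (r - i)) q :=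
  ofSeq_eq_markFamily hG (by omega) (isSeqOf_seqLS hG hi hq hqp)

theorem ofSeq_seqL0 (hG : IsCyclicPGroup G p r) {i : ℕ} (hi : i ≤ r) :
    ofSeq (seqL0 G p r i) = markFamily (subgroupH G p (r - i)) 0 :=
  ofSeq_eq_markFamily hG (by omega) (isSeqOf_seqL0 hG hi)

theorem ofSeq_seqLp (hG : IsCyclicPGroup G p r) :
    ofSeq (seqLp G p r) = markFamily (subgroupH G p 0) p :=
  ofSeq_eq_markFamily hG (by omega) (isSeqOf_seqLp hG)

theorem spec_eq (hG : IsCyclicPGroup G p r) : spec G =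
    {ofSeq (seqLp G p r)} ∪ {P | ∃ i ≤ r, P = ofSeq (seqL0 G p r i)} ∪
      {P | ∃ i ≤ r, ∃ q : ℕ, q.Prime ∧ q ≠ p ∧ P = ofSeq (seqLS G p r q i)} := by
  ext P
  constructor
  · intro hP
    obtain ⟨n, hn, q, hq, rfl⟩ := IsTambaraPrime.exists_eq_markFamily hP hG
    rcases hq with hq | rfl
    · by_cases hqp : q = p
      · subst hqp
        refine Or.inl (Or.inl ?_)
        rw [Set.mem_singleton_iff, ofSeq_seqLp hG]
        exact markFamily_prime hG _
      · refine Or.inr ⟨r - n, Nat.sub_le r n, q, hq, hqp, ?_⟩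
        rw [ofSeq_seqLS hG (Nat.sub_le r n) hq hqp, Nat.sub_sub_self hn]
    · refine Or.inl (Or.inr ⟨r - n, Nat.sub_le r n, ?_⟩)
      rw [ofSeq_seqL0 hG (Nat.sub_le r n), Nat.sub_sub_self hn]
  · rintro ((rfl | ⟨i, hi, rfl⟩) | ⟨i, hi, q, hq, hqp, rfl⟩)
    · rw [ofSeq_seqLp hG]
      exact isTambaraPrime_markFamily _ (Or.inl hG.prime)
    · rw [ofSeq_seqL0 hG hi]
      exact isTambaraPrime_markFamily _ (Or.inr rfl)
    · rw [ofSeq_seqLS hG hi hq hqp]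
      exact isTambaraPrime_markFamily _ (Or.inl hq)

end Spectrum

end Burnside

theorem mainTheorem1 {G : Type u} [CommGroup G] [Finite G] [IsCyclic G] (p r : ℕ)
    (hp : p.Prime) (hG : Nat.card G = p ^ r) :
    -- Primes over `(q)`, for `q ≠ p`: the chain `𝓢^r(q) ⊊ 𝓛𝓢^{r-1}(q) ⊊ … ⊊ 𝓛^r(q)`.
    (∀ q : ℕ, q.Prime → q ≠ p →
      (∀ i : Fin (r + 1), Burnside.IsSeqOf (Burnside.ofSeq (Burnside.seqLS G p r q i))
        (Burnside.seqLS G p r q i)) ∧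
      StrictMono (fun i : Fin (r + 1) => Burnside.ofSeq (Burnside.seqLS G p r q i)) ∧
      Burnside.primesOver p (Burnside.idealR0 G p q) =
        Set.range (fun i : Fin (r + 1) => Burnside.ofSeq (Burnside.seqLS G p r q i))) ∧
    -- Primes over `(p)`: only `𝓛^r(p)`.
    (Burnside.IsSeqOf (Burnside.ofSeq (Burnside.seqLp G p r)) (Burnside.seqLp G p r) ∧
      Burnside.primesOver p (Burnside.idealR0 G p p) =
        {Burnside.ofSeq (Burnside.seqLp G p r)}) ∧
    -- Primes over `0`: the chain `0 ⊊ 𝓛(0) ⊊ … ⊊ 𝓛^r(0)`.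
    ((∀ i : Fin (r + 1), Burnside.IsSeqOf (Burnside.ofSeq (Burnside.seqL0 G p r i))
        (Burnside.seqL0 G p r i)) ∧
      Burnside.ofSeq (Burnside.seqL0 G p r 0) = ⊥ ∧
      StrictMono (fun i : Fin (r + 1) => Burnside.ofSeq (Burnside.seqL0 G p r i)) ∧
      Burnside.primesOver p (⊥ : Ideal (Burnside.R G p 0)) =
        Set.range (fun i : Fin (r + 1) => Burnside.ofSeq (Burnside.seqL0 G p r i))) ∧
    -- The ring `R_0` is the ring of integers, and the whole spectrum.
    Nonempty (Burnside.R G p 0 ≃+* ℤ) ∧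
    Burnside.spec G =
      {Burnside.ofSeq (Burnside.seqLp G p r)} ∪
        {P | ∃ i ≤ r, P = Burnside.ofSeq (Burnside.seqL0 G p r i)} ∪
        {P | ∃ i ≤ r, ∃ q : ℕ, q.Prime ∧ q ≠ p ∧
          P = Burnside.ofSeq (Burnside.seqLS G p r q i)} := by
  have h : Burnside.IsCyclicPGroup G p r := ⟨hp, inferInstance, hG⟩
  have hle (i : Fin (r + 1)) : (i : ℕ) ≤ r := Nat.lt_succ_iff.mp i.2
  refine ⟨fun q hq hqp => ?_, ⟨?_, ?_⟩, ⟨fun i => ?_, ?_, ?_, ?_⟩,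
    Burnside.nonempty_ringEquiv_int h, Burnside.spec_eq h⟩
  · have hqp' : ¬ (q : ℤ) ∣ p := fun hd =>
      hqp ((Nat.prime_dvd_prime_iff_eq hq hp).mp (Int.natCast_dvd_natCast.mp hd))
    simp only [Burnside.ofSeq_seqLS h (hle _) hq hqp]
    exact ⟨fun i => Burnside.isSeqOf_seqLS h (hle i) hq hqp,
      Burnside.strictMono_markFamily h hqp', Burnside.primesOver_idealR0 h (Or.inl hq)⟩
  · rw [Burnside.ofSeq_seqLp h]
    exact Burnside.isSeqOf_seqLp h
  · rw [Burnside.ofSeq_seqLp h, Burnside.primesOver_idealR0 h (Or.inl hp)]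
    -- All `r + 1` candidates over `(p)` coincide, so the range is constant.
    simp only [Burnside.markFamily_prime h (Burnside.subgroupH G p (r - _))]
    exact Set.range_const
  · rw [Burnside.ofSeq_seqL0 h (hle i)]
    exact Burnside.isSeqOf_seqL0 h (hle i)
  · rw [Burnside.ofSeq_seqL0 h (Nat.zero_le r)]
    exact Burnside.markFamily_top_zero h
  · simp only [Burnside.ofSeq_seqL0 h (hle _)]
    exact Burnside.strictMono_markFamily h
      -- For `q = 0` the strictness condition says that `0` does not divide `p`.
      fun hd => hp.ne_zero (by simpa using hd)
  · simp only [Burnside.ofSeq_seqL0 h (hle _)]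
    rw [← Burnside.idealR0_zero]
    exact Burnside.primesOver_idealR0 h (Or.inr rfl)
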